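/- For $x\in\mathbb{R}_{\ge 0}^m$ and $\ell\in\{1,\dots,m\}$ let $\mathrm{Top}_\ell(x)$ be the sum of the $\ell$ largest coordinates of $x$. In stochastic $\mathrm{Top}_\ell$-norm load balancing there are $m\ge 1$ identical machines and $n$ jobs with independent, nonnegative, integrable random sizes $X_1,\dots,X_n$. An assignment $\sigma:[n]\to[m]$ induces the random load vector $\mathrm{load}_\sigma$ with coordinates $\mathrm{load}_\sigma(i)=\sum_{j:\sigma(j)=i}X_j$ for $i\in[m]$. It is an $\alpha$-approximation if $\mathbb{E}[\mathrm{Top}_\ell(\mathrm{load}_\sigma)]\le\alpha\,\mathbb{E}[\mathrm{Top}_\ell(\mathrm{load}_\tau)]$ for every assignment $\tau:[n]\to[m]$. Theorem. There are a constant $C$ and a randomized algorithm with the following property. On every such instance, given $m$ and $n$, it runs in time polynomial in $m+n$ and, with probability at least $2/3$ over its own coin flips, outputs an assignment $\sigma:[n]\to[m]$ that is, simultaneously for all $\ell\in\{1,2,4,\dots,2^{\lfloor\log_2 m\rfloor}\}$, a $C\cdot\max\{1,\log\log m\}$-approximation for stochastic $\mathrm{Top}_\ell$-norm load balancing (for $m=1$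 the maximum is read as $1$). Here the algorithm is a program for a real RAM (unit-cost arithmetic and comparisons of real numbers, without rounding) with fair coin flips. It has access to the job-size distributions through unit-cost queries that return, for a job $j$, a real $\theta$ and an integer $\lambda\ge1$, the mean $\mathbb{E}[X_j\mathbf{1}_{X_j\ge\theta}]$ and, for $\theta>0$, the $\lambda$-effective size of $X_j\mathbf{1}_{X_j<\theta}/(4\theta)$. The $\lambda$-effective size of $Z$ is $\log_\lambda\mathbb{E}[\lambda^Z]$ for $\lambda>1$ and $\mathbb{E}[Z]$ for $\lambda=1$. -/

import Mathlib

open MeasureTheory ProbabilityTheory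

noncomputable section

/-! ## Stochastic load balancing with Top-`ℓ` norms -/

namespace StochLB

/-- The load vector of the assignment `σ` for job sizes `x`: machine `i` receives the total size
of the jobs assigned to it. -/
def load {m n : ℕ} (σ : Fin n → Fin m) (x : Fin n → ℝ) : Fin m → ℝ :=
  fun i => ∑ j with σ j = i, x j

/-- The Top-`ℓ` norm of a (nonnegative) vector: the coordinates are rearranged in non-increasing
order (the permutation `Tuple.sort (-x)` does that) and the first `ℓ` of them are added. -/
def topNorm {m : ℕ} (ℓ : ℕ) (x : Fin m → ℝ) : ℝ :=
  ∑ i : Fin m with Fin.val i < ℓ, x (Tuple.sort (fun k => -x k) i)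

/-- `POS m = {1, 2, 4, …, 2 ^ ⌊log₂ m⌋}`. -/
def POS (m : ℕ) : Finset ℕ :=
  (Finset.range (Nat.log 2 m + 1)).image (fun k => 2 ^ k)

variable {Ω : Type*} [MeasurableSpace Ω]

/-- The objective: the expected Top-`ℓ` norm of the random load vector of `σ`. -/
def expTop {m n : ℕ} (P : Measure Ω) (X : Fin n → Ω → ℝ) (ℓ : ℕ) (σ : Fin n → Fin m) : ℝ :=
  ∫ ω, topNorm ℓ (load σ (fun j => X j ω)) ∂P

/-- `σ` is an `α`-approximation for stochastic Top-`ℓ`-norm load balancing: its objective value is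
at most `α` times that of every assignment, hence at most `α` times the optimum. -/
def IsApprox {m n : ℕ} (P : Measure Ω) (X : Fin n → Ω → ℝ) (ℓ : ℕ) (α : ℝ)
    (σ : Fin n → Fin m) : Prop :=
  ∀ τ : Fin n → Fin m, expTop P X ℓ σ ≤ α * expTop P X ℓ τ

/-- The truncated random variable `Z · 1_{Z < θ}`. -/
def trunc (Z : Ω → ℝ) (θ : ℝ) : Ω → ℝ := Set.indicator {ω | Z ω < θ} Z

/-- The exceptional random variable `Z · 1_{Z ≥ θ}`. -/
def exceptional (Z : Ω → ℝ) (θ : ℝ) : Ω → ℝ := Set.indicator {ω | θ ≤ Z ω} Z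

/-- The `lam`-effective size of `Z`: `log_lam E[lam ^ Z]` for `lam > 1`, and `E[Z]` for
`lam = 1`. -/
def effSize (P : Measure Ω) (lam : ℝ) (Z : Ω → ℝ) : ℝ :=
  if lam = 1 then ∫ ω, Z ω ∂P else Real.logb lam (∫ ω, lam ^ Z ω ∂P)

/-! ## The machine model

Algorithms are finite programs of a loop language on a random access memory whose cells hold
natural numbers or real numbers: a real RAM (unit-cost `+`, `-`, `*`, `/`, `≤` on reals, no
rounding of reals, no real constants other than naturals) with addition and truncated subtraction
on naturals, fair coins, and unit-cost access to the job-size distributions. -/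

/-- The access to the distribution of job `j` that programs have: `excMean j θ` is the mean of the
exceptional part of its size, and `truncEff j lam θ` is the `lam`-effective size of its truncated
part, scaled by `1 / (4 θ)`. -/
structure JobAccess where
  excMean : ℕ → ℝ → ℝ
  truncEff : ℕ → ℕ → ℝ → ℝ

/-- The access given by jobs `X 0, …, X (n - 1)`. Queries about other indices return `0`. -/
def jobAccess {n : ℕ} (P : Measure Ω) (X : Fin n → Ω → ℝ) : JobAccess where
  excMean j θ := if h : j < n then ∫ ω, exceptional (X ⟨j, h⟩) θ ω ∂P else 0
  truncEff j lam θ :=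
    if h : j < n then effSize P lam (fun ω => trunc (X ⟨j, h⟩) θ ω / (4 * θ)) else 0

/-- An address `(a, i, j)` is entry `(i, j)` of the two-dimensional array with name `a`. -/
abbrev Addr : Type := ℕ × ℕ × ℕ

/-- The memory, together with the number of steps made so far. -/
structure State where
  nat : Addr → ℕ
  real : Addr → ℝ
  steps : ℕ

/-- Expressions with values in the natural numbers. -/
inductive NExp : Type
  | lit (k : ℕ)
  | get (a : ℕ) (i j : NExp)
  | add (e₁ e₂ : NExp)
  | sub (e₁ e₂ : NExp)

def NExp.eval (s : State) : NExp → ℕ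
  | lit k => k
  | get a i j => s.nat (a, i.eval s, j.eval s)
  | add e₁ e₂ => e₁.eval s + e₂.eval s
  | sub e₁ e₂ => e₁.eval s - e₂.eval s

/-- Expressions with values in the real numbers. -/
inductive RExp : Type
  | ofNat (e : NExp)
  | get (a : ℕ) (i j : NExp)
  | add (e₁ e₂ : RExp)
  | sub (e₁ e₂ : RExp)
  | mul (e₁ e₂ : RExp)
  | div (e₁ e₂ : RExp)

def RExp.eval (s : State) : RExp → ℝ
  | ofNat e => (e.eval s : ℝ)
  | get a i j => s.real (a, i.eval s, j.eval s)
  | add e₁ e₂ => e₁.eval s + e₂.eval s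
  | sub e₁ e₂ => e₁.eval s - e₂.eval s
  | mul e₁ e₂ => e₁.eval s * e₂.eval s
  | div e₁ e₂ => e₁.eval s / e₂.eval s

/-- Tests. -/
inductive Test : Type
  | natLE (e₁ e₂ : NExp)
  | realLE (e₁ e₂ : RExp)
  | not (b : Test)
  | and (b₁ b₂ : Test)

def Test.Holds (s : State) : Test → Prop
  | natLE e₁ e₂ => e₁.eval s ≤ e₂.eval s
  | realLE e₁ e₂ => e₁.eval s ≤ e₂.eval s
  | not b => ¬ b.Holds s
  | and b₁ b₂ => b₁.Holds s ∧ b₂.Holds s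

/-- Programs. The first three arguments `a i j` of a command that writes are the address it writes
to. The command `loop a e body` evaluates `e` once, to `k` say, and executes `body` for the values
`0, 1, …, k - 1` of the loop variable, which is the cell `(a, 0, 0)`. -/
inductive Prog : Type
  | skip
  | setNat (a : ℕ) (i j : NExp) (e : NExp)
  | setReal (a : ℕ) (i j : NExp) (e : RExp)
  | coin (a : ℕ) (i j : NExp)
  | excMean (a : ℕ) (i j : NExp) (job : NExp) (θ : RExp)
  | truncEff (a : ℕ) (i j : NExp) (job lam : NExp) (θ : RExp)
  | seq (p q : Prog)
  | ite (b : Test) (p q : Prog)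
  | loop (a : ℕ) (e : NExp) (body : Prog)

namespace State

/-- Count one step. -/
def tick (s : State) : State := { s with steps := s.steps + 1 }

def writeNat (s : State) (x : Addr) (v : ℕ) : State :=
  { s with nat := Function.update s.nat x v }

def writeReal (s : State) (x : Addr) (v : ℝ) : State :=
  { s with real := Function.update s.real x v }

/-- The initial state: cell `(0, 0, 0)` holds the number `m` of machines, cell `(0, 1, 0)` holds
the number `n` of jobs, all other cells are zero. -/
def init (m n : ℕ) : State where
  nat := Function.update (Function.update (fun _ => 0) (0, 0, 0) m) (0, 1, 0) n
  real := fun _ => 0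
  steps := 0

/-- The state holds the assignment `σ` as its output: entry `(j, 0)` of array `1` is the machine
of job `j`. -/
def Outputs {m n : ℕ} (s : State) (σ : Fin n → Fin m) : Prop :=
  ∀ j : Fin n, s.nat (1, (j : ℕ), 0) = (σ j : ℕ)

end State

/-- Execute `f 0`, then `f 1`, …, then `f (k - 1)`. -/
def iterate (f : ℕ → State → PMF State) : ℕ → State → PMF State
  | 0, s => PMF.pure s
  | k + 1, s => (iterate f k s).bind (f k)

open Classical in
/-- The distribution of the final state of a program. Every assignment, coin flip, query, test and
round of a loop takes one step. (The size of an expression is fixed by the program, so charging for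
its operations would change the number of steps by a constant factor only.) -/
def Prog.run (J : JobAccess) : Prog → State → PMF State
  | skip, s => PMF.pure s.tick
  | setNat a i j e, s => PMF.pure (s.writeNat (a, i.eval s, j.eval s) (e.eval s)).tick
  | setReal a i j e, s => PMF.pure (s.writeReal (a, i.eval s, j.eval s) (e.eval s)).tick
  | coin a i j, s =>
      (PMF.uniformOfFintype Bool).bind fun b =>
        PMF.pure (s.writeNat (a, i.eval s, j.eval s) b.toNat).tick
  | excMean a i j job θ, s =>
      PMF.pure (s.writeReal (a, i.eval s, j.eval s) (J.excMean (job.eval s) (θ.eval s))).tick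
  | truncEff a i j job lam θ, s =>
      PMF.pure (s.writeReal (a, i.eval s, j.eval s)
        (J.truncEff (job.eval s) (lam.eval s) (θ.eval s))).tick
  | seq p q, s => (p.run J s).bind (q.run J)
  | ite b p q, s => if b.Holds s then p.run J s.tick else q.run J s.tick
  | loop a e body, s =>
      iterate (fun k s' => body.run J (s'.writeNat (a, 0, 0) k).tick) (e.eval s) s.tick

end StochLB

end

noncomputable section

namespace StochLB

section

/-! ### Top-`ℓ` norms as maxima over index sets -/

/-! The algorithm flips no coins. It reduces all norms at once to a vector scheduling problem with
one coordinate per norm, and solves that problem greedily.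

One norm. Let `ℓ = 2 ^ k`, let `D = numNorms m` be the number of norms, and let `λ = 2 ^ (D - k)`,
so that `m ≤ λ ℓ ≤ 2 m`. A threshold `θ` is good if the exceptional parts of the jobs have total
mean at most `ℓ θ` and the scaled truncated parts have total `λ`-effective size at most `11 m`. If
`θ > 0` is not good, every assignment costs at least `ℓ θ / 2` (`half_le_expTop_of_not_good`). If
the exceptional mean is too large, this follows by counting the first `ℓ` exceptional jobs. If the
effective size is too large, any assignment can be cut into `2 m` single-machine chunks of effective
size at least `3`. Each chunk exceeds `θ` with probability at least `1 / λ`, so the chunks take the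
role of the exceptional jobs. Conversely, if `θ` is good and every machine has effective size at
most `B`, the objective is `O(ℓ θ (B + 1))`, by the moment generating function of each load
(`expTop_le_of_effSize`). The program takes the least good `θ` among the multiples of `M / (n + m +
1)`, where `M` is the total mean size. The multiple just below it is not good and is at least `θ /
2`, so balancing up to `B` is an `O(B + 1)`-approximation (`isApprox_of_effSize_le`).

All norms. The effective sizes form vectors with `D` coordinates in `[0, 1 / 4]`, each coordinate
having total at most `11 m`. A machine should receive `O(log D) = O(log log m)` in every coordinate.
A uniformly random assignment keeps the expectation of a product potential constant, so a greedy
choice of machines never increases it (`potential_succ_le`). A union bound over all machines would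
cost `log m`. Instead, only machines whose `D` products sum to more than `D ^ 4` are given up. All
others already have load at most `8 log D`. The jobs on the overfull machines are so few that even
the sum of their largest coordinates is `O(m)` (`sum_overfull_le`), and list scheduling by the
largest coordinate spreads them with `O(1)` extra load per machine (`reassignProg_spec`).

The remaining work is the program itself: loop invariants show that it computes this, and its loops
have at most `n + m + 1` rounds. -/

theorem exists_topNorm_eq {m : ℕ} (ℓ : ℕ) (x : Fin m → ℝ) :
    ∃ I : Finset (Fin m), I.card ≤ ℓ ∧ topNorm ℓ x = ∑ i ∈ I, x i := by
  refine ⟨(Finset.univ.filter fun i : Fin m => i.val < ℓ).map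
    (Tuple.sort (fun k => -x k)).toEmbedding, ?_, ?_⟩
  · rw [Finset.card_map]
    calc _ ≤ (Finset.range ℓ).card :=
          Finset.card_le_card_of_injOn (fun i => i.val) (fun i hi => by simpa using hi)
            (fun a _ b _ h => Fin.ext h)
      _ = ℓ := Finset.card_range ℓ
  · rw [Finset.sum_map]; rfl

/-- Let `t` be the `ℓ`-th largest coordinate. A sum over at most `ℓ` indices is at most `∑ max (x i
- t) 0 + ℓ t`, with equality for the top `ℓ` indices. -/
theorem sum_le_topNorm {m : ℕ} (ℓ : ℕ) (x : Fin m → ℝ) (hx : ∀ i, 0 ≤ x i)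
    (I : Finset (Fin m)) (hI : I.card ≤ ℓ) : ∑ i ∈ I, x i ≤ topNorm ℓ x := by
  classical
  set e := Tuple.sort (fun k => -x k) with he
  set y : Fin m → ℝ := fun i => x (e i) with hy
  have hmono : ∀ i j : Fin m, i ≤ j → y j ≤ y i := by
    intro i j hij
    have := Tuple.monotone_sort (fun k => -x k) hij
    simpa [hy, he] using this
  set A := Finset.univ.filter fun i : Fin m => i.val < ℓ with hA
  have hIy : ∑ i ∈ I, x i = ∑ i ∈ I.map e.symm.toEmbedding, y i := by
    simp [Finset.sum_map, hy]
  have hT : topNorm ℓ x = ∑ i ∈ A, y i := rfl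
  rw [hIy, hT]
  set J := I.map e.symm.toEmbedding with hJ
  have hJc : J.card ≤ ℓ := by simpa [hJ] using hI
  have hy0 : ∀ i, 0 ≤ y i := fun i => hx _
  by_cases hm : m ≤ ℓ
  · refine Finset.sum_le_sum_of_subset_of_nonneg (fun i _ => ?_) (fun i _ _ => hy0 i)
    simp only [hA, Finset.mem_filter, Finset.mem_univ, true_and]
    exact lt_of_lt_of_le i.2 hm
  push Not at hm
  rcases Nat.eq_zero_or_pos ℓ with h0 | hpos
  · have : J = ∅ := by rw [← Finset.card_eq_zero]; omega
    rw [this]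
    simpa using Finset.sum_nonneg fun i _ => hy0 i
  set t := y ⟨ℓ - 1, by omega⟩ with ht
  have hAc : (A.card : ℝ) = ℓ := by
    have : A = (Finset.univ : Finset (Fin ℓ)).map (Fin.castLEEmb hm.le) := by
      ext i
      simp only [hA, Finset.mem_filter, Finset.mem_univ, true_and, Finset.mem_map]
      constructor
      · intro h; exact ⟨⟨i, h⟩, rfl⟩
      · rintro ⟨a, rfl⟩; exact a.2
    rw [this]; simp
  calc ∑ i ∈ J, y i ≤ ∑ i ∈ J, (max (y i - t) 0 + t) :=
        Finset.sum_le_sum fun i _ => by linarith [le_max_left (y i - t) 0]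
    _ = ∑ i ∈ J, max (y i - t) 0 + J.card * t := by
        rw [Finset.sum_add_distrib]; simp
    _ ≤ ∑ i, max (y i - t) 0 + ℓ * t := by
        have h1 : ∑ i ∈ J, max (y i - t) 0 ≤ ∑ i, max (y i - t) 0 :=
          Finset.sum_le_sum_of_subset_of_nonneg (Finset.subset_univ _)
            (fun i _ _ => le_max_right _ _)
        have h2 : (J.card : ℝ) * t ≤ ℓ * t :=
          mul_le_mul_of_nonneg_right (by exact_mod_cast hJc) (hy0 _)
        linarith
    _ = ∑ i ∈ A, (y i - t) + ℓ * t := by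
        congr 1
        rw [hA, Finset.sum_filter]
        refine Finset.sum_congr rfl fun i _ => ?_
        split_ifs with h
        · exact max_eq_left (sub_nonneg.2 (hmono _ _ (by rw [Fin.le_def]; simp; omega)))
        · exact max_eq_right (sub_nonpos.2 (hmono _ _ (by rw [Fin.le_def]; simp; omega)))
    _ = ∑ i ∈ A, y i := by
        rw [Finset.sum_sub_distrib]; simp [hAc]

theorem topNorm_nonneg {m : ℕ} (ℓ : ℕ) (x : Fin m → ℝ) (hx : ∀ i, 0 ≤ x i) :
    0 ≤ topNorm ℓ x := Finset.sum_nonneg fun _ _ => hx _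

theorem topNorm_le_sum {m : ℕ} (ℓ : ℕ) (x : Fin m → ℝ) (hx : ∀ i, 0 ≤ x i) :
    topNorm ℓ x ≤ ∑ i, x i := by
  obtain ⟨I, -, h⟩ := exists_topNorm_eq ℓ x
  rw [h]
  exact Finset.sum_le_sum_of_subset_of_nonneg (Finset.subset_univ _) fun i _ _ => hx i

theorem load_nonneg {m n : ℕ} (σ : Fin n → Fin m) (x : Fin n → ℝ) (hx : ∀ j, 0 ≤ x j)
    (i : Fin m) : 0 ≤ load σ x i := Finset.sum_nonneg fun _ _ => hx _

theorem sum_load {m n : ℕ} (σ : Fin n → Fin m) (x : Fin n → ℝ) :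
    ∑ i, load σ x i = ∑ j, x j := by
  simp only [load]
  exact Finset.sum_fiberwise _ _ _

/-! ### Truncated and exceptional parts -/

theorem trunc_nonneg {Ω : Type*} {Z : Ω → ℝ} (h0 : ∀ ω, 0 ≤ Z ω) (θ : ℝ) (ω : Ω) : 0 ≤ trunc Z θ ω :=
  Set.indicator_nonneg (fun ω _ => h0 ω) ω

theorem exceptional_nonneg {Ω : Type*} {Z : Ω → ℝ} (h0 : ∀ ω, 0 ≤ Z ω) (θ : ℝ) (ω : Ω) :
    0 ≤ exceptional Z θ ω :=
  Set.indicator_nonneg (fun ω _ => h0 ω) ω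

theorem trunc_add_exceptional {Ω : Type*} (Z : Ω → ℝ) (θ : ℝ) (ω : Ω) :
    trunc Z θ ω + exceptional Z θ ω = Z ω := by
  unfold trunc exceptional
  rcases lt_or_ge (Z ω) θ with h | h
  · simp [Set.indicator, h, not_le.2 h]
  · simp [Set.indicator, h, not_lt.2 h]

theorem trunc_le {Ω : Type*} {Z : Ω → ℝ} (h0 : ∀ ω, 0 ≤ Z ω) (θ : ℝ) (ω : Ω) : trunc Z θ ω ≤ Z ω :=
  Set.indicator_le_self' (fun ω _ => h0 ω) ω

theorem trunc_le_threshold {Ω : Type*} {Z : Ω → ℝ} {θ : ℝ} (hθ : 0 ≤ θ) (ω : Ω) : trunc Z θ ω ≤ θ := by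
  by_cases h : Z ω < θ
  · simpa [trunc, Set.indicator, h] using h.le
  · simpa [trunc, Set.indicator, h] using hθ

variable {Ω : Type*} [MeasurableSpace Ω]

/-- The sorting permutation depends on the outcome, so measurability is read off from the
description as a finite maximum of sums over index sets. -/
theorem measurable_topNorm_load {m n : ℕ} (ℓ : ℕ) (σ : Fin n → Fin m) {X : Fin n → Ω → ℝ}
    (hX : ∀ j, Measurable (X j)) (h0 : ∀ j ω, 0 ≤ X j ω) :
    Measurable fun ω => topNorm ℓ (load σ (fun j => X j ω)) := by
  classical
  have hne : ((Finset.univ : Finset (Finset (Fin m))).filter fun I => I.card ≤ ℓ).Nonempty :=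
    ⟨∅, by simp⟩
  have : (fun ω => topNorm ℓ (load σ (fun j => X j ω))) = fun ω =>
      ((Finset.univ : Finset (Finset (Fin m))).filter fun I => I.card ≤ ℓ).sup' hne
        (fun I ω => ∑ i ∈ I, load σ (fun j => X j ω) i) ω := by
    funext ω
    rw [Finset.sup'_apply]
    apply le_antisymm
    · obtain ⟨I, hI, h⟩ := exists_topNorm_eq ℓ (load σ (fun j => X j ω))
      rw [h]
      exact Finset.le_sup' (fun I => ∑ i ∈ I, load σ (fun j => X j ω) i) (by simpa using hI)
    · refine Finset.sup'_le _ _ fun I hI => ?_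
      exact sum_le_topNorm ℓ _ (load_nonneg σ _ (fun j => h0 j ω)) I (by simpa using hI)
  rw [this]
  refine Finset.measurable_sup' hne fun I _ => ?_
  unfold load
  fun_prop

theorem integrable_topNorm_load {m n : ℕ} (ℓ : ℕ) (σ : Fin n → Fin m) {P : Measure Ω}
    {X : Fin n → Ω → ℝ} (hX : ∀ j, Measurable (X j)) (h0 : ∀ j ω, 0 ≤ X j ω)
    (hi : ∀ j, Integrable (X j) P) :
    Integrable (fun ω => topNorm ℓ (load σ (fun j => X j ω))) P := by
  refine Integrable.mono' (integrable_finsetSum Finset.univ fun j _ => hi j)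
    (measurable_topNorm_load ℓ σ hX h0).aestronglyMeasurable (.of_forall fun ω => ?_)
  have hl := load_nonneg σ _ (fun j => h0 j ω)
  rw [Real.norm_of_nonneg (topNorm_nonneg ℓ _ hl)]
  exact (topNorm_le_sum ℓ _ hl).trans (sum_load σ _).le

theorem measurable_trunc {Z : Ω → ℝ} (hZ : Measurable Z) (θ : ℝ) : Measurable (trunc Z θ) :=
  hZ.indicator (measurableSet_lt hZ measurable_const)

theorem measurable_exceptional {Z : Ω → ℝ} (hZ : Measurable Z) (θ : ℝ) :
    Measurable (exceptional Z θ) :=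
  hZ.indicator (measurableSet_le measurable_const hZ)

theorem integrable_exceptional {P : Measure Ω} {Z : Ω → ℝ} (hZ : Measurable Z)
    (hi : Integrable Z P) (θ : ℝ) : Integrable (exceptional Z θ) P :=
  hi.indicator (measurableSet_le measurable_const hZ)

theorem integrable_trunc {P : Measure Ω} {Z : Ω → ℝ} (hZ : Measurable Z)
    (hi : Integrable Z P) (θ : ℝ) : Integrable (trunc Z θ) P :=
  hi.indicator (measurableSet_lt hZ measurable_const)

/-! ### A lower bound from exceptional parts -/

/-- The rank within `E` is injective on `E`, so at most `ℓ` elements have rank below `ℓ`. -/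
theorem card_filter_rank_lt {q : ℕ} (E : Finset (Fin q)) (ℓ : ℕ) :
    (E.filter fun c => (E.filter (· < c)).card < ℓ).card ≤ ℓ := by
  calc _ ≤ (Finset.range ℓ).card := by
        refine Finset.card_le_card_of_injOn (fun c => (E.filter (· < c)).card)
          (fun c hc => by simpa using (Finset.mem_filter.1 hc).2) ?_
        have key : ∀ a ∈ E, ∀ b, a < b →
            (E.filter (· < a)).card < (E.filter (· < b)).card := by
          intro a ha b hab
          apply Finset.card_lt_card
          refine ⟨fun c hc => ?_, fun h => ?_⟩
          · simp only [Finset.mem_filter] at hc ⊢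
            exact ⟨hc.1, hc.2.trans hab⟩
          · have := h (Finset.mem_filter.2 ⟨ha, hab⟩)
            simp at this
        intro a ha b hb hab
        simp only [Finset.coe_filter, Set.mem_ofPred_eq] at ha hb
        rcases lt_trichotomy a b with h | h | h
        · exact absurd hab (key a ha.1 b h).ne
        · exact h
        · exact absurd hab (key b hb.1 a h).ne'
    _ = ℓ := Finset.card_range ℓ

/-- Let the `W c` be nonnegative and let each of them be independent of the earlier ones.
If the sum of any `ℓ` of the variables `W c` is at most `T`, and the exceptional
parts of the `W c` have total mean at least `ℓ θ`, then `T` has mean at least `ℓ θ / 2`: stop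
counting after `ℓ` exceptional variables. -/
theorem half_le_integral_of_exceptional {q : ℕ} {P : Measure Ω} [IsProbabilityMeasure P]
    {W : Fin q → Ω → ℝ} (hW : ∀ c, Measurable (W c)) (h0 : ∀ c ω, 0 ≤ W c ω)
    (hi : ∀ c, Integrable (W c) P)
    (hind : ∀ c, IndepFun (W c)
      (fun ω (c' : (Finset.univ.filter (· < c) : Finset (Fin q))) => W c' ω) P)
    (ℓ : ℕ) {θ : ℝ}
    {T : Ω → ℝ} (hT : Integrable T P)
    (hWT : ∀ S : Finset (Fin q), S.card ≤ ℓ → ∀ ω, ∑ c ∈ S, W c ω ≤ T ω)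
    (h : ℓ * θ ≤ ∑ c, ∫ ω, exceptional (W c) θ ω ∂P) :
    ℓ * θ / 2 ≤ ∫ ω, T ω ∂P := by
  classical
  set E : Ω → Finset (Fin q) := fun ω => Finset.univ.filter fun c => θ ≤ W c ω with hE
  -- `cnt c` counts the exceptional variables before `c`. It depends on earlier variables only,
  -- hence is independent of `W c`.
  set cnt : Fin q → Ω → ℝ := fun c ω => ∑ c' with c' < c, Set.indicator {ω | θ ≤ W c' ω} 1 ω
    with hcnt
  have hcnt_eq : ∀ c ω, cnt c ω = ((E ω).filter (· < c)).card := by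
    intro c ω
    simp only [hcnt, hE, Set.indicator_apply, Set.mem_ofPred_eq, Pi.one_apply]
    rw [Finset.sum_boole, Finset.filter_filter, Finset.filter_filter]
    simp only [and_comm]
  have hms : ∀ c, MeasurableSet {ω | θ ≤ W c ω} := fun c =>
    measurableSet_le measurable_const (hW c)
  set tot : Ω → ℝ := fun ω => ∑ c, Set.indicator {ω | θ ≤ W c ω} 1 ω with htot
  have htot_eq : ∀ ω, tot ω = (E ω).card := by
    intro ω
    simp only [htot, hE, Set.indicator_apply, Set.mem_ofPred_eq, Pi.one_apply]
    rw [Finset.sum_boole]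
  have htm : Measurable tot := by
    refine Finset.measurable_sum _ fun c _ => ?_
    exact measurable_one.indicator (hms c)
  have hcm : ∀ c, Measurable (cnt c) := fun c => by
    refine Finset.measurable_sum _ fun c _ => ?_
    exact measurable_one.indicator (hms c)
  have hA : MeasurableSet {ω | tot ω < ℓ} := measurableSet_lt htm measurable_const
  set p := P.real {ω | tot ω < ℓ} with hp
  have hp1 : p ≤ 1 := measureReal_le_one
  have hp0 : 0 ≤ p := measureReal_nonneg
  have hT0 : ∀ ω, 0 ≤ T ω := fun ω => by simpa using hWT ∅ (by simp) ω
  -- many exceptional variables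
  have h1 : (1 - p) * (ℓ * θ) ≤ ∫ ω, T ω ∂P := by
    have hc : P.real {ω | tot ω < ℓ}ᶜ = 1 - p := by
      rw [measureReal_compl hA]; simp [hp]
    calc (1 - p) * (ℓ * θ) = ∫ ω, Set.indicator {ω | tot ω < ℓ}ᶜ (fun _ => ℓ * θ) ω ∂P := by
          rw [integral_indicator_const _ hA.compl, hc, smul_eq_mul]
      _ ≤ ∫ ω, T ω ∂P := by
          refine integral_mono ((integrable_const _).indicator hA.compl) hT fun ω => ?_
          by_cases hω : ω ∈ {ω | tot ω < ℓ}ᶜ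
          · rw [Set.indicator_of_mem hω]
            have hcard : ℓ ≤ (E ω).card := by
              have : (ℓ : ℝ) ≤ tot ω := not_lt.1 hω
              rw [htot_eq] at this
              exact_mod_cast this
            obtain ⟨S, hS, hSc⟩ := Finset.exists_subset_card_eq hcard
            refine le_trans ?_ (hWT S hSc.le ω)
            calc (ℓ : ℝ) * θ = ∑ c ∈ S, θ := by simp [hSc]
              _ ≤ _ := Finset.sum_le_sum fun c hc => by
                have := hS hc
                simpa [hE] using this
          · rw [Set.indicator_of_notMem hω]; exact hT0 ω
  -- few exceptional variables
  have h2 : p * (ℓ * θ) ≤ ∫ ω, T ω ∂P := by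
    -- The event `cnt c < ℓ` contains the event `tot < ℓ`, so it has probability at least `p`, and
    -- by independence the mean factors.
    have hterm : ∀ c, p * ∫ ω, exceptional (W c) θ ω ∂P ≤
        ∫ ω, exceptional (W c) θ ω * Set.indicator {ω | cnt c ω < ℓ} 1 ω ∂P := by
      intro c
      have hmc : MeasurableSet {ω | cnt c ω < ℓ} := measurableSet_lt (hcm c) measurable_const
      have hin : IndepFun (exceptional (W c) θ)
          (Set.indicator {ω | cnt c ω < ℓ} (1 : Ω → ℝ)) P := by
        have hf : Measurable (Set.indicator {y : ℝ | θ ≤ y} id) :=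
          measurable_id.indicator (measurableSet_le measurable_const measurable_id)
        have hg : Measurable fun x : (Finset.univ.filter (· < c) : Finset (Fin q)) → ℝ =>
            Set.indicator {x : (Finset.univ.filter (· < c) : Finset (Fin q)) → ℝ |
              ∑ c', Set.indicator {y : ℝ | θ ≤ y} (1 : ℝ → ℝ) (x c') < ℓ} (fun _ => (1 : ℝ)) x := by
          refine measurable_const.indicator (measurableSet_lt ?_ measurable_const)
          refine Finset.measurable_sum _ fun c' _ => ?_
          exact (measurable_one.indicator
            (measurableSet_le measurable_const measurable_id)).comp (measurable_pi_apply _)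
        have h3 := (hind c).comp hf hg
        convert h3 using 1
        · funext ω
          simp [Function.comp, Set.indicator_apply, exceptional]
        · funext ω
          simp only [Function.comp, Set.indicator_apply, Set.mem_ofPred_eq, hcnt, Pi.one_apply]
          rw [← Finset.sum_coe_sort]
      rw [hin.integral_fun_mul_eq_mul_integral
        (measurable_exceptional (hW c) θ).aestronglyMeasurable
        (measurable_one.indicator hmc).aestronglyMeasurable, mul_comm,
        integral_indicator_one hmc]
      refine mul_le_mul_of_nonneg_left ?_ (integral_nonneg (exceptional_nonneg (h0 c) θ))
      refine measureReal_mono fun ω hω => ?_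
      refine lt_of_le_of_lt ?_ (show tot ω < ℓ from hω)
      rw [hcnt_eq, htot_eq]
      exact_mod_cast Finset.card_le_card (Finset.filter_subset _ _)
    calc p * (ℓ * θ) ≤ p * ∑ c, ∫ ω, exceptional (W c) θ ω ∂P :=
          mul_le_mul_of_nonneg_left h hp0
      _ ≤ ∑ c, ∫ ω, exceptional (W c) θ ω * Set.indicator {ω | cnt c ω < ℓ} 1 ω ∂P := by
          rw [Finset.mul_sum]; exact Finset.sum_le_sum fun c _ => hterm c
      _ = ∫ ω, ∑ c, exceptional (W c) θ ω * Set.indicator {ω | cnt c ω < ℓ} 1 ω ∂P := by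
          rw [integral_finsetSum]
          intro c _
          exact (integrable_exceptional (hW c) (hi c) θ).mul_of_top_left
            (memLp_top_of_bound
              (measurable_one.indicator
                (measurableSet_lt (hcm c) measurable_const)).aestronglyMeasurable 1
              (.of_forall fun ω => by
                by_cases hx : cnt c ω < ℓ <;> simp [hx]))
      _ ≤ ∫ ω, T ω ∂P := by
          refine integral_mono_of_nonneg (.of_forall fun ω => ?_) hT (.of_forall fun ω => ?_)
          · exact Finset.sum_nonneg fun c _ => mul_nonneg (exceptional_nonneg (h0 c) θ ω)
              (Set.indicator_nonneg (fun _ _ => zero_le_one) ω)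
          · refine le_trans (le_of_eq ?_) (hWT _ (card_filter_rank_lt (E ω) ℓ) ω)
            simp only [hE, Finset.filter_filter, Finset.sum_filter, exceptional,
              Set.indicator_apply, Set.mem_ofPred_eq, hcnt_eq, Nat.cast_lt, Pi.one_apply]
            refine Finset.sum_congr rfl fun c _ => ?_
            by_cases ha : θ ≤ W c ω <;> simp [ha]
  -- The sum of `h1` and `h2` is `ℓ θ ≤ 2 E[T]`.
  linarith

end

section

/-! ### Effective sizes of scaled truncated parts -/

/-- The truncated part of `Z`, scaled by `1 / (4 θ)`. -/
def scaled {Ω : Type*} (Z : Ω → ℝ) (θ : ℝ) : Ω → ℝ := fun ω => trunc Z θ ω / (4 * θ)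

theorem scaled_nonneg {Ω : Type*} {Z : Ω → ℝ} (h0 : ∀ ω, 0 ≤ Z ω) {θ : ℝ} (hθ : 0 ≤ θ) (ω : Ω) :
    0 ≤ scaled Z θ ω := div_nonneg (trunc_nonneg h0 θ ω) (by positivity)

theorem scaled_le {Ω : Type*} {Z : Ω → ℝ} {θ : ℝ} (hθ : 0 ≤ θ) (ω : Ω) : scaled Z θ ω ≤ 1 / 4 := by
  rcases hθ.eq_or_lt with rfl | h
  · simp [scaled]
  · rw [scaled, div_le_iff₀ (by positivity)]
    linarith [trunc_le_threshold (Z := Z) hθ ω]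

theorem sum_le_card_mul {Ω : Type*} {n : ℕ} {Z : Fin n → Ω → ℝ} {b : ℝ} (hb : ∀ j ω, Z j ω ≤ b) (s : Finset (Fin n)) (ω : Ω) :
    ∑ j ∈ s, Z j ω ≤ s.card * b := by
  simpa using Finset.sum_le_sum fun j (_ : j ∈ s) => hb j ω

variable {Ω : Type*} [MeasurableSpace Ω]

theorem measurable_scaled {Z : Ω → ℝ} (hZ : Measurable Z) (θ : ℝ) : Measurable (scaled Z θ) :=
  (measurable_trunc hZ θ).div_const _

/-! ### Effective size of one bounded variable -/

section bounded

variable {P : Measure Ω} [IsProbabilityMeasure P] {lam : ℝ} {Z : Ω → ℝ}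

theorem integrable_rpow_of_bounded (hlam : 1 < lam) (hZ : Measurable Z)
    {b : ℝ} (hb : ∀ ω, Z ω ≤ b) : Integrable (fun ω => lam ^ Z ω) P := by
  refine Integrable.of_bound
    ((Real.continuous_const_rpow (by linarith)).measurable.comp hZ).aestronglyMeasurable (lam ^ b) (.of_forall fun ω => ?_)
  rw [Real.norm_of_nonneg (by positivity)]
  exact Real.rpow_le_rpow_of_exponent_le hlam.le (hb ω)

theorem one_le_integral_rpow (hlam : 1 < lam) (hZ : Measurable Z) (h0 : ∀ ω, 0 ≤ Z ω)
    {b : ℝ} (hb : ∀ ω, Z ω ≤ b) : 1 ≤ ∫ ω, lam ^ Z ω ∂P := by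
  calc (1 : ℝ) = ∫ _, (1 : ℝ) ∂P := by simp
    _ ≤ _ := integral_mono (integrable_const _) (integrable_rpow_of_bounded hlam hZ hb)
      fun ω => Real.one_le_rpow hlam.le (h0 ω)

theorem rpow_effSize (hlam : 1 < lam) (hZ : Measurable Z) (h0 : ∀ ω, 0 ≤ Z ω)
    {b : ℝ} (hb : ∀ ω, Z ω ≤ b) : lam ^ effSize P lam Z = ∫ ω, lam ^ Z ω ∂P := by
  rw [effSize, if_neg hlam.ne', Real.rpow_logb (by linarith) hlam.ne']
  linarith [one_le_integral_rpow (P := P) hlam hZ h0 hb]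

theorem effSize_nonneg (hlam : 1 < lam) (hZ : Measurable Z) (h0 : ∀ ω, 0 ≤ Z ω)
    {b : ℝ} (hb : ∀ ω, Z ω ≤ b) : 0 ≤ effSize P lam Z := by
  rw [effSize, if_neg hlam.ne']
  exact Real.logb_nonneg hlam (one_le_integral_rpow hlam hZ h0 hb)

theorem effSize_le (hlam : 1 < lam) (hZ : Measurable Z) (h0 : ∀ ω, 0 ≤ Z ω)
    {b : ℝ} (hb : ∀ ω, Z ω ≤ b) : effSize P lam Z ≤ b := by
  rw [← Real.rpow_le_rpow_left_iff hlam, rpow_effSize hlam hZ h0 hb]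
  calc ∫ ω, lam ^ Z ω ∂P ≤ ∫ _, lam ^ b ∂P :=
        integral_mono (integrable_rpow_of_bounded hlam hZ hb) (integrable_const _)
          fun ω => Real.rpow_le_rpow_of_exponent_le hlam.le (hb ω)
    _ = lam ^ b := by simp

theorem rpow_le_one_add_mul (hlam : 1 < lam) {z : ℝ} (hz0 : 0 ≤ z) (hz1 : z ≤ 1) :
    lam ^ z ≤ 1 + (lam - 1) * z := by
  have h := (convexOn_rpow_left (by linarith : 0 < lam)).2 (Set.mem_univ (0 : ℝ))
    (Set.mem_univ (1 : ℝ)) (sub_nonneg.2 hz1) hz0 (by ring)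
  simp only [smul_eq_mul, mul_zero, mul_one, zero_add, Real.rpow_zero, Real.rpow_one] at h
  linarith

/-- By convexity `lam ^ z ≤ 1 + (lam - 1) z` on `[0, 1]`, and `log x ≤ x - 1`. The factor `2` bounds
`1 / log lam`. This shows that the largest candidate threshold is good. -/
theorem effSize_le_mul_integral (hlam : 2 ≤ lam) (hZ : Measurable Z) (h0 : ∀ ω, 0 ≤ Z ω)
    (h1 : ∀ ω, Z ω ≤ 1) : effSize P lam Z ≤ 2 * (lam - 1) * ∫ ω, Z ω ∂P := by
  have hl : 1 < lam := by linarith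
  have hZi : Integrable Z P := Integrable.of_bound hZ.aestronglyMeasurable 1
    (.of_forall fun ω => by rw [Real.norm_of_nonneg (h0 ω)]; exact h1 ω)
  have hg : ∫ ω, lam ^ Z ω ∂P ≤ 1 + (lam - 1) * ∫ ω, Z ω ∂P := by
    calc ∫ ω, lam ^ Z ω ∂P ≤ ∫ ω, (1 + (lam - 1) * Z ω) ∂P :=
          integral_mono (integrable_rpow_of_bounded hl hZ h1)
            ((integrable_const _).add (hZi.const_mul _))
            fun ω => rpow_le_one_add_mul hl (h0 ω) (h1 ω)
      _ = _ := by
        rw [integral_add (integrable_const _) (hZi.const_mul _), integral_const_mul]; simp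
  have h1g := one_le_integral_rpow (P := P) hl hZ h0 h1
  have hI : 0 ≤ ∫ ω, Z ω ∂P := integral_nonneg h0
  rw [effSize, if_neg hl.ne', Real.logb, div_le_iff₀ (Real.log_pos hl)]
  have hlog : Real.log (∫ ω, lam ^ Z ω ∂P) ≤ (lam - 1) * ∫ ω, Z ω ∂P := by
    linarith [Real.log_le_sub_one_of_pos (by linarith : 0 < ∫ ω, lam ^ Z ω ∂P)]
  have hlog2 : 1 / 2 ≤ Real.log lam :=
    le_trans (by linarith [Real.log_two_gt_d9]) (Real.log_le_log two_pos hlam)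
  have : 0 ≤ (lam - 1) * ∫ ω, Z ω ∂P := mul_nonneg (by linarith) hI
  nlinarith

end bounded

/-! ### Effective sizes of sums of independent variables -/

section independent

variable {P : Measure Ω} {lam : ℝ} {n : ℕ} {Z : Fin n → Ω → ℝ}

/-- The function `f` is general because it is needed both for `z ↦ lam ^ z` and for its restriction
to `z ≥ 1 / 4`. -/
theorem integral_rpow_insert (hZ : ∀ j, Measurable (Z j)) (hind : iIndepFun Z P)
    {s : Finset (Fin n)} {j : Fin n} (hj : j ∉ s) {f : ℝ → ℝ} (hf : Measurable f) (hl : 0 < lam) :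
    ∫ ω, f (∑ i ∈ s, Z i ω) * lam ^ Z j ω ∂P =
      (∫ ω, f (∑ i ∈ s, Z i ω) ∂P) * ∫ ω, lam ^ Z j ω ∂P := by
  have hin : IndepFun (∑ i ∈ s, Z i) (Z j) P := hind.indepFun_finsetSum_of_notMem hZ hj
  have hg : Measurable fun z : ℝ => lam ^ z :=
    (Real.continuous_const_rpow hl.ne').measurable
  have hsm : Measurable (∑ i ∈ s, Z i) := by fun_prop
  have := (hin.comp hf hg).integral_fun_mul_eq_mul_integral
    (hf.comp hsm).aestronglyMeasurable
    (hg.comp (hZ j)).aestronglyMeasurable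
  simpa [Function.comp, Finset.sum_apply] using this

variable [IsProbabilityMeasure P]

theorem integral_rpow_sum (hlam : 1 < lam) (hZ : ∀ j, Measurable (Z j))
    (h0 : ∀ j ω, 0 ≤ Z j ω) {b : ℝ} (hb : ∀ j ω, Z j ω ≤ b) (hind : iIndepFun Z P)
    (s : Finset (Fin n)) :
    ∫ ω, lam ^ (∑ j ∈ s, Z j ω) ∂P = lam ^ ∑ j ∈ s, effSize P lam (Z j) := by
  have hl : 0 < lam := by linarith
  induction s using Finset.induction_on with
  | empty => simp
  | insert j s hj ih =>
    have h1 := integral_rpow_insert (P := P) hZ hind hj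
      (f := fun z => lam ^ z)
      (Real.continuous_const_rpow hl.ne').measurable hl
    rw [ih] at h1
    rw [Finset.sum_insert hj, add_comm, Real.rpow_add hl,
      rpow_effSize hlam (hZ j) (h0 j) (hb j), ← h1]
    refine integral_congr_ae (.of_forall fun ω => ?_)
    simp only
    rw [Finset.sum_insert hj, add_comm, Real.rpow_add hl]

/-- The first time the partial sums reach `1 / 4` they stay below `1 / 2`, and the remaining
variables are independent of what happened so far. -/
theorem integral_rpow_indicator_le (hlam : 1 < lam) (hZ : ∀ j, Measurable (Z j))
    (h0 : ∀ j ω, 0 ≤ Z j ω) (hb : ∀ j ω, Z j ω ≤ 1 / 4) (hind : iIndepFun Z P)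
    (s : Finset (Fin n)) :
    ∫ ω, Set.indicator {z : ℝ | 1 / 4 ≤ z} (fun z => lam ^ z) (∑ j ∈ s, Z j ω) ∂P ≤
      lam ^ (1 / 2 : ℝ) * P.real {ω | 1 / 4 ≤ ∑ j ∈ s, Z j ω} *
        ∫ ω, lam ^ (∑ j ∈ s, Z j ω) ∂P := by
  have hl : 0 < lam := by linarith
  have hms : ∀ s : Finset (Fin n), Measurable fun ω => ∑ j ∈ s, Z j ω := fun s =>
    Finset.measurable_sum s fun i _ => hZ i
  have hset : MeasurableSet {z : ℝ | 1 / 4 ≤ z} := measurableSet_le measurable_const measurable_id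
  have hE : ∀ s : Finset (Fin n), MeasurableSet {ω | 1 / 4 ≤ ∑ j ∈ s, Z j ω} := fun s =>
    hms s hset
  have hint : ∀ s : Finset (Fin n), Integrable (fun ω => lam ^ (∑ j ∈ s, Z j ω)) P := fun s =>
    integrable_rpow_of_bounded hlam (hms s) (sum_le_card_mul hb s)
  have hfm : Measurable (Set.indicator {z : ℝ | 1 / 4 ≤ z} (fun z => lam ^ z)) :=
    (Real.continuous_const_rpow hl.ne').measurable.indicator hset
  induction s using Finset.induction_on with
  | empty =>
    have : {z : ℝ | 1 / 4 ≤ z}.indicator (fun z => lam ^ z) 0 = 0 :=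
      Set.indicator_of_notMem (by simp) _
    simp only [Finset.sum_empty, this, integral_zero]
    positivity
  | insert j s hj ih =>
    set G := ∫ ω, lam ^ (∑ i ∈ s, Z i ω) ∂P with hG
    set G' := ∫ ω, lam ^ (∑ i ∈ insert j s, Z i ω) ∂P with hG'
    set g := ∫ ω, lam ^ Z j ω ∂P with hg
    have hGg : G' = G * g := by
      rw [hG, hg, ← integral_rpow_insert (P := P) hZ hind hj (f := fun z => lam ^ z)
        (Real.continuous_const_rpow hl.ne').measurable hl]
      refine integral_congr_ae (.of_forall fun ω => ?_)
      simp only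
      rw [Finset.sum_insert hj, add_comm, Real.rpow_add hl]
    have hg0 : 0 ≤ g := integral_nonneg fun ω => by positivity
    have hG1 : 1 ≤ G' := one_le_integral_rpow hlam (hms _)
      (fun ω => Finset.sum_nonneg fun i _ => h0 i ω) (sum_le_card_mul hb _)
    set A := {ω | 1 / 4 ≤ ∑ i ∈ s, Z i ω} with hA
    set A' := {ω | 1 / 4 ≤ ∑ i ∈ insert j s, Z i ω} with hA'
    have hAA : A ⊆ A' := fun ω hω => by
      simp only [hA, hA', Set.mem_ofPred_eq, Finset.sum_insert hj] at hω ⊢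
      linarith [h0 j ω]
    have hdiff : P.real (A' \ A) = P.real A' - P.real A :=
      measureReal_sdiff hAA (hE s)
    have hfint : Integrable (fun ω =>
        Set.indicator {z : ℝ | 1 / 4 ≤ z} (fun z => lam ^ z) (∑ i ∈ s, Z i ω) * lam ^ Z j ω) P := by
      refine ((hint (insert j s)).indicator (hE s)).congr (.of_forall fun ω => ?_)
      simp only [Set.indicator_apply, Set.mem_ofPred_eq]
      rw [Finset.sum_insert hj, add_comm, Real.rpow_add hl, ite_mul, zero_mul]
    -- Either the sum over `s` has already reached `1 / 4`, and `lam ^ Z j` splits off as an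
    -- independent factor, or it is below `1 / 4` and adding `Z j ≤ 1 / 4` keeps it below `1 / 2`.
    calc ∫ ω, Set.indicator {z : ℝ | 1 / 4 ≤ z} (fun z => lam ^ z)
            (∑ i ∈ insert j s, Z i ω) ∂P
        ≤ ∫ ω, (Set.indicator {z : ℝ | 1 / 4 ≤ z} (fun z => lam ^ z) (∑ i ∈ s, Z i ω)
              * lam ^ Z j ω + Set.indicator (A' \ A) (fun _ => lam ^ (1 / 2 : ℝ)) ω) ∂P := by
          refine integral_mono ?_ ?_ fun ω => ?_
          · exact ((hint (insert j s)).indicator (hE (insert j s))).congr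
              (.of_forall fun ω => rfl)
          · exact hfint.add ((integrable_const _).indicator ((hE _).diff (hE _)))
          · simp only [Set.indicator_apply, Set.mem_ofPred_eq, Set.mem_sdiff, hA, hA',
              Finset.sum_insert hj]
            have hz0 := h0 j ω
            have hz1 := hb j ω
            by_cases h1 : 1 / 4 ≤ ∑ i ∈ s, Z i ω
            · have h2 : 1 / 4 ≤ Z j ω + ∑ i ∈ s, Z i ω := by linarith
              simp only [h1, h2, if_true, not_true, and_false, if_false, add_zero]
              rw [add_comm, Real.rpow_add hl]
            · by_cases h2 : 1 / 4 ≤ Z j ω + ∑ i ∈ s, Z i ω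
              · simp only [h1, h2, if_true, if_false, not_false_eq_true, and_true, zero_mul,
                  zero_add]
                exact Real.rpow_le_rpow_of_exponent_le hlam.le (by linarith [not_le.1 h1])
              · simp only [h1, h2, if_false, false_and, zero_mul, add_zero, le_refl]
      _ = (∫ ω, Set.indicator {z : ℝ | 1 / 4 ≤ z} (fun z => lam ^ z) (∑ i ∈ s, Z i ω) ∂P) * g
            + (P.real A' - P.real A) * lam ^ (1 / 2 : ℝ) := by
          rw [integral_add hfint ((integrable_const _).indicator ((hE _).diff (hE _))),
            integral_rpow_insert hZ hind hj hfm hl,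
            integral_indicator_const _ ((hE _).diff (hE _)), hdiff, smul_eq_mul]
      _ ≤ lam ^ (1 / 2 : ℝ) * P.real A * G * g
            + (P.real A' - P.real A) * lam ^ (1 / 2 : ℝ) * G' := by
          refine add_le_add (mul_le_mul_of_nonneg_right ih hg0) ?_
          -- The factor `G' ≥ 1` is inserted so that the terms for `A` and for `A' \ A` add up to
          -- one for `A'`.
          refine le_mul_of_one_le_right (mul_nonneg ?_ (by positivity)) hG1
          rw [← hdiff]; exact measureReal_nonneg
      _ = lam ^ (1 / 2 : ℝ) * P.real A' * G' := by
          rw [mul_assoc _ G g, ← hGg]; ring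

/-- Independent variables in `[0, 1 / 4]` of total effective size at least `3` have a sum of at
least `1 / 4` with probability at least `1 / lam`. -/
theorem one_div_le_prob_of_effSize (hlam : 2 ≤ lam) (hZ : ∀ j, Measurable (Z j))
    (h0 : ∀ j ω, 0 ≤ Z j ω) (hb : ∀ j ω, Z j ω ≤ 1 / 4) (hind : iIndepFun Z P)
    (s : Finset (Fin n)) (hs : 3 ≤ ∑ j ∈ s, effSize P lam (Z j)) :
    1 / lam ≤ P.real {ω | 1 / 4 ≤ ∑ j ∈ s, Z j ω} := by
  by_contra! hlt
  have hl1 : 1 < lam := by linarith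
  have hl : 0 < lam := by linarith
  set p := P.real {ω | 1 / 4 ≤ ∑ j ∈ s, Z j ω} with hp
  set G := ∫ ω, lam ^ (∑ j ∈ s, Z j ω) ∂P with hG
  have hms : Measurable fun ω => ∑ j ∈ s, Z j ω := Finset.measurable_sum s fun i _ => hZ i
  have hset : MeasurableSet {z : ℝ | 1 / 4 ≤ z} := measurableSet_le measurable_const measurable_id
  have hint : Integrable (fun ω => lam ^ (∑ j ∈ s, Z j ω)) P :=
    integrable_rpow_of_bounded hl1 hms (sum_le_card_mul hb s)
  have hG3 : lam ^ (3 : ℝ) ≤ G := by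
    rw [hG, integral_rpow_sum hl1 hZ h0 hb hind]
    exact Real.rpow_le_rpow_of_exponent_le hl1.le hs
  have h1 : G ≤ lam ^ (1 / 4 : ℝ) + lam ^ (1 / 2 : ℝ) * p * G := by
    have hI := integral_rpow_indicator_le (P := P) hl1 hZ h0 hb hind s
    have hi2 : Integrable (fun ω =>
        Set.indicator {z : ℝ | 1 / 4 ≤ z} (fun z => lam ^ z) (∑ j ∈ s, Z j ω)) P :=
      (hint.indicator (hms hset)).congr (.of_forall fun ω => rfl)
    calc G ≤ ∫ ω, (lam ^ (1 / 4 : ℝ) +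
          Set.indicator {z : ℝ | 1 / 4 ≤ z} (fun z => lam ^ z) (∑ j ∈ s, Z j ω)) ∂P := by
          refine integral_mono hint ((integrable_const _).add hi2) fun ω => ?_
          simp only [Set.indicator_apply, Set.mem_ofPred_eq]
          have : 0 < lam ^ (1 / 4 : ℝ) := by positivity
          split_ifs with h
          · linarith
          · rw [add_zero]
            exact Real.rpow_le_rpow_of_exponent_le hl1.le (not_le.1 h).le
      _ = lam ^ (1 / 4 : ℝ) + ∫ ω,
          Set.indicator {z : ℝ | 1 / 4 ≤ z} (fun z => lam ^ z) (∑ j ∈ s, Z j ω) ∂P := by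
          rw [integral_add (integrable_const _) hi2]; simp
      _ ≤ _ := by linarith
  -- In terms of `r` the facts are `G ≤ r + r ^ 2 p G`, `r ^ 4 p < 1` and `G ≥ r ^ 12`. The first
  -- two bound `G` by a multiple of `r ^ 3`, against the third.
  set r := lam ^ (1 / 4 : ℝ) with hr
  have hr4 : r ^ 4 = lam := by
    rw [hr, ← Real.rpow_natCast, ← Real.rpow_mul hl.le]; norm_num
  have hr2 : lam ^ (1 / 2 : ℝ) = r ^ 2 := by
    rw [hr, ← Real.rpow_natCast, ← Real.rpow_mul hl.le]; norm_num
  have hr12 : lam ^ (3 : ℝ) = r ^ 12 := by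
    rw [hr, ← Real.rpow_natCast, ← Real.rpow_mul hl.le]; norm_num
  have hr0 : 0 < r := by positivity
  rw [hr2] at h1
  rw [hr12] at hG3
  have hp2 : r ^ 4 * p < 1 := by
    rw [hr4]; rwa [lt_div_iff₀ hl, mul_comm] at hlt
  have hGpos : 0 < G := lt_of_lt_of_le (by positivity) hG3
  -- multiply by `r ^ 2`
  have h2 : r ^ 2 * G < r ^ 3 + G := by
    have := mul_le_mul_of_nonneg_left h1 (sq_nonneg r)
    nlinarith
  -- Here `r ^ 2 = √lam ≥ √2`.
  have hs2 : 1.41 ≤ r ^ 2 := by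
    have : 2 ≤ (r ^ 2) ^ 2 := by rw [← pow_mul]; norm_num [hr4, hlam]
    nlinarith [sq_nonneg r]
  have h3 : 0.41 * G < r ^ 3 := by nlinarith
  have h9 : (4 : ℝ) ≤ r ^ 8 := by
    have : r ^ 8 = lam ^ 2 := by rw [← hr4]; ring
    rw [this]; nlinarith
  have hr1 : 1 ≤ r := Real.one_le_rpow hl1.le (by norm_num)
  have h5 : r ^ 3 * 4 ≤ G := by
    calc r ^ 3 * 4 ≤ r ^ 3 * r ^ 8 := by gcongr
      _ = r ^ 11 := by ring
      _ ≤ r ^ 12 := pow_le_pow_right₀ hr1 (by norm_num)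
      _ ≤ G := hG3
  have : 0 < r ^ 3 := by positivity
  linarith

end independent

end

/-! ### Lower bounds on the optimum -/

/-- Disjoint sets of jobs, each of them on a single machine. -/
structure IsChunks {m n q : ℕ} (τ : Fin n → Fin m) (c : Fin q → Finset (Fin n))
    (mach : Fin q → Fin m) : Prop where
  disj : Pairwise fun a b => Disjoint (c a) (c b)
  mach_eq : ∀ a, ∀ j ∈ c a, τ j = mach a

/-- At most `ℓ` chunks occupy at most `ℓ` machines, and disjointness prevents a job from being
counted twice. -/
theorem IsChunks.sum_le_topNorm {m n q : ℕ} {τ : Fin n → Fin m} {c : Fin q → Finset (Fin n)}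
    {mach : Fin q → Fin m} (hc : IsChunks τ c mach) (ℓ : ℕ) {x : Fin n → ℝ} (hx : ∀ j, 0 ≤ x j)
    (S : Finset (Fin q)) (hS : S.card ≤ ℓ) :
    ∑ a ∈ S, ∑ j ∈ c a, x j ≤ topNorm ℓ (load τ x) := by
  classical
  refine le_trans ?_ (StochLB.sum_le_topNorm ℓ _ (load_nonneg τ x hx) (S.image mach)
    (Finset.card_image_le.trans hS))
  rw [← Finset.sum_biUnion fun a _ b _ hab => hc.disj hab]
  simp only [load]
  rw [← Finset.sum_biUnion]
  · refine Finset.sum_le_sum_of_subset_of_nonneg (fun j hj => ?_) fun j _ _ => hx j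
    obtain ⟨a, ha, hja⟩ := Finset.mem_biUnion.1 hj
    exact Finset.mem_biUnion.2 ⟨mach a, Finset.mem_image_of_mem _ ha,
      by simpa using hc.mach_eq a j hja⟩
  · intro a _ b _ hab
    refine Finset.disjoint_left.2 fun j hj hj' => hab ?_
    simp only [Finset.mem_filter] at hj hj'
    exact hj.2.symm.trans hj'.2

/-- Elements are added one at a time until the sum first reaches `x`; the last one overshoots by at
most `b`. -/
theorem exists_subset_sum_between {ι : Type*} (β : ι → ℝ) {b x : ℝ} (hb : ∀ j, β j ≤ b)
    (hx : 0 ≤ x) (hb0 : 0 ≤ b)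
    (T : Finset ι) (hT : x ≤ ∑ j ∈ T, β j) :
    ∃ S ⊆ T, x ≤ ∑ j ∈ S, β j ∧ ∑ j ∈ S, β j ≤ x + b := by
  classical
  induction T using Finset.induction_on with
  | empty =>
    simp only [Finset.sum_empty] at hT
    exact ⟨∅, le_rfl, by simpa using hT, by simp; linarith⟩
  | insert j T hj ih =>
    by_cases h : x ≤ ∑ j ∈ T, β j
    · obtain ⟨S, hS, h1, h2⟩ := ih h
      exact ⟨S, hS.trans (Finset.subset_insert _ _), h1, h2⟩
    · refine ⟨insert j T, le_rfl, hT, ?_⟩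
      rw [Finset.sum_insert hj]
      linarith [hb j, not_le.1 h]

/-- Cut the jobs into `q` disjoint sets of size at least `3` that are on one machine each. -/
theorem exists_isChunks {m n : ℕ} (τ : Fin n → Fin m) {β : Fin n → ℝ}
    (hb : ∀ j, β j ≤ 1 / 4) (q : ℕ) (T : Finset (Fin n)) (hT : 3 * m + 4 * q ≤ ∑ j ∈ T, β j) :
    ∃ (c : Fin q → Finset (Fin n)) (mach : Fin q → Fin m), IsChunks τ c mach ∧
      (∀ a, c a ⊆ T) ∧ ∀ a, 3 ≤ ∑ j ∈ c a, β j := by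
  classical
  induction q generalizing T with
  | zero =>
    exact ⟨fun _ => ∅, fun a => a.elim0, ⟨fun a => a.elim0, fun a => a.elim0⟩, fun a => a.elim0,
      fun a => a.elim0⟩
  | succ q ih =>
    push_cast at hT
    -- If every machine had less than `3`, the total would be at most `3 m`. The chunk taken from
    -- this machine uses at most `3 + 1 / 4 ≤ 4` of the total.
    have hi : ∃ i, 3 ≤ ∑ j ∈ T with τ j = i, β j := by
      by_contra! h
      have h1 : ∑ j ∈ T, β j = ∑ i, ∑ j ∈ T with τ j = i, β j :=
        (Finset.sum_fiberwise _ _ _).symm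
      have h2 : ∑ i, ∑ j ∈ T with τ j = i, β j ≤ ∑ _i : Fin m, (3 : ℝ) :=
        Finset.sum_le_sum fun i _ => (h i).le
      simp only [Finset.sum_const, Finset.card_univ, Fintype.card_fin, nsmul_eq_mul] at h2
      have : (0 : ℝ) ≤ q := Nat.cast_nonneg q
      linarith
    obtain ⟨i, hi⟩ := hi
    obtain ⟨S, hS, h3, h4⟩ := exists_subset_sum_between β hb (by norm_num : (0 : ℝ) ≤ 3)
      (by norm_num) _ hi
    have hST : S ⊆ T := hS.trans (Finset.filter_subset _ _)
    have hrest : 3 * m + 4 * q ≤ ∑ j ∈ T \ S, β j := by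
      have := Finset.sum_sdiff (f := β) hST
      linarith
    obtain ⟨c, mach, hc, hcT, hc3⟩ := ih _ hrest
    refine ⟨Fin.cons S c, Fin.cons i mach, ⟨?_, ?_⟩, ?_, ?_⟩
    · have hd : ∀ a, Disjoint S (c a) := fun a =>
        Finset.disjoint_left.2 fun j hj hj' => (Finset.mem_sdiff.1 (hcT a hj')).2 hj
      intro a b hab
      induction a using Fin.cases with
      | zero =>
        induction b using Fin.cases with
        | zero => exact absurd rfl hab
        | succ b => simpa using hd b
      | succ a =>
        induction b using Fin.cases with
        | zero => simpa using (hd a).symm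
        | succ b => simpa using hc.disj fun h => hab (by rw [h])
    · intro a
      induction a using Fin.cases with
      | zero => intro j hj; simpa using (Finset.mem_filter.1 (hS hj)).2
      | succ a => simpa using hc.mach_eq a
    · intro a
      induction a using Fin.cases with
      | zero => simpa using hST
      | succ a => simpa using (hcT a).trans Finset.sdiff_subset
    · intro a
      induction a using Fin.cases with
      | zero => simpa using h3
      | succ a => simpa using hc3 a

section jobs

variable {Ω : Type*} [MeasurableSpace Ω] {P : Measure Ω} {m n : ℕ} {X : Fin n → Ω → ℝ}

theorem expTop_nonneg (h0 : ∀ j ω, 0 ≤ X j ω) (ℓ : ℕ) (σ : Fin n → Fin m) :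
    0 ≤ expTop P X ℓ σ :=
  integral_nonneg fun ω => topNorm_nonneg ℓ _ (load_nonneg σ _ fun j => h0 j ω)

theorem expTop_le_sum_integral (hX : ∀ j, Measurable (X j)) (h0 : ∀ j ω, 0 ≤ X j ω)
    (hi : ∀ j, Integrable (X j) P) (ℓ : ℕ) (σ : Fin n → Fin m) :
    expTop P X ℓ σ ≤ ∑ j, ∫ ω, X j ω ∂P := by
  rw [← integral_finsetSum _ fun j _ => hi j]
  refine integral_mono (integrable_topNorm_load ℓ σ hX h0 hi)
    (integrable_finsetSum _ fun j _ => hi j) fun ω => ?_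
  exact (topNorm_le_sum ℓ _ (load_nonneg σ _ fun j => h0 j ω)).trans (sum_load σ _).le

theorem iIndepFun_scaled (hind : iIndepFun X P) (θ : ℝ) :
    iIndepFun (fun j => scaled (X j) θ) P := by
  have hf : Measurable fun x : ℝ => Set.indicator {y : ℝ | y < θ} id x / (4 * θ) :=
    (measurable_id.indicator (measurableSet_lt measurable_id measurable_const)).div_const _
  have := hind.comp (fun _ => fun x : ℝ => Set.indicator {y : ℝ | y < θ} id x / (4 * θ))
    fun _ => hf
  convert this using 1
  funext j ω
  simp [scaled, trunc, Set.indicator_apply]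

variable [IsProbabilityMeasure P]

/-- Chunks whose sums have exceptional parts of large total mean force a large objective. -/
theorem IsChunks.half_le_expTop (hX : ∀ j, Measurable (X j)) (h0 : ∀ j ω, 0 ≤ X j ω)
    (hi : ∀ j, Integrable (X j) P) (hind : iIndepFun X P) {q : ℕ} {τ : Fin n → Fin m}
    {c : Fin q → Finset (Fin n)} {mach : Fin q → Fin m} (hc : IsChunks τ c mach) (ℓ : ℕ) {θ : ℝ}
    (h : ℓ * θ ≤ ∑ a, ∫ ω, exceptional (fun ω => ∑ j ∈ c a, X j ω) θ ω ∂P) :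
    ℓ * θ / 2 ≤ expTop P X ℓ τ := by
  classical
  refine half_le_integral_of_exceptional (W := fun a ω => ∑ j ∈ c a, X j ω)
    (fun a => Finset.measurable_sum _ fun j _ => hX j)
    (fun a ω => Finset.sum_nonneg fun j _ => h0 j ω)
    (fun a => integrable_finsetSum _ fun j _ => hi j) (fun a => ?_) ℓ
    (integrable_topNorm_load ℓ τ hX h0 hi)
    (fun S hS ω => hc.sum_le_topNorm ℓ (fun j => h0 j ω) S hS) h
  -- A chunk and the union of the earlier chunks use disjoint blocks of jobs, so their sums are
  -- independent.
  have hd : Disjoint (c a) ((Finset.univ.filter (· < a)).biUnion c) := by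
    rw [Finset.disjoint_biUnion_right]
    intro b hb
    exact hc.disj (Finset.mem_filter.1 hb).2.ne'
  have h1 := hind.indepFun_finset (c a) ((Finset.univ.filter (· < a)).biUnion c) hd hX
  have hf : Measurable fun x : (c a) → ℝ => ∑ j, x j := by fun_prop
  have hg : Measurable fun (x : ((Finset.univ.filter (· < a)).biUnion c) → ℝ)
      (b : (Finset.univ.filter (· < a) : Finset (Fin q))) =>
      ∑ j : (c b), x ⟨j, Finset.mem_biUnion.2 ⟨b, b.2, j.2⟩⟩ := by fun_prop
  have h2 := h1.comp hf hg
  convert h2 using 1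
  · funext ω
    simp only [Function.comp]
    exact (Finset.sum_coe_sort (c a) fun j => X j ω).symm
  · funext ω b
    simp only [Function.comp]
    exact (Finset.sum_coe_sort (c b) fun j => X j ω).symm

theorem half_le_expTop_of_exceptional (hX : ∀ j, Measurable (X j)) (h0 : ∀ j ω, 0 ≤ X j ω)
    (hi : ∀ j, Integrable (X j) P) (hind : iIndepFun X P) (ℓ : ℕ) {θ : ℝ}
    (h : ℓ * θ ≤ ∑ j, ∫ ω, exceptional (X j) θ ω ∂P) (τ : Fin n → Fin m) :
    ℓ * θ / 2 ≤ expTop P X ℓ τ := by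
  have hc : IsChunks τ (fun j => {j}) τ := by
    refine ⟨fun a b hab => by simpa using hab, fun a j hj => ?_⟩
    rw [Finset.mem_singleton.1 hj]
  exact hc.half_le_expTop hX h0 hi hind ℓ (by simpa using h)

/-- If the total effective size is large, then every assignment has a large objective. -/
theorem half_le_expTop_of_effSize (hX : ∀ j, Measurable (X j)) (h0 : ∀ j ω, 0 ≤ X j ω)
    (hi : ∀ j, Integrable (X j) P) (hind : iIndepFun X P) {ℓ : ℕ} {θ lam : ℝ}
    (hθ : 0 < θ) (hlam : 2 ≤ lam) (hlm : lam * ℓ ≤ 2 * m)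
    (h : 11 * m ≤ ∑ j, effSize P lam (scaled (X j) θ)) (τ : Fin n → Fin m) :
    ℓ * θ / 2 ≤ expTop P X ℓ τ := by
  have hl1 : 1 < lam := by linarith
  have hZm : ∀ j, Measurable (scaled (X j) θ) := fun j => measurable_scaled (hX j) θ
  have hZ0 : ∀ j ω, 0 ≤ scaled (X j) θ ω := fun j => scaled_nonneg (h0 j) hθ.le
  have hZb : ∀ j ω, scaled (X j) θ ω ≤ 1 / 4 := fun j => scaled_le hθ.le
  -- The constant `11` is `3 + 4 * 2`: it pays for `2 m` chunks.
  obtain ⟨c, mach, hc, -, h3⟩ := exists_isChunks τ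
    (fun j => effSize_le (P := P) hl1 (hZm j) (hZ0 j) (hZb j)) (2 * m) Finset.univ
    (by push_cast; linarith)
  refine hc.half_le_expTop hX h0 hi hind ℓ ?_
  -- A chunk of effective size `3` has scaled sum at least `1 / 4`, that is size at least `θ`, with
  -- probability at least `1 / lam`. In total `2 m θ / lam ≥ ℓ θ`.
  have hterm : ∀ a, θ / lam ≤ ∫ ω, exceptional (fun ω => ∑ j ∈ c a, X j ω) θ ω ∂P := by
    intro a
    have hW : Measurable fun ω => ∑ j ∈ c a, X j ω := Finset.measurable_sum _ fun j _ => hX j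
    have hWi : Integrable (fun ω => ∑ j ∈ c a, X j ω) P := integrable_finsetSum _ fun j _ => hi j
    have hp := one_div_le_prob_of_effSize hlam hZm hZ0 hZb (iIndepFun_scaled hind θ) (c a) (h3 a)
    set A := {ω | 1 / 4 ≤ ∑ j ∈ c a, scaled (X j) θ ω} with hA
    have hAm : MeasurableSet A :=
      measurableSet_le measurable_const (Finset.measurable_sum _ fun j _ => hZm j)
    calc θ / lam = 1 / lam * θ := by ring
      _ ≤ P.real A * θ := mul_le_mul_of_nonneg_right hp hθ.le
      _ = ∫ ω, A.indicator (fun _ => θ) ω ∂P := by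
          rw [integral_indicator_const _ hAm, smul_eq_mul]
      _ ≤ _ := by
          refine integral_mono ((integrable_const _).indicator hAm)
            (integrable_exceptional hW hWi θ) fun ω => ?_
          by_cases hω : ω ∈ A
          · rw [Set.indicator_of_mem hω]
            have h4 : θ ≤ ∑ j ∈ c a, X j ω := by
              calc θ = 4 * θ * (1 / 4) := by ring
                _ ≤ 4 * θ * ∑ j ∈ c a, scaled (X j) θ ω :=
                    mul_le_mul_of_nonneg_left hω (by positivity)
                _ = ∑ j ∈ c a, trunc (X j) θ ω := by
                    rw [Finset.mul_sum]
                    refine Finset.sum_congr rfl fun j _ => ?_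
                    rw [scaled]; field_simp
                _ ≤ _ := Finset.sum_le_sum fun j _ => trunc_le (h0 j) θ ω
            rw [exceptional, Set.indicator_of_mem (by exact h4)]
            exact h4
          · rw [Set.indicator_of_notMem hω]
            exact exceptional_nonneg (fun ω => Finset.sum_nonneg fun j _ => h0 j ω) θ ω
  calc (ℓ : ℝ) * θ ≤ ∑ _a : Fin (2 * m), θ / lam := by
        simp only [Finset.sum_const, Finset.card_univ, Fintype.card_fin, nsmul_eq_mul]
        push_cast
        rw [← mul_div_assoc, le_div_iff₀ (by linarith)]
        nlinarith
    _ ≤ _ := Finset.sum_le_sum fun a _ => hterm a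

/-! ### An upper bound on the objective -/

/-- It suffices that `x ≤ exp (x / 2)` for `x > 0`, which follows from the quadratic Taylor bound.
It trades an excess over `B + 1` for an exponential moment. -/
theorem le_rpow_self {lam x : ℝ} (hlam : 2 ≤ lam) : x ≤ lam ^ x := by
  have hl : 0 < lam := by linarith
  rcases le_or_gt x 0 with h | h
  · exact h.trans (by positivity)
  have hlog2 : 1 / 2 ≤ Real.log lam :=
    le_trans (by linarith [Real.log_two_gt_d9]) (Real.log_le_log two_pos hlam)
  rw [Real.rpow_def_of_pos hl]
  have h1 : x / 2 ≤ Real.log lam * x := by nlinarith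
  have h2 := Real.quadratic_le_exp_of_nonneg (by linarith : 0 ≤ x / 2)
  have h3 := Real.exp_le_exp.2 h1
  nlinarith [sq_nonneg (x - 2)]

theorem load_add {m n : ℕ} (σ : Fin n → Fin m) (x y : Fin n → ℝ) (i : Fin m) :
    load σ (fun j => x j + y j) i = load σ x i + load σ y i := Finset.sum_add_distrib

/-- If every machine has total effective size at most `B`, then the objective is at most of the
order of `ℓ θ B`, plus the mean of the exceptional parts. -/
theorem expTop_le_of_effSize (hX : ∀ j, Measurable (X j)) (h0 : ∀ j ω, 0 ≤ X j ω)
    (hi : ∀ j, Integrable (X j) P) (hind : iIndepFun X P) {ℓ : ℕ} {θ lam B : ℝ}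
    (hθ : 0 < θ) (hlam : 2 ≤ lam) (hB : 0 ≤ B) (σ : Fin n → Fin m)
    (h : ∀ i, ∑ j with σ j = i, effSize P lam (scaled (X j) θ) ≤ B) :
    expTop P X ℓ σ ≤
      ℓ * (4 * θ * (B + 1)) + 4 * θ * (m / lam) + ∑ j, ∫ ω, exceptional (X j) θ ω ∂P := by
  have hl1 : 1 < lam := by linarith
  have hl : 0 < lam := by linarith
  have hZm : ∀ j, Measurable (scaled (X j) θ) := fun j => measurable_scaled (hX j) θ
  have hZ0 : ∀ j ω, 0 ≤ scaled (X j) θ ω := fun j => scaled_nonneg (h0 j) hθ.le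
  have hZb : ∀ j ω, scaled (X j) θ ω ≤ 1 / 4 := fun j => scaled_le hθ.le
  set z : Fin m → Ω → ℝ := fun i ω => ∑ j with σ j = i, scaled (X j) θ ω with hz
  have hzm : ∀ i, Measurable (z i) := fun i => Finset.measurable_sum _ fun j _ => hZm j
  have hzint : ∀ i, Integrable (fun ω => lam ^ z i ω) P := fun i =>
    integrable_rpow_of_bounded hl1 (hzm i) (sum_le_card_mul hZb _)
  have hexc : ∀ j, Integrable (exceptional (X j) θ) P := fun j =>
    integrable_exceptional (hX j) (hi j) θ
  -- The bound `z ≤ (B + 1) + lam ^ (z - B - 1)` is used on each machine. The first term is paid by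
  -- `ℓ` machines only, the second by all `m`, and the exceptional parts are charged in full.
  have hpt : ∀ ω, topNorm ℓ (load σ (fun j => X j ω)) ≤
      ℓ * (4 * θ * (B + 1)) + 4 * θ * ∑ i, lam ^ (-(B + 1)) * lam ^ z i ω +
        ∑ j, exceptional (X j) θ ω := by
    intro ω
    obtain ⟨I, hI, hT⟩ := exists_topNorm_eq ℓ (load σ (fun j => X j ω))
    rw [hT]
    have hload : ∀ i, load σ (fun j => X j ω) i =
        4 * θ * z i ω + load σ (fun j => exceptional (X j) θ ω) i := by
      intro i
      have h1 : (fun j => X j ω) = fun j => 4 * θ * scaled (X j) θ ω + exceptional (X j) θ ω := by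
        funext j
        rw [scaled, mul_div_cancel₀ _ (by positivity), trunc_add_exceptional]
      rw [h1, load_add, hz]
      simp only [load, Finset.mul_sum]
    have hterm : ∀ i, 4 * θ * z i ω ≤
        4 * θ * (B + 1) + 4 * θ * (lam ^ (-(B + 1)) * lam ^ z i ω) := by
      intro i
      rw [← Real.rpow_add hl, ← mul_add]
      refine mul_le_mul_of_nonneg_left ?_ (by positivity)
      have := le_rpow_self (x := -(B + 1) + z i ω) hlam
      linarith
    calc ∑ i ∈ I, load σ (fun j => X j ω) i
        = ∑ i ∈ I, 4 * θ * z i ω + ∑ i ∈ I, load σ (fun j => exceptional (X j) θ ω) i := by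
          rw [← Finset.sum_add_distrib]; exact Finset.sum_congr rfl fun i _ => hload i
      _ ≤ (∑ i ∈ I, (4 * θ * (B + 1)) + ∑ i ∈ I, 4 * θ * (lam ^ (-(B + 1)) * lam ^ z i ω))
          + ∑ i, load σ (fun j => exceptional (X j) θ ω) i := by
          refine add_le_add ?_ ?_
          · rw [← Finset.sum_add_distrib]; exact Finset.sum_le_sum fun i _ => hterm i
          · exact Finset.sum_le_sum_of_subset_of_nonneg (Finset.subset_univ _) fun i _ _ =>
              load_nonneg σ _ (fun j => exceptional_nonneg (h0 j) θ ω) i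
      _ ≤ _ := by
          rw [sum_load, Finset.mul_sum]
          refine add_le_add (add_le_add ?_ ?_) le_rfl
          · rw [Finset.sum_const, nsmul_eq_mul]
            exact mul_le_mul_of_nonneg_right (by exact_mod_cast hI) (by positivity)
          · exact Finset.sum_le_sum_of_subset_of_nonneg (Finset.subset_univ _) fun i _ _ => by
              positivity
  -- By independence `E[lam ^ z i]` is `lam` to the total effective size, at most `lam ^ B`.
  have hmgf : ∀ i, ∫ ω, lam ^ (-(B + 1)) * lam ^ z i ω ∂P ≤ 1 / lam := by
    intro i
    rw [integral_const_mul, integral_rpow_sum hl1 hZm hZ0 hZb (iIndepFun_scaled hind θ),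
      ← Real.rpow_add hl]
    calc _ ≤ lam ^ (-1 : ℝ) := Real.rpow_le_rpow_of_exponent_le hl1.le (by linarith [h i])
      _ = 1 / lam := by rw [Real.rpow_neg_one, one_div]
  have hi1 : Integrable (fun ω => 4 * θ * ∑ i, lam ^ (-(B + 1)) * lam ^ z i ω) P :=
    (integrable_finsetSum _ fun i _ => (hzint i).const_mul _).const_mul _
  have hi2 : Integrable (fun ω => ∑ j, exceptional (X j) θ ω) P :=
    integrable_finsetSum _ fun j _ => hexc j
  have hi12 : Integrable (fun ω => ℓ * (4 * θ * (B + 1)) +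
      4 * θ * ∑ i, lam ^ (-(B + 1)) * lam ^ z i ω) P := (integrable_const _).add hi1
  calc expTop P X ℓ σ ≤ ∫ ω, (ℓ * (4 * θ * (B + 1)) +
        4 * θ * ∑ i, lam ^ (-(B + 1)) * lam ^ z i ω + ∑ j, exceptional (X j) θ ω) ∂P :=
        integral_mono (integrable_topNorm_load ℓ σ hX h0 hi)
          (hi12.add hi2) hpt
    _ = ℓ * (4 * θ * (B + 1)) + 4 * θ * ∑ i, ∫ ω, lam ^ (-(B + 1)) * lam ^ z i ω ∂P +
        ∑ j, ∫ ω, exceptional (X j) θ ω ∂P := by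
        rw [integral_add hi12 hi2, integral_add (integrable_const _) hi1, integral_const,
          integral_const_mul,
          integral_finsetSum _ fun i _ => (hzint i).const_mul _,
          integral_finsetSum _ fun j _ => hexc j]
        simp
    _ ≤ _ := by
        have : ∑ i, ∫ ω, lam ^ (-(B + 1)) * lam ^ z i ω ∂P ≤ m / lam := by
          calc _ ≤ ∑ _i : Fin m, 1 / lam := Finset.sum_le_sum fun i _ => hmgf i
            _ = m / lam := by simp [div_eq_mul_inv]
        have := mul_le_mul_of_nonneg_left this (by positivity : 0 ≤ 4 * θ)
        linarith

end jobs

/-! ### Deterministic programs -/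

/-- The program flips no coins. -/
def Prog.CoinFree : Prog → Prop
  | .coin _ _ _ => False
  | .seq p q => p.CoinFree ∧ q.CoinFree
  | .ite _ p q => p.CoinFree ∧ q.CoinFree
  | .loop _ _ body => body.CoinFree
  | _ => True

/-- Execute `f 0`, then `f 1`, …, then `f (k - 1)`, without randomness. -/
def iterateDet (f : ℕ → State → State) : ℕ → State → State
  | 0, s => s
  | k + 1, s => f k (iterateDet f k s)

open Classical in
/-- The final state of a program without coin flips. -/
def Prog.exec (J : JobAccess) : Prog → State → State
  | skip, s => s.tick
  | setNat a i j e, s => (s.writeNat (a, i.eval s, j.eval s) (e.eval s)).tick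
  | setReal a i j e, s => (s.writeReal (a, i.eval s, j.eval s) (e.eval s)).tick
  -- A junk value, excluded by `CoinFree`.
  | coin _ _ _, s => s
  | excMean a i j job θ, s =>
      (s.writeReal (a, i.eval s, j.eval s) (J.excMean (job.eval s) (θ.eval s))).tick
  | truncEff a i j job lam θ, s =>
      (s.writeReal (a, i.eval s, j.eval s)
        (J.truncEff (job.eval s) (lam.eval s) (θ.eval s))).tick
  | seq p q, s => q.exec J (p.exec J s)
  | ite b p q, s => if b.Holds s then p.exec J s.tick else q.exec J s.tick
  | loop a e body, s =>
      iterateDet (fun k s' => body.exec J (s'.writeNat (a, 0, 0) k).tick) (e.eval s) s.tick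

theorem iterate_pure (f : ℕ → State → State) (k : ℕ) (s : State) :
    iterate (fun k s => PMF.pure (f k s)) k s = PMF.pure (iterateDet f k s) := by
  induction k with
  | zero => rfl
  | succ k ih => rw [iterate, ih, PMF.pure_bind]; rfl

theorem Prog.run_eq_pure_exec (J : JobAccess) (p : Prog) (hp : p.CoinFree) (s : State) :
    p.run J s = PMF.pure (p.exec J s) := by
  induction p generalizing s with
  | coin => exact hp.elim
  | seq p q ihp ihq => rw [run, ihp hp.1, PMF.pure_bind, ihq hp.2]; rfl
  | ite b p q ihp ihq =>
    rw [run, exec]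
    split_ifs
    · exact ihp hp.1 _
    · exact ihq hp.2 _
  | loop a e body ih =>
    rw [run, exec, ← iterate_pure]
    congr 1
    funext k s
    exact ih hp _
  | _ => rfl

/-! ### Cells that a program leaves unchanged -/

/-- The names of the arrays of natural numbers that the program writes to. -/
def Prog.natWrites : Prog → List ℕ
  | setNat a _ _ _ => [a]
  | coin a _ _ => [a]
  | seq p q => p.natWrites ++ q.natWrites
  | ite _ p q => p.natWrites ++ q.natWrites
  | loop a _ body => a :: body.natWrites
  | _ => []

/-- The names of the arrays of real numbers that the program writes to. -/
def Prog.realWrites : Prog → List ℕ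
  | setReal a _ _ _ => [a]
  | excMean a _ _ _ _ => [a]
  | truncEff a _ _ _ _ _ => [a]
  | seq p q => p.realWrites ++ q.realWrites
  | ite _ p q => p.realWrites ++ q.realWrites
  | loop _ _ body => body.realWrites
  | _ => []

@[simp] theorem State.tick_nat (s : State) : s.tick.nat = s.nat := rfl
@[simp] theorem State.tick_real (s : State) : s.tick.real = s.real := rfl
@[simp] theorem State.tick_steps (s : State) : s.tick.steps = s.steps + 1 := rfl
@[simp] theorem State.writeNat_nat (s : State) (x : Addr) (v : ℕ) (y : Addr) :
    (s.writeNat x v).nat y = if y = x then v else s.nat y := by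
  simp [State.writeNat, Function.update_apply]
@[simp] theorem State.writeNat_real (s : State) (x : Addr) (v : ℕ) :
    (s.writeNat x v).real = s.real := rfl
@[simp] theorem State.writeNat_steps (s : State) (x : Addr) (v : ℕ) :
    (s.writeNat x v).steps = s.steps := rfl
@[simp] theorem State.writeReal_real (s : State) (x : Addr) (v : ℝ) (y : Addr) :
    (s.writeReal x v).real y = if y = x then v else s.real y := by
  simp [State.writeReal, Function.update_apply]
@[simp] theorem State.writeReal_nat (s : State) (x : Addr) (v : ℝ) :
    (s.writeReal x v).nat = s.nat := rfl
@[simp] theorem State.writeReal_steps (s : State) (x : Addr) (v : ℝ) :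
    (s.writeReal x v).steps = s.steps := rfl

theorem iterateDet_induction {f : ℕ → State → State} (I : ℕ → State → Prop) {s : State}
    (h0 : I 0 s) (k : ℕ) (hs : ∀ t s', t < k → I t s' → I (t + 1) (f t s')) :
    I k (iterateDet f k s) := by
  induction k with
  | zero => exact h0
  | succ k ih =>
    exact hs k _ (Nat.lt_succ_self k) (ih fun t s' ht h => hs t s' (ht.trans (Nat.lt_succ_self k)) h)

/-- Writes are tracked by array name only, so the frame condition for a concrete program is usually
settled by `decide`. -/
theorem Prog.exec_nat (J : JobAccess) (p : Prog) {b : ℕ} (hb : b ∉ p.natWrites) (s : State)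
    (i j : ℕ) : (p.exec J s).nat (b, i, j) = s.nat (b, i, j) := by
  induction p generalizing s with
  | setNat a i' j' e =>
    simp only [natWrites, List.mem_singleton] at hb
    simp [exec, hb]
  | seq p q ihp ihq =>
    simp only [natWrites, List.mem_append, not_or] at hb
    rw [exec, ihq hb.2, ihp hb.1]
  | ite t p q ihp ihq =>
    simp only [natWrites, List.mem_append, not_or] at hb
    rw [exec]
    split_ifs
    · rw [ihp hb.1]; rfl
    · rw [ihq hb.2]; rfl
  | loop a e body ih =>
    simp only [natWrites, List.mem_cons, not_or] at hb
    rw [exec]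
    refine iterateDet_induction (s := s.tick) (fun _ s' => s'.nat (b, i, j) = s.nat (b, i, j)) rfl _ ?_
    intro t s' _ h
    rw [ih hb.2]
    simp [hb.1, h]
  | _ => simp [exec]

theorem Prog.exec_real (J : JobAccess) (p : Prog) {b : ℕ} (hb : b ∉ p.realWrites) (s : State)
    (i j : ℕ) : (p.exec J s).real (b, i, j) = s.real (b, i, j) := by
  induction p generalizing s with
  | setReal a i' j' e =>
    simp only [realWrites, List.mem_singleton] at hb
    simp [exec, hb]
  | excMean a i' j' job θ =>
    simp only [realWrites, List.mem_singleton] at hb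
    simp [exec, hb]
  | truncEff a i' j' job lam θ =>
    simp only [realWrites, List.mem_singleton] at hb
    simp [exec, hb]
  | seq p q ihp ihq =>
    simp only [realWrites, List.mem_append, not_or] at hb
    rw [exec, ihq hb.2, ihp hb.1]
  | ite t p q ihp ihq =>
    simp only [realWrites, List.mem_append, not_or] at hb
    rw [exec]
    split_ifs
    · rw [ihp hb.1]; rfl
    · rw [ihq hb.2]; rfl
  | loop a e body ih =>
    rw [exec]
    refine iterateDet_induction (s := s.tick) (fun _ s' => s'.real (b, i, j) = s.real (b, i, j)) rfl _ ?_
    intro t s' _ h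
    rw [ih hb]
    simp [h]
  | _ => simp [exec]

/-- The states agree on all arrays whose names are not in the given lists. -/
structure Agree (ws wr : List ℕ) (s s' : State) : Prop where
  nat : ∀ b ∉ ws, ∀ i j, s'.nat (b, i, j) = s.nat (b, i, j)
  real : ∀ b ∉ wr, ∀ i j, s'.real (b, i, j) = s.real (b, i, j)

/-- The loop rule: an invariant that is kept by every round. The states at the beginning of the
rounds agree with the initial one up to what the loop writes. -/
theorem Prog.exec_loop_induction (J : JobAccess) {a : ℕ} {e : NExp} {body : Prog} {s : State}
    (I : ℕ → State → Prop) {k : ℕ} (hk : e.eval s = k) (h0 : I 0 s.tick)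
    (hs : ∀ t s', t < k → Agree (a :: body.natWrites) body.realWrites s s' → I t s' →
      I (t + 1) (body.exec J (s'.writeNat (a, 0, 0) t).tick)) :
    I k ((Prog.loop a e body).exec J s) := by
  rw [exec, hk]
  refine (iterateDet_induction (s := s.tick) (fun t s' => Agree (a :: body.natWrites) body.realWrites s s' ∧
    I t s') ⟨⟨fun _ _ _ _ => rfl, fun _ _ _ _ => rfl⟩, h0⟩ k ?_).2
  rintro t s' ht ⟨hA, hI⟩
  refine ⟨⟨fun b hb i j => ?_, fun b hb i j => ?_⟩, hs t s' ht hA hI⟩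
  · have hb' := hb
    simp only [List.mem_cons, not_or] at hb'
    rw [exec_nat J body hb'.2]
    simp [hb'.1, hA.nat b hb]
  · rw [exec_real J body hb]
    simp [hA.real b hb]

/-! ### Running times -/

/-- A bound on the number of steps, if no loop has more than `N` rounds. -/
def Prog.cost (N : ℕ) : Prog → ℕ
  | seq p q => p.cost N + q.cost N
  | ite _ p q => 1 + (p.cost N + q.cost N)
  | loop _ _ body => 1 + N * (1 + body.cost N)
  | _ => 1

/-- The nesting depth of loops. -/
def Prog.depth : Prog → ℕ
  | seq p q => max p.depth q.depth
  | ite _ p q => max p.depth q.depth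
  | loop _ _ body => body.depth + 1
  | _ => 0

/-- Each level of nesting contributes one factor `N`; the coefficient depends on the program only.
This turns step counts into a polynomial bound. -/
theorem Prog.cost_le (N : ℕ) (hN : 1 ≤ N) (p : Prog) : p.cost N ≤ p.cost 1 * N ^ p.depth := by
  have hpow : ∀ a b, a ≤ b → N ^ a ≤ N ^ b := fun a b h => Nat.pow_le_pow_right hN h
  have h1 : ∀ a, 1 ≤ N ^ a := fun a => Nat.one_le_pow _ _ hN
  induction p with
  | seq p q ihp ihq =>
    simp only [cost, depth, add_mul]
    exact add_le_add (ihp.trans (Nat.mul_le_mul_left _ (hpow _ _ (le_max_left _ _))))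
      (ihq.trans (Nat.mul_le_mul_left _ (hpow _ _ (le_max_right _ _))))
  | ite b p q ihp ihq =>
    simp only [cost, depth, add_mul, one_mul]
    exact add_le_add (h1 _)
      (add_le_add (ihp.trans (Nat.mul_le_mul_left _ (hpow _ _ (le_max_left _ _))))
      (ihq.trans (Nat.mul_le_mul_left _ (hpow _ _ (le_max_right _ _)))))
  | loop a e body ih =>
    simp only [cost, depth, add_mul, one_mul]
    refine add_le_add (h1 _) ?_
    calc N * (1 + body.cost N) ≤ N * (N ^ body.depth + body.cost 1 * N ^ body.depth) :=
          Nat.mul_le_mul_left _ (add_le_add (h1 _) ih)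
      _ = _ := by ring
  | _ => simp [cost, depth]

/-- All loops have at most `N` rounds in states with the property `S`. -/
def Prog.LoopsLE (N : ℕ) (S : State → Prop) : Prog → Prop
  | seq p q => p.LoopsLE N S ∧ q.LoopsLE N S
  | ite _ p q => p.LoopsLE N S ∧ q.LoopsLE N S
  | loop _ e body => (∀ s, S s → e.eval s ≤ N) ∧ body.LoopsLE N S
  | _ => True

/-- The arrays of natural numbers with names in `A` have the contents `f`. -/
def HasNat (A : List ℕ) (f : Addr → ℕ) (s : State) : Prop :=
  ∀ a ∈ A, ∀ i j, s.nat (a, i, j) = f (a, i, j)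

/-- Loop bounds are evaluated during the run. If they depend only on arrays in `A`, which the
program never writes, then they are the same in every state that is reached. -/
theorem Prog.exec_steps_le (J : JobAccess) {N : ℕ} {A : List ℕ} {f : Addr → ℕ} (p : Prog)
    (hA : ∀ a ∈ A, a ∉ p.natWrites) (hp : p.LoopsLE N (HasNat A f)) (s : State)
    (hs : HasNat A f s) : (p.exec J s).steps ≤ s.steps + p.cost N := by
  induction p generalizing s with
  | seq p q ihp ihq =>
    simp only [natWrites, List.mem_append, not_or] at hA
    have h1 := ihp (fun a ha => (hA a ha).1) hp.1 s hs
    have h2 := ihq (fun a ha => (hA a ha).2) hp.2 (p.exec J s) fun a ha i j => by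
      rw [exec_nat J p (hA a ha).1, hs a ha]
    simp only [exec, cost]
    omega
  | ite t p q ihp ihq =>
    simp only [natWrites, List.mem_append, not_or] at hA
    have h1 := ihp (fun a ha => (hA a ha).1) hp.1 s.tick hs
    have h2 := ihq (fun a ha => (hA a ha).2) hp.2 s.tick hs
    simp only [State.tick_steps] at h1 h2
    simp only [exec, cost]
    split_ifs <;> omega
  | loop a e body ih =>
    simp only [natWrites, List.mem_cons, not_or] at hA
    have key := exec_loop_induction J (a := a) (e := e) (body := body) (s := s)
      (fun t s' => s'.steps ≤ s.steps + 1 + t * (1 + body.cost N)) rfl (by simp) ?_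
    · refine key.trans ?_
      have := Nat.mul_le_mul_right (1 + body.cost N) (hp.1 s hs)
      simp only [cost]
      omega
    · intro t s' _ hag hI
      have h1 := ih (fun b hb => (hA b hb).2) hp.2 (s'.writeNat (a, 0, 0) t).tick fun b hb i j => by
        simp only [State.tick_nat, State.writeNat_nat, Prod.mk.injEq, (hA b hb).1, false_and,
          if_false]
        rw [hag.nat b (by simpa using hA b hb), hs b hb]
      simp only [State.tick_steps, State.writeNat_steps] at h1
      rw [add_mul, one_mul]
      omega
  | coin => simp [exec, cost]
  | _ => simp [exec, cost]

/-! ### Vector scheduling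

The vector of job `j` is `v j`, its coordinates are `v j k` with `k < D`, and `a j` is the machine
of job `j`. -/

/-- The product of `1 + v j k` over the jobs `j < t` on machine `i`. -/
def loadProd (v : ℕ → ℕ → ℝ) (a : ℕ → ℕ) (t i k : ℕ) : ℝ :=
  ∏ j ∈ Finset.range t with a j = i, (1 + v j k)

/-- The product of `1 + v j k / m` over the jobs `j < t`. -/
def meanProd (v : ℕ → ℕ → ℝ) (m t k : ℕ) : ℝ := ∏ j ∈ Finset.range t, (1 + v j k / m)

/-- The increase of the potential if job `t` is assigned to machine `i`. -/
def increase (v : ℕ → ℕ → ℝ) (a : ℕ → ℕ) (m D t i : ℕ) : ℝ :=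
  ∑ k ∈ Finset.range D, loadProd v a t i k * v t k / meanProd v m (t + 1) k

/-- Under a uniformly random choice of machine, `loadProd` grows by the factor `1 + v t k / m` in
expectation, and so does `meanProd`; the quotient keeps its expectation. -/
def potential (v : ℕ → ℕ → ℝ) (a : ℕ → ℕ) (m D t : ℕ) : ℝ :=
  ∑ i ∈ Finset.range m, ∑ k ∈ Finset.range D, loadProd v a t i k / meanProd v m t k

theorem loadProd_succ (v : ℕ → ℕ → ℝ) (a : ℕ → ℕ) (t i k : ℕ) :
    loadProd v a (t + 1) i k =
      if a t = i then loadProd v a t i k * (1 + v t k) else loadProd v a t i k := by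
  unfold loadProd
  rw [Finset.range_add_one, Finset.filter_insert]
  split_ifs
  · rw [Finset.prod_insert (by simp), mul_comm]
  · rfl

theorem meanProd_succ (v : ℕ → ℕ → ℝ) (m t k : ℕ) :
    meanProd v m (t + 1) k = meanProd v m t k * (1 + v t k / m) := Finset.prod_range_succ _ _

theorem loadProd_congr {v v' : ℕ → ℕ → ℝ} {a a' : ℕ → ℕ} {t : ℕ} (i k : ℕ)
    (hv : ∀ j < t, v j k = v' j k) (h : ∀ j < t, a j = a' j) :
    loadProd v a t i k = loadProd v' a' t i k := by
  unfold loadProd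
  have : (Finset.range t).filter (fun j => a j = i) = (Finset.range t).filter fun j => a' j = i :=
    Finset.filter_congr fun j hj => by rw [h j (Finset.mem_range.1 hj)]
  rw [this]
  exact Finset.prod_congr rfl fun j hj => by
    rw [hv j (Finset.mem_range.1 (Finset.mem_filter.1 hj).1)]

section

variable {v : ℕ → ℕ → ℝ} {a : ℕ → ℕ} {m D n : ℕ}

theorem meanProd_pos {t k : ℕ} (hv : ∀ j < t, 0 ≤ v j k) : 0 < meanProd v m t k :=
  Finset.prod_pos fun j hj => by have := hv j (Finset.mem_range.1 hj); positivity

theorem one_le_loadProd {t k : ℕ} (hv : ∀ j < t, 0 ≤ v j k) (i : ℕ) : 1 ≤ loadProd v a t i k :=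
  Finset.prod_induction _ (fun x => 1 ≤ x) (fun _ _ => one_le_mul_of_one_le_of_one_le) le_rfl
    fun j hj => by
      have := hv j (Finset.mem_range.1 (Finset.mem_filter.1 hj).1); linarith

theorem potential_zero : potential v a m D 0 = m * D := by
  simp [potential, loadProd, meanProd]

/-- The method of conditional expectations: the average over all machines leaves the potential
exactly unchanged (`h3`), and the minimum is at most the average (`h4`). -/
theorem potential_succ_le (hm : 0 < m) {t : ℕ} (hv : ∀ j ≤ t, ∀ k < D, 0 ≤ v j k) (ha : a t < m)
    (hmin : ∀ i < m, increase v a m D t (a t) ≤ increase v a m D t i) :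
    potential v a m D (t + 1) ≤ potential v a m D t := by
  have hm' : (0 : ℝ) < m := by exact_mod_cast hm
  have h1 : potential v a m D (t + 1) = ∑ i ∈ Finset.range m, ∑ k ∈ Finset.range D,
      loadProd v a t i k / meanProd v m (t + 1) k + increase v a m D t (a t) := by
    have h2 : increase v a m D t (a t) = ∑ i ∈ Finset.range m,
        if a t = i then increase v a m D t i else 0 := by
      rw [Finset.sum_ite_eq, if_pos (Finset.mem_range.2 ha)]
    rw [h2, potential, ← Finset.sum_add_distrib]
    refine Finset.sum_congr rfl fun i _ => ?_
    split_ifs with h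
    · rw [increase, ← Finset.sum_add_distrib]
      refine Finset.sum_congr rfl fun k _ => ?_
      rw [loadProd_succ, if_pos h]; ring
    · rw [add_zero]
      refine Finset.sum_congr rfl fun k _ => ?_
      rw [loadProd_succ, if_neg h]
  have h3 : potential v a m D t = ∑ i ∈ Finset.range m, ∑ k ∈ Finset.range D,
      loadProd v a t i k / meanProd v m (t + 1) k +
        (∑ i ∈ Finset.range m, increase v a m D t i) / m := by
    rw [potential, Finset.sum_div, ← Finset.sum_add_distrib]
    refine Finset.sum_congr rfl fun i _ => ?_
    rw [increase, Finset.sum_div, ← Finset.sum_add_distrib]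
    refine Finset.sum_congr rfl fun k hk => ?_
    have hk' := Finset.mem_range.1 hk
    have hp : 0 < meanProd v m t k := meanProd_pos fun j hj => hv j hj.le k hk'
    have hq : 0 < 1 + v t k / m := by have := hv t le_rfl k hk'; positivity
    have hq' : (m : ℝ) + v t k ≠ 0 := by have := hv t le_rfl k hk'; positivity
    rw [meanProd_succ]
    field_simp
  have h4 : increase v a m D t (a t) ≤ (∑ i ∈ Finset.range m, increase v a m D t i) / m := by
    rw [le_div_iff₀ hm']
    calc _ = ∑ _i ∈ Finset.range m, increase v a m D t (a t) := by simp [mul_comm]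
      _ ≤ _ := Finset.sum_le_sum fun i hi => hmin i (Finset.mem_range.1 hi)
  linarith

/-- Since `1 + x ≤ exp x`, each `meanProd` is at most `exp` of the average load, which is at most
`11`. -/
theorem sum_loadProd_le (hm : 0 < m) (hv : ∀ j < n, ∀ k < D, 0 ≤ v j k)
    (hsum : ∀ k < D, ∑ j ∈ Finset.range n, v j k ≤ 11 * m)
    (hpot : potential v a m D n ≤ m * D) :
    ∑ i ∈ Finset.range m, ∑ k ∈ Finset.range D, loadProd v a n i k ≤ Real.exp 11 * (m * D) := by
  have hm' : (0 : ℝ) < m := by exact_mod_cast hm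
  refine le_trans ?_ (mul_le_mul_of_nonneg_left hpot (Real.exp_pos 11).le)
  rw [potential, Finset.mul_sum]
  refine Finset.sum_le_sum fun i _ => ?_
  rw [Finset.mul_sum]
  refine Finset.sum_le_sum fun k hk => ?_
  have hk' := Finset.mem_range.1 hk
  have hp : 0 < meanProd v m n k := meanProd_pos fun j hj => hv j hj k hk'
  have h1 : meanProd v m n k ≤ Real.exp 11 := by
    calc meanProd v m n k ≤ ∏ j ∈ Finset.range n, Real.exp (v j k / m) :=
          Finset.prod_le_prod (fun j hj => by
            have := hv j (Finset.mem_range.1 hj) k hk'; positivity)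
            fun j _ => by linarith [Real.add_one_le_exp (v j k / m)]
      _ = Real.exp ((∑ j ∈ Finset.range n, v j k) / m) := by
          rw [← Real.exp_sum, Finset.sum_div]
      _ ≤ _ := Real.exp_le_exp.2 (by rw [div_le_iff₀ hm']; exact hsum k hk')
  have h2 : 1 ≤ loadProd v a n i k := one_le_loadProd (fun j hj => hv j hj k hk') i
  rw [← mul_div_assoc, le_div_iff₀ hp, mul_comm]
  exact mul_le_mul_of_nonneg_right h1 (by linarith)

/-- For `0 ≤ x ≤ 1`, `x / 2 ≤ x / (1 + x) ≤ log (1 + x)`. -/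
theorem sum_le_log_loadProd {t k : ℕ} (hv : ∀ j < t, 0 ≤ v j k) (hv1 : ∀ j < t, v j k ≤ 1)
    (i : ℕ) :
    ∑ j ∈ Finset.range t with a j = i, v j k ≤ 2 * Real.log (loadProd v a t i k) := by
  have hj : ∀ j ∈ (Finset.range t).filter (fun j => a j = i), j < t := fun j hj =>
    Finset.mem_range.1 (Finset.mem_filter.1 hj).1
  rw [loadProd, Real.log_prod fun j h => by linarith [hv j (hj j h)], Finset.mul_sum]
  refine Finset.sum_le_sum fun j h => ?_
  have h0 := hv j (hj j h)
  have h1 := hv1 j (hj j h)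
  have h2 := Real.one_sub_inv_le_log_of_pos (by linarith : 0 < 1 + v j k)
  have h3 : v j k / 2 ≤ 1 - (1 + v j k)⁻¹ := by
    have : 1 - (1 + v j k)⁻¹ = v j k / (1 + v j k) := by field_simp; ring
    rw [this]
    exact div_le_div_of_nonneg_left h0 (by linarith) (by linarith)
  linarith

/-! ### Overfull machines and largest coordinates -/

/-- The maximum of `f 0, …, f (k - 1)` and `0`. -/
def maxUpTo (f : ℕ → ℝ) : ℕ → ℝ
  | 0 => 0
  | k + 1 => max (maxUpTo f k) (f k)

theorem le_maxUpTo (f : ℕ → ℝ) {k K : ℕ} (h : k < K) : f k ≤ maxUpTo f K := by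
  induction K with
  | zero => omega
  | succ K ih =>
    rcases Nat.lt_succ_iff_lt_or_eq.1 h with h | rfl
    · exact (ih h).trans (le_max_left _ _)
    · exact le_max_right _ _

theorem maxUpTo_nonneg (f : ℕ → ℝ) (K : ℕ) : 0 ≤ maxUpTo f K := by
  induction K with
  | zero => exact le_rfl
  | succ K ih => exact ih.trans (le_max_left _ _)

theorem maxUpTo_le {f : ℕ → ℝ} {K : ℕ} {b : ℝ} (hb : 0 ≤ b) (h : ∀ k < K, f k ≤ b) :
    maxUpTo f K ≤ b := by
  induction K with
  | zero => exact hb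
  | succ K ih => exact max_le (ih fun k hk => h k (by omega)) (h K (by omega))

theorem maxUpTo_le_sum {f : ℕ → ℝ} {K : ℕ} (h : ∀ k < K, 0 ≤ f k) :
    maxUpTo f K ≤ ∑ k ∈ Finset.range K, f k := by
  induction K with
  | zero => simp [maxUpTo]
  | succ K ih =>
    have h1 := ih fun k hk => h k (by omega)
    rw [Finset.sum_range_succ]
    exact max_le (by linarith [h K (by omega)])
      (by
        have h2 : 0 ≤ ∑ k ∈ Finset.range K, f k := Finset.sum_nonneg fun k hk =>
          h k (by have := Finset.mem_range.1 hk; omega)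
        linarith)

/-- A machine that some coordinate of its load vector may overflow. -/
def Overfull (v : ℕ → ℕ → ℝ) (a : ℕ → ℕ) (D n i : ℕ) : Prop :=
  (D : ℝ) ^ 4 < ∑ k ∈ Finset.range D, loadProd v a n i k

-- On an overfull machine with sum of products `Q > D ^ 4`, each of the `D` coordinates has load at
-- most `2 log Q ≤ 4 √Q`, so the largest coordinates sum to at most `4 D √Q ≤ 4 Q / D`. Over all
-- machines the `Q` sum to at most `exp 11 * m * D`. The exponent `4` is what gives `√Q ≥ D ^ 2`.
open Classical in
theorem sum_overfull_le (hm : 0 < m) (hD : 0 < D) (hv : ∀ j < n, ∀ k < D, 0 ≤ v j k)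
    (hv1 : ∀ j < n, ∀ k < D, v j k ≤ 1)
    (hsum : ∀ k < D, ∑ j ∈ Finset.range n, v j k ≤ 11 * m)
    (hpot : potential v a m D n ≤ m * D) (ha : ∀ j < n, a j < m) :
    ∑ j ∈ Finset.range n with Overfull v a D n (a j), maxUpTo (v j) D ≤ 4 * Real.exp 11 * m := by
  have hD' : (1 : ℝ) ≤ D := by exact_mod_cast hD
  have hone : ∀ i, ∀ k < D, 1 ≤ loadProd v a n i k := fun i k hk =>
    one_le_loadProd (fun j hj => hv j hj k hk) i
  have hmach : ∀ i, Overfull v a D n i →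
      ∑ j ∈ Finset.range n with a j = i, maxUpTo (v j) D ≤
        4 * (∑ k ∈ Finset.range D, loadProd v a n i k) / D := by
    intro i hi
    set Q := ∑ k ∈ Finset.range D, loadProd v a n i k with hQ
    have hQ4 : (D : ℝ) ^ 4 < Q := hi
    have hQ0 : 0 < Q := lt_trans (by positivity) hQ4
    have hsq : (D : ℝ) ^ 2 ≤ √Q := Real.le_sqrt_of_sq_le (by rw [← pow_mul]; exact hQ4.le)
    have hlog : ∀ k < D, Real.log (loadProd v a n i k) ≤ 2 * √Q := by
      intro k hk
      have h1 : loadProd v a n i k ≤ Q :=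
        Finset.single_le_sum (f := fun k => loadProd v a n i k)
          (fun k hk => by linarith [hone i k (Finset.mem_range.1 hk)]) (Finset.mem_range.2 hk)
      have h2 : Real.log (loadProd v a n i k) ≤ Real.log Q :=
        Real.log_le_log (by linarith [hone i k hk]) h1
      have h3 : Real.log Q = 2 * Real.log √Q := by rw [Real.log_sqrt hQ0.le]; ring
      have h4 : Real.log √Q ≤ √Q := Real.log_le_self (Real.sqrt_nonneg Q)
      linarith
    calc ∑ j ∈ Finset.range n with a j = i, maxUpTo (v j) D
        ≤ ∑ j ∈ Finset.range n with a j = i, ∑ k ∈ Finset.range D, v j k :=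
          Finset.sum_le_sum fun j hj => maxUpTo_le_sum fun k hk =>
            hv j (Finset.mem_range.1 (Finset.mem_filter.1 hj).1) k hk
      _ = ∑ k ∈ Finset.range D, ∑ j ∈ Finset.range n with a j = i, v j k := Finset.sum_comm
      _ ≤ ∑ _k ∈ Finset.range D, 4 * √Q := Finset.sum_le_sum fun k hk => by
          have hk' := Finset.mem_range.1 hk
          have := sum_le_log_loadProd (a := a) (fun j hj => hv j hj k hk')
            (fun j hj => hv1 j hj k hk') i
          linarith [hlog k hk']
      _ = 4 * (D * √Q) := by simp; ring
      _ ≤ 4 * Q / D := by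
          rw [le_div_iff₀ (by linarith)]
          have hQs : √Q * √Q = Q := Real.mul_self_sqrt hQ0.le
          nlinarith [mul_le_mul_of_nonneg_right hsq (Real.sqrt_nonneg Q)]
  have hsplit : ∑ j ∈ Finset.range n with Overfull v a D n (a j), maxUpTo (v j) D =
      ∑ i ∈ Finset.range m with Overfull v a D n i,
        ∑ j ∈ Finset.range n with a j = i, maxUpTo (v j) D := by
    rw [← Finset.sum_fiberwise_of_maps_to (t := (Finset.range m).filter (Overfull v a D n))
      (g := a) fun j hj => ?_]
    · refine Finset.sum_congr rfl fun i hi => ?_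
      rw [Finset.filter_filter]
      refine Finset.sum_congr (Finset.filter_congr fun j _ => ?_) fun _ _ => rfl
      constructor
      · exact fun h => h.2
      · exact fun h => ⟨h ▸ (Finset.mem_filter.1 hi).2, h⟩
    · simp only [Finset.mem_filter, Finset.mem_range] at hj ⊢
      exact ⟨ha j hj.1, hj.2⟩
  rw [hsplit]
  calc _ ≤ ∑ i ∈ Finset.range m with Overfull v a D n i,
        4 * (∑ k ∈ Finset.range D, loadProd v a n i k) / D :=
        Finset.sum_le_sum fun i hi => hmach i (Finset.mem_filter.1 hi).2
    _ ≤ ∑ i ∈ Finset.range m, 4 * (∑ k ∈ Finset.range D, loadProd v a n i k) / D :=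
        Finset.sum_le_sum_of_subset_of_nonneg (Finset.filter_subset _ _) fun i _ _ =>
          div_nonneg (mul_nonneg (by norm_num) (Finset.sum_nonneg fun k hk => by
            linarith [hone i k (Finset.mem_range.1 hk)])) (by linarith)
    _ = 4 * (∑ i ∈ Finset.range m, ∑ k ∈ Finset.range D, loadProd v a n i k) / D := by
        rw [← Finset.sum_div, ← Finset.mul_sum]
    _ ≤ _ := by
        rw [div_le_iff₀ (by linarith)]
        linarith [sum_loadProd_le hm hv hsum hpot]

open Classical in
/-- Jobs on overfull machines are moved according to a bound on the sum of their largest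
coordinates. -/
theorem sum_reassigned_le (hD : 0 < D) (hv : ∀ j < n, ∀ k < D, 0 ≤ v j k)
    (hv1 : ∀ j < n, ∀ k < D, v j k ≤ 1) {a' : ℕ → ℕ}
    (hgood : ∀ j < n, ¬ Overfull v a D n (a j) → a' j = a j) {R : ℝ} {i : ℕ}
    (hR : ∑ j ∈ Finset.range n with Overfull v a D n (a j) ∧ a' j = i, maxUpTo (v j) D ≤ R)
    {k : ℕ} (hk : k < D) :
    ∑ j ∈ Finset.range n with a' j = i, v j k ≤ 8 * Real.log D + R := by
  have hD' : (1 : ℝ) ≤ D := by exact_mod_cast hD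
  rw [← Finset.sum_filter_add_sum_filter_not _ (fun j => Overfull v a D n (a j)),
    Finset.filter_filter, Finset.filter_filter, add_comm]
  refine add_le_add ?_ ?_
  -- An overfull machine keeps none of its jobs. On any other machine each product is at most `D ^
  -- 4`, hence the load is at most `2 log (D ^ 4) = 8 log D`.
  · by_cases hi : Overfull v a D n i
    · rw [Finset.filter_false_of_mem]
      · rw [Finset.sum_empty]
        have := Real.log_nonneg hD'
        positivity
      · rintro j hj ⟨h1, h2⟩
        rw [← hgood j (Finset.mem_range.1 hj) h2, h1] at h2
        exact h2 hi
    · have h1 : ∑ j ∈ Finset.range n with a' j = i ∧ ¬ Overfull v a D n (a j), v j k ≤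
          ∑ j ∈ Finset.range n with a j = i, v j k := by
        refine Finset.sum_le_sum_of_subset_of_nonneg (fun j hj => ?_) fun j hj _ =>
          hv j (Finset.mem_range.1 (Finset.mem_filter.1 hj).1) k hk
        simp only [Finset.mem_filter, Finset.mem_range] at hj ⊢
        exact ⟨hj.1, by rw [← hgood j hj.1 hj.2.2, hj.2.1]⟩
      have h2 := sum_le_log_loadProd (a := a) (fun j hj => hv j hj k hk)
        (fun j hj => hv1 j hj k hk) i
      have hone : ∀ k < D, 1 ≤ loadProd v a n i k := fun k hk =>
        one_le_loadProd (fun j hj => hv j hj k hk) i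
      have h3 : loadProd v a n i k ≤ (D : ℝ) ^ 4 :=
        (Finset.single_le_sum (f := fun k => loadProd v a n i k)
          (fun k hk => by linarith [hone k (Finset.mem_range.1 hk)])
          (Finset.mem_range.2 hk)).trans (not_lt.1 hi)
      have h4 : Real.log (loadProd v a n i k) ≤ Real.log ((D : ℝ) ^ 4) :=
        Real.log_le_log (by linarith [hone k hk]) h3
      rw [Real.log_pow] at h4
      push_cast at h4
      linarith
  · refine le_trans ?_ hR
    have : ((Finset.range n).filter fun j => a' j = i ∧ Overfull v a D n (a j)) =
        (Finset.range n).filter fun j => Overfull v a D n (a j) ∧ a' j = i :=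
      Finset.filter_congr fun j _ => and_comm
    rw [this]
    exact Finset.sum_le_sum fun j _ => le_maxUpTo (v j) hk

end

/-! ### The program

Arrays of natural numbers: `0` input, `1` assignment, `2` number `D` of norms, `3` powers of two,
`4` next power of two, `5`, …, `9` loop variables (`6` for jobs, `7` for norms, `8` for thresholds,
`9` for machines), `10` index of a minimum.

Arrays of real numbers: `0` total mean size, `1` answer of a query, `2` and `3` sums over all jobs,
`4` thresholds, `5` vectors of the jobs, `6` products `loadProd`, `7` products `meanProd` (both
reduced by `1`, so that they are correct initially), `8` increases of the potential, `9` loads by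
reassigned jobs, `10` and `11` sum and maximum over all norms, `12` current threshold. -/

def nCell (a : ℕ) : NExp := .get a (.lit 0) (.lit 0)
def rCell (a : ℕ) : RExp := .get a (.lit 0) (.lit 0)
def rLit (k : ℕ) : RExp := .ofNat (.lit k)
def jobsExp : NExp := .get 0 (.lit 1) (.lit 0)

@[simp] theorem nCell_eval (a : ℕ) (s : State) : (nCell a).eval s = s.nat (a, 0, 0) := rfl
@[simp] theorem rCell_eval (a : ℕ) (s : State) : (rCell a).eval s = s.real (a, 0, 0) := rfl
@[simp] theorem rLit_eval (k : ℕ) (s : State) : (rLit k).eval s = k := rfl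
@[simp] theorem jobsExp_eval (s : State) : jobsExp.eval s = s.nat (0, 1, 0) := rfl

def numNorms (m : ℕ) : ℕ := Nat.log 2 m + 1

theorem two_pow_le_iff_lt_numNorms {m : ℕ} (hm : 0 < m) (k : ℕ) : 2 ^ k ≤ m ↔ k < numNorms m := by
  rw [numNorms, Nat.lt_succ_iff, Nat.le_log_iff_pow_le (by norm_num) hm.ne']

theorem numNorms_le {m : ℕ} (hm : 0 < m) : numNorms m ≤ m := by
  have := (two_pow_le_iff_lt_numNorms hm (Nat.log 2 m)).2 (Nat.lt_succ_self _)
  have h2 : Nat.log 2 m < 2 ^ Nat.log 2 m := Nat.lt_two_pow_self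
  unfold numNorms
  omega

/-- One round of doubling. -/
def doubleProg : Prog :=
  .ite (.natLE (nCell 4) (nCell 0))
    (.seq (.setNat 3 (nCell 2) (.lit 0) (nCell 4)) <|
      .seq (.setNat 2 (.lit 0) (.lit 0) (.add (nCell 2) (.lit 1)))
        (.setNat 4 (.lit 0) (.lit 0) (.add (nCell 4) (nCell 4))))
    .skip

/-- Compute the number of norms and the powers of two. -/
def powersProg : Prog :=
  .seq (.setNat 4 (.lit 0) (.lit 0) (.lit 1)) <|
  .seq (.loop 5 (nCell 0) doubleProg) (.setNat 3 (nCell 2) (.lit 0) (nCell 4))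

/-- The state holds the input, the number of norms and the powers of two. -/
structure Env (m n : ℕ) (s : State) : Prop where
  machines : s.nat (0, 0, 0) = m
  jobs : s.nat (0, 1, 0) = n
  norms : s.nat (2, 0, 0) = numNorms m
  pow : ∀ k ≤ numNorms m, s.nat (3, k, 0) = 2 ^ k

theorem Env.of_agree {m n : ℕ} {s s' : State} (h : Env m n s) {ws wr : List ℕ}
    (hs : Agree ws wr s s') (hw : 0 ∉ ws ∧ 2 ∉ ws ∧ 3 ∉ ws) : Env m n s' :=
  ⟨by rw [hs.nat 0 hw.1, h.machines], by rw [hs.nat 0 hw.1, h.jobs],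
    by rw [hs.nat 2 hw.2.1, h.norms], fun k hk => by rw [hs.nat 3 hw.2.2, h.pow k hk]⟩

theorem Prog.exec_agree (J : JobAccess) (p : Prog) (s : State) :
    Agree p.natWrites p.realWrites s (p.exec J s) :=
  ⟨fun _ hb i j => exec_nat J p hb s i j, fun _ hb i j => exec_real J p hb s i j⟩

theorem Env.exec {m n : ℕ} {s : State} (h : Env m n s) (J : JobAccess) (p : Prog)
    (hw : 0 ∉ p.natWrites ∧ 2 ∉ p.natWrites ∧ 3 ∉ p.natWrites) : Env m n (p.exec J s) :=
  h.of_agree (p.exec_agree J s) hw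

theorem Env.round {m n : ℕ} {s : State} (h : Env m n s) {a t : ℕ}
    (ha : a ≠ 0 ∧ a ≠ 2 ∧ a ≠ 3) : Env m n (s.writeNat (a, 0, 0) t).tick :=
  ⟨by simp [ha.1.symm, h.machines], by simp [h.jobs], by simp [ha.2.1.symm, h.norms],
    fun k hk => by simp [ha.2.2.symm, h.pow k hk]⟩

theorem Prog.exec_seq (J : JobAccess) (p q : Prog) (s : State) :
    (Prog.seq p q).exec J s = q.exec J (p.exec J s) := rfl

/-- The `m` rounds suffice because `numNorms m ≤ m`; later rounds are idle. The write after the loop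
stores the extra power `2 ^ numNorms m`, the base of the effective size for `ℓ = 1`. -/
theorem powersProg_spec (J : JobAccess) {m : ℕ} (n : ℕ) (hm : 0 < m) :
    Env m n (powersProg.exec J (State.init m n)) := by
  have hmn : ∀ j, (powersProg.exec J (State.init m n)).nat (0, j, 0) =
      (State.init m n).nat (0, j, 0) := fun j => Prog.exec_nat J powersProg (by decide) _ _ _
  set s0 : State := (Prog.setNat 4 (.lit 0) (.lit 0) (.lit 1)).exec J (State.init m n) with hs0
  set s1 := (Prog.loop 5 (nCell 0) doubleProg).exec J s0 with hs1
  have key : s1.nat (2, 0, 0) = min m (numNorms m) ∧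
      s1.nat (4, 0, 0) = 2 ^ min m (numNorms m) ∧
      ∀ k < min m (numNorms m), s1.nat (3, k, 0) = 2 ^ k := by
    refine Prog.exec_loop_induction J (fun t s => s.nat (2, 0, 0) = min t (numNorms m) ∧
      s.nat (4, 0, 0) = 2 ^ min t (numNorms m) ∧
      ∀ k < min t (numNorms m), s.nat (3, k, 0) = 2 ^ k) ?_ ?_ ?_
    · simp [hs0, Prog.exec, State.init]
    · simp [hs0, Prog.exec, State.init, NExp.eval]
    · rintro t s ht hag ⟨h2, h4, h3⟩
      have h0 : s.nat (0, 0, 0) = m := by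
        rw [hag.nat 0 (by decide)]; simp [hs0, Prog.exec, State.init, NExp.eval]
      rw [doubleProg, Prog.exec]
      have hc : (Test.natLE (nCell 4) (nCell 0)).Holds (s.writeNat (5, 0, 0) t).tick ↔
          t < numNorms m := by
        simp only [Test.Holds, nCell_eval, State.tick_nat, State.writeNat_nat, Prod.mk.injEq,
          h4, h0]
        norm_num
        rw [two_pow_le_iff_lt_numNorms hm]
        omega
      by_cases h : t < numNorms m
      · have h5 : min t (numNorms m) = t := min_eq_left h.le
        have h6 : min (t + 1) (numNorms m) = t + 1 := min_eq_left h
        rw [h5] at h2 h4 h3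
        rw [h6, if_pos (hc.2 h)]
        simp only [Prog.exec, NExp.eval, nCell_eval, State.tick_nat, State.writeNat_nat,
          Prod.mk.injEq, h2, h4]
        norm_num
        refine ⟨by ring, fun k hk => ?_⟩
        split_ifs with hkt
        · rw [hkt]
        · exact h3 k (by omega)
      · have h5 : min t (numNorms m) = numNorms m := min_eq_right (not_lt.1 h)
        have h6 : min (t + 1) (numNorms m) = numNorms m := min_eq_right (by omega)
        rw [h5] at h2 h4 h3
        rw [h6, if_neg fun h' => h (hc.1 h')]
        simpa [Prog.exec, h2, h4] using h3
  obtain ⟨h2, h4, h3⟩ := key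
  rw [min_eq_right (numNorms_le hm)] at h2 h4 h3
  refine ⟨by rw [hmn]; simp [State.init], by rw [hmn]; simp [State.init], ?_, fun k hk => ?_⟩
  all_goals
    rw [powersProg, Prog.exec_seq, Prog.exec_seq, ← hs0, ← hs1]
    simp only [Prog.exec, NExp.eval, nCell_eval, State.tick_nat, State.writeNat_nat,
      Prod.mk.injEq, h2, h4]
    norm_num
  split_ifs with h
  · rw [h]
  · exact h3 k (by omega)

/-! ### Total size, thresholds and job vectors -/

/-- Compute the total mean size. -/
def totalProg : Prog :=
  .loop 6 jobsExp <|
    .seq (.excMean 1 (.lit 0) (.lit 0) (nCell 6) (rLit 0))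
      (.setReal 0 (.lit 0) (.lit 0) (.add (rCell 0) (rCell 1)))

/-- Sizes are nonnegative, so the exceptional part for threshold `0` is the whole size. -/
def JobAccess.total (J : JobAccess) (n : ℕ) : ℝ := ∑ j ∈ Finset.range n, J.excMean j 0

theorem totalProg_spec (J : JobAccess) {m n : ℕ} {s : State} (hE : Env m n s)
    (h0 : s.real (0, 0, 0) = 0) : (totalProg.exec J s).real (0, 0, 0) = J.total n := by
  refine Prog.exec_loop_induction J
    (fun t s => s.real (0, 0, 0) = ∑ j ∈ Finset.range t, J.excMean j 0)
    (by simp [hE.jobs]) (by simp [h0]) fun t s' _ _ hI => ?_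
  simp [Prog.exec, NExp.eval, RExp.eval, Finset.sum_range_succ, hI]

/-- Sum up the means of the exceptional parts and the effective sizes for the current threshold. -/
def sumsProg : Prog :=
  .seq (.setReal 2 (.lit 0) (.lit 0) (rLit 0)) <|
  .seq (.setReal 3 (.lit 0) (.lit 0) (rLit 0)) <|
  .loop 6 jobsExp <|
    .seq (.excMean 1 (.lit 0) (.lit 0) (nCell 6) (rCell 12)) <|
    .seq (.setReal 2 (.lit 0) (.lit 0) (.add (rCell 2) (rCell 1))) <|
    .seq (.truncEff 1 (.lit 0) (.lit 0) (nCell 6)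
      (.get 3 (.sub (nCell 2) (nCell 7)) (.lit 0)) (rCell 12))
      (.setReal 3 (.lit 0) (.lit 0) (.add (rCell 3) (rCell 1)))

theorem sumsProg_spec (J : JobAccess) {m n k : ℕ} {s : State} (hE : Env m n s)
    (hk : s.nat (7, 0, 0) = k) :
    (sumsProg.exec J s).real (2, 0, 0) =
        ∑ j ∈ Finset.range n, J.excMean j (s.real (12, 0, 0)) ∧
      (sumsProg.exec J s).real (3, 0, 0) =
        ∑ j ∈ Finset.range n, J.truncEff j (2 ^ (numNorms m - k)) (s.real (12, 0, 0)) := by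
  rw [sumsProg, Prog.exec_seq, Prog.exec_seq]
  set s0 := Prog.exec J (.setReal 3 (.lit 0) (.lit 0) (rLit 0))
    (Prog.exec J (.setReal 2 (.lit 0) (.lit 0) (rLit 0)) s) with hs0
  have hE0 : Env m n s0 := (hE.exec J _ (by decide)).exec J _ (by decide)
  have h12 : s0.real (12, 0, 0) = s.real (12, 0, 0) := by simp [hs0, Prog.exec, NExp.eval]
  have h7 : s0.nat (7, 0, 0) = k := by simp [hs0, Prog.exec, hk]
  refine Prog.exec_loop_induction J
    (fun t s' => s'.real (2, 0, 0) =
        ∑ j ∈ Finset.range t, J.excMean j (s.real (12, 0, 0)) ∧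
      s'.real (3, 0, 0) =
        ∑ j ∈ Finset.range t, J.truncEff j (2 ^ (numNorms m - k)) (s.real (12, 0, 0)))
    (by simp [hE0.jobs]) (by simp [hs0, Prog.exec, NExp.eval]) fun t s' _ hag hI => ?_
  have hE' := hE0.of_agree hag (by decide)
  have h12' : s'.real (12, 0, 0) = s.real (12, 0, 0) := by rw [hag.real 12 (by decide), h12]
  have h7' : s'.nat (7, 0, 0) = k := by rw [hag.nat 7 (by decide), h7]
  simp [Prog.exec, NExp.eval, RExp.eval, Finset.sum_range_succ, hI, h12', h7', hE'.norms,
    hE'.pow (numNorms m - k) (Nat.sub_le _ _)]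

/-- The candidates for thresholds. -/
def JobAccess.thr (J : JobAccess) (m n t : ℕ) : ℝ :=
  t * (J.total n / ((n + m + 1 : ℕ) : ℝ))

/-- The `t`-th candidate is large enough for the norm with `ℓ = 2 ^ k`. -/
def JobAccess.Good (J : JobAccess) (m n k t : ℕ) : Prop :=
  ∑ j ∈ Finset.range n, J.excMean j (J.thr m n t) ≤ 2 ^ k * J.thr m n t ∧
    ∑ j ∈ Finset.range n, J.truncEff j (2 ^ (numNorms m - k)) (J.thr m n t) ≤ 11 * m

def candidatesExp : NExp := .add (.add jobsExp (nCell 0)) (.lit 1)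

/-- Find the least good candidate for the current norm. -/
def searchProg : Prog :=
  .loop 8 candidatesExp <|
    .seq (.setReal 12 (.lit 0) (.lit 0)
      (.mul (.ofNat (.sub candidatesExp (nCell 8))) (.div (rCell 0) (.ofNat candidatesExp)))) <|
    .seq sumsProg <|
    .ite (.and (.realLE (rCell 2) (.mul (.ofNat (.get 3 (nCell 7) (.lit 0))) (rCell 12)))
        (.realLE (rCell 3) (.mul (rLit 11) (.ofNat (nCell 0)))))
      (.setReal 4 (nCell 7) (.lit 0) (rCell 12)) .skip

/-- Candidates are tested in decreasing order and every good one overwrites the answer, so the last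
write is the least good one. No monotonicity of goodness is needed. -/
theorem searchProg_spec (J : JobAccess) {m n k : ℕ} {s : State} (hE : Env m n s)
    (hk : s.nat (7, 0, 0) = k) (hkD : k < numNorms m) (h0 : s.real (0, 0, 0) = J.total n)
    (hgood : J.Good m n k (n + m + 1)) :
    ∃ T, 0 < T ∧ T ≤ n + m + 1 ∧ J.Good m n k T ∧ (∀ t, 0 < t → t < T → ¬ J.Good m n k t) ∧
      (searchProg.exec J s).real (4, k, 0) = J.thr m n T := by
  have key := Prog.exec_loop_induction J (a := 8) (e := candidatesExp) (s := s)
    (body := .seq (.setReal 12 (.lit 0) (.lit 0)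
      (.mul (.ofNat (.sub candidatesExp (nCell 8))) (.div (rCell 0) (.ofNat candidatesExp)))) <|
    .seq sumsProg <|
    .ite (.and (.realLE (rCell 2) (.mul (.ofNat (.get 3 (nCell 7) (.lit 0))) (rCell 12)))
        (.realLE (rCell 3) (.mul (rLit 11) (.ofNat (nCell 0)))))
      (.setReal 4 (nCell 7) (.lit 0) (rCell 12)) .skip) (k := n + m + 1)
    (fun r s' => (∀ t, n + m + 1 - r < t → t ≤ n + m + 1 → ¬ J.Good m n k t) ∨
      ∃ T, n + m + 1 - r < T ∧ T ≤ n + m + 1 ∧ J.Good m n k T ∧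
        (∀ t, n + m + 1 - r < t → t < T → ¬ J.Good m n k t) ∧
        s'.real (4, k, 0) = J.thr m n T) ?_ ?_ ?_
  · rcases key with h | ⟨T, h1, h2, h3, h4, h5⟩
    · exact absurd hgood (h _ (by omega) le_rfl)
    · exact ⟨T, by omega, h2, h3, fun t ht htT => h4 t (by omega) htT, h5⟩
  · simp [candidatesExp, NExp.eval, hE.jobs, hE.machines]
  · left
    intro t h1 h2
    omega
  · intro r s' hr hag hI
    have hE' := (hE.of_agree hag (by decide)).round (a := 8) (t := r) (by decide)
    have h0' : s'.real (0, 0, 0) = J.total n := by rw [hag.real 0 (by decide), h0]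
    have h7' : s'.nat (7, 0, 0) = k := by rw [hag.nat 7 (by decide), hk]
    set s1 := (s'.writeNat (8, 0, 0) r).tick with hs1
    set s2 := (Prog.setReal 12 (.lit 0) (.lit 0)
      (.mul (.ofNat (.sub candidatesExp (nCell 8))) (.div (rCell 0) (.ofNat candidatesExp)))).exec
        J s1 with hs2
    have hE2 : Env m n s2 := hE'.exec J _ (by decide)
    have h12 : s2.real (12, 0, 0) = J.thr m n (n + m + 1 - r) := by
      have : s1.real (0, 0, 0) = J.total n := h0'
      have h8 : s1.nat (8, 0, 0) = r := by simp [hs1]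
      simp only [hs2, Prog.exec, candidatesExp, NExp.eval, RExp.eval, State.tick_real,
        State.writeReal_real, jobsExp_eval, nCell_eval, rCell_eval, hE'.jobs, hE'.machines, this,
        h8, if_true]
      rfl
    have h72 : s2.nat (7, 0, 0) = k := by simp [hs2, Prog.exec, hs1, h7']
    have h42 : s2.real (4, k, 0) = s'.real (4, k, 0) := by
      simp [hs2, Prog.exec, hs1]
    obtain ⟨hS1, hS2⟩ := sumsProg_spec J hE2 h72
    set s3 := sumsProg.exec J s2 with hs3
    have hE3 : Env m n s3 := hE2.exec J _ (by decide)
    have h73 : s3.nat (7, 0, 0) = k := by rw [hs3, Prog.exec_nat J _ (by decide), h72]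
    have h123 : s3.real (12, 0, 0) = J.thr m n (n + m + 1 - r) := by
      rw [hs3, Prog.exec_real J _ (by decide), h12]
    have h43 : s3.real (4, k, 0) = s'.real (4, k, 0) := by
      rw [hs3, Prog.exec_real J _ (by decide), h42]
    rw [h12] at hS1 hS2
    set u := n + m + 1 - r with hu
    have hu1 : n + m + 1 - (r + 1) = u - 1 := by omega
    have hu0 : 0 < u := by omega
    rw [hu1, Prog.exec, ← hs2, Prog.exec, ← hs3, Prog.exec]
    have hcond : (Test.and (.realLE (rCell 2) (.mul (.ofNat (.get 3 (nCell 7) (.lit 0)))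
        (rCell 12))) (.realLE (rCell 3) (.mul (rLit 11) (.ofNat (nCell 0))))).Holds s3 ↔
        J.Good m n k u := by
      simp only [Test.Holds, RExp.eval, NExp.eval, rCell_eval, rLit_eval, nCell_eval, hS1, hS2,
        h73, h123, hE3.machines, hE3.pow k hkD.le]
      unfold JobAccess.Good
      push_cast
      rfl
    by_cases hG : J.Good m n k u
    · right
      rw [if_pos (hcond.2 hG)]
      refine ⟨u, by omega, by omega, hG, fun t h1 h2 => by omega, ?_⟩
      simp [Prog.exec, h73, h123, NExp.eval]
    · rw [if_neg fun h => hG (hcond.1 h)]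
      have hstep : ∀ t, u - 1 < t → (u < t ∨ t = u) := fun t ht => by omega
      rcases hI with h | ⟨T, h1, h2, h3, h4, h5⟩
      · left
        intro t ht htN
        rcases hstep t ht with h' | rfl
        · exact h t h' htN
        · exact hG
      · right
        refine ⟨T, by omega, h2, h3, fun t ht htT => ?_, ?_⟩
        · rcases hstep t ht with h' | rfl
          · exact h4 t h' htT
          · exact hG
        · simp only [Prog.exec, State.tick_real]
          rw [h43, h5]

/-- Compute the coordinates of all jobs for the current norm. -/
def fillProg : Prog :=
  .loop 6 jobsExp <|
    .truncEff 5 (nCell 6) (nCell 7) (nCell 6) (.get 3 (.sub (nCell 2) (nCell 7)) (.lit 0))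
      (.get 4 (nCell 7) (.lit 0))

theorem fillProg_spec (J : JobAccess) {m n k : ℕ} {s : State} (hE : Env m n s)
    (hk : s.nat (7, 0, 0) = k) :
    (∀ j < n, (fillProg.exec J s).real (5, j, k) =
        J.truncEff j (2 ^ (numNorms m - k)) (s.real (4, k, 0))) ∧
      ∀ j, ∀ k' ≠ k, (fillProg.exec J s).real (5, j, k') = s.real (5, j, k') := by
  refine Prog.exec_loop_induction J
    (fun t s' => (∀ j < t, s'.real (5, j, k) =
        J.truncEff j (2 ^ (numNorms m - k)) (s.real (4, k, 0))) ∧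
      ∀ j, ∀ k' ≠ k, s'.real (5, j, k') = s.real (5, j, k'))
    (by simp [hE.jobs]) (by simp) fun t s' _ hag hI => ?_
  have hE' := hE.of_agree hag (by decide)
  have h7' : s'.nat (7, 0, 0) = k := by rw [hag.nat 7 (by decide), hk]
  have h4' : s'.real (4, k, 0) = s.real (4, k, 0) := hag.real 4 (by decide) _ _
  constructor
  · intro j hj
    simp only [Prog.exec, NExp.eval, RExp.eval, State.tick_real, State.writeReal_real,
      nCell_eval, State.tick_nat, State.writeNat_nat, State.writeNat_real, Prod.mk.injEq, h7',
      hE'.norms]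
    norm_num [h4', hE'.pow (numNorms m - k) (Nat.sub_le _ _)]
    split_ifs with h
    · rw [h]
    · exact hI.1 j (by omega)
  · intro j k' hk'
    simp only [Prog.exec, State.tick_real, State.writeReal_real, nCell_eval, State.tick_nat,
      State.writeNat_nat, State.writeNat_real, Prod.mk.injEq, h7']
    norm_num [hk']
    rw [hI.2 j k' hk']

/-- Compute the vectors of all jobs. -/
def vectorsProg : Prog := .loop 7 (nCell 2) (.seq searchProg fillProg)

theorem vectorsProg_spec (J : JobAccess) {m n : ℕ} {s : State} (hE : Env m n s)
    (h0 : s.real (0, 0, 0) = J.total n)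
    (hgood : ∀ k < numNorms m, J.Good m n k (n + m + 1)) :
    ∀ k < numNorms m, ∃ T, 0 < T ∧ T ≤ n + m + 1 ∧ J.Good m n k T ∧
      (∀ t, 0 < t → t < T → ¬ J.Good m n k t) ∧
      ∀ j < n, (vectorsProg.exec J s).real (5, j, k) =
        J.truncEff j (2 ^ (numNorms m - k)) (J.thr m n T) := by
  refine Prog.exec_loop_induction J
    (fun K s' => ∀ k < K, ∃ T, 0 < T ∧ T ≤ n + m + 1 ∧ J.Good m n k T ∧
      (∀ t, 0 < t → t < T → ¬ J.Good m n k t) ∧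
      ∀ j < n, s'.real (5, j, k) = J.truncEff j (2 ^ (numNorms m - k)) (J.thr m n T))
    (by simp [hE.norms]) (by simp) fun K s' hK hag hI => ?_
  have hE' := (hE.of_agree hag (by decide)).round (a := 7) (t := K) (by decide)
  set s1 := (s'.writeNat (7, 0, 0) K).tick with hs1
  have h0' : s1.real (0, 0, 0) = J.total n := by
    simp only [hs1, State.tick_real, State.writeNat_real]
    rw [hag.real 0 (by decide), h0]
  have h7 : s1.nat (7, 0, 0) = K := by simp [hs1]
  obtain ⟨T, hT0, hTN, hTg, hTm, hT4⟩ := searchProg_spec J hE' h7 hK h0' (hgood K hK)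
  rw [Prog.exec]
  set s2 := searchProg.exec J s1 with hs2
  have hE2 : Env m n s2 := hE'.exec J _ (by decide)
  have h72 : s2.nat (7, 0, 0) = K := by rw [hs2, Prog.exec_nat J _ (by decide), h7]
  obtain ⟨hf1, hf2⟩ := fillProg_spec J hE2 h72
  intro k hk
  rcases Nat.lt_succ_iff_lt_or_eq.1 hk with h | rfl
  · obtain ⟨T', h1, h2, h3, h4, h5⟩ := hI k h
    refine ⟨T', h1, h2, h3, h4, fun j hj => ?_⟩
    rw [hf2 j k h.ne, hs2, Prog.exec_real J _ (by decide), ← h5 j hj]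
    rfl
  · exact ⟨T, hT0, hTN, hTg, hTm, fun j hj => by rw [hf1 j hj, hT4]⟩

/-- Find the index `i < m` of a least entry `(i, 0)` of array `a`. -/
def argminProg (a : ℕ) : Prog :=
  .seq (.setNat 10 (.lit 0) (.lit 0) (.lit 0)) <|
  .loop 9 (nCell 0) <|
    .ite (.realLE (.get a (nCell 9) (.lit 0)) (.get a (nCell 10) (.lit 0)))
      (.setNat 10 (.lit 0) (.lit 0) (nCell 9)) .skip

theorem argminProg_spec (J : JobAccess) {m n : ℕ} (hm : 0 < m) {s : State} (hE : Env m n s)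
    (a : ℕ) :
    (argminProg a |>.exec J s).nat (10, 0, 0) < m ∧
      ∀ i < m, s.real (a, (argminProg a |>.exec J s).nat (10, 0, 0), 0) ≤ s.real (a, i, 0) := by
  rw [argminProg, Prog.exec_seq]
  set s0 := (Prog.setNat 10 (.lit 0) (.lit 0) (.lit 0)).exec J s with hs0
  have hE0 : Env m n s0 := hE.exec J _ (by decide)
  have key := Prog.exec_loop_induction J (a := 9) (e := nCell 0) (s := s0) (k := m)
    (body := .ite (.realLE (.get a (nCell 9) (.lit 0)) (.get a (nCell 10) (.lit 0)))
      (.setNat 10 (.lit 0) (.lit 0) (nCell 9)) .skip)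
    (fun t s' => s'.nat (10, 0, 0) < m ∧
      ∀ i < t, s.real (a, s'.nat (10, 0, 0), 0) ≤ s.real (a, i, 0))
    (by simp [hE0.machines]) (by simp [hs0, Prog.exec, NExp.eval, hm]) ?_
  · exact key
  · intro t s' ht hag hI
    have hr : ∀ i, s'.real (a, i, 0) = s.real (a, i, 0) := fun i => by
      rw [hag.real a (by simp [Prog.realWrites])]; simp [hs0, Prog.exec]
    simp only [Prog.exec, Test.Holds, RExp.eval, NExp.eval, nCell_eval, State.tick_nat,
      State.tick_real, State.writeNat_nat, State.writeNat_real, Prod.mk.injEq, hr]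
    norm_num
    split_ifs with h
    · simp only [State.tick_nat, State.writeNat_nat, Prod.mk.injEq]
      norm_num
      refine ⟨ht, fun i hi => ?_⟩
      rcases (by omega : i < t ∨ i = t) with h' | rfl
      · exact h.trans (hI.2 i h')
      · exact le_rfl
    · simp only [State.tick_nat, State.writeNat_nat, Prod.mk.injEq]
      norm_num
      refine ⟨hI.1, fun i hi => ?_⟩
      rcases (by omega : i < t ∨ i = t) with h' | rfl
      · exact hI.2 i h'
      · exact (not_le.1 h).le

/-! ### Greedy assignment by the potential -/

/-- Entry `(j, k)` of the vectors, for the current job and norm. -/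
def entryExp : RExp := .get 5 (nCell 6) (nCell 7)

/-- Update `meanProd` for the current job. -/
def updateMeanProg : Prog :=
  .loop 7 (nCell 2) <| .setReal 7 (nCell 7) (.lit 0)
    (.sub (.mul (.add (rLit 1) (.get 7 (nCell 7) (.lit 0)))
      (.add (rLit 1) (.div entryExp (.ofNat (nCell 0))))) (rLit 1))

theorem updateMeanProg_spec (J : JobAccess) {m n j : ℕ} {s : State} (hE : Env m n s)
    (hj : s.nat (6, 0, 0) = j) : ∀ k < numNorms m, (updateMeanProg.exec J s).real (7, k, 0) =
      (1 + s.real (7, k, 0)) * (1 + s.real (5, j, k) / m) - 1 := by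
  -- The second conjunct serves the induction: round `t` reads entry `t`, which must still be the
  -- old one.
  have key : (∀ k < numNorms m, (updateMeanProg.exec J s).real (7, k, 0) =
      (1 + s.real (7, k, 0)) * (1 + s.real (5, j, k) / m) - 1) ∧
      ∀ k ≥ numNorms m, (updateMeanProg.exec J s).real (7, k, 0) = s.real (7, k, 0) := by
    refine Prog.exec_loop_induction J
      (fun t s' => (∀ k < t, s'.real (7, k, 0) =
        (1 + s.real (7, k, 0)) * (1 + s.real (5, j, k) / m) - 1) ∧
        ∀ k ≥ t, s'.real (7, k, 0) = s.real (7, k, 0)) (by simp [hE.norms]) (by simp) ?_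
    intro t s' _ hag hI
    have hE' := hE.of_agree hag (by decide)
    have hj' : s'.nat (6, 0, 0) = j := by rw [hag.nat 6 (by decide), hj]
    have h5 : ∀ k, s'.real (5, j, k) = s.real (5, j, k) := hag.real 5 (by decide) _
    simp only [Prog.exec, entryExp, NExp.eval, RExp.eval, State.tick_real, State.writeReal_real,
      nCell_eval, State.tick_nat, State.writeNat_nat, State.writeNat_real, Prod.mk.injEq, hj',
      hE'.machines, rLit_eval]
    norm_num [h5, hj', hE'.machines]
    refine ⟨fun k hk => ?_, fun k hk => ?_⟩
    · split_ifs with h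
      · rw [h, hI.2 t le_rfl]
      · exact hI.1 k (by omega)
    · rw [if_neg (by omega)]
      exact hI.2 k (by omega)
  exact key.1

def incrementProg : Prog :=
  .loop 7 (nCell 2) <| .setReal 8 (nCell 9) (.lit 0)
    (.add (.get 8 (nCell 9) (.lit 0))
      (.div (.mul (.add (rLit 1) (.get 6 (nCell 9) (nCell 7))) entryExp)
        (.add (rLit 1) (.get 7 (nCell 7) (.lit 0)))))

theorem incrementProg_spec (J : JobAccess) {m n i j : ℕ} {s : State} (hE : Env m n s)
    (hj : s.nat (6, 0, 0) = j) (hi : s.nat (9, 0, 0) = i) (h0 : s.real (8, i, 0) = 0) :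
    (incrementProg.exec J s).real (8, i, 0) = ∑ k ∈ Finset.range (numNorms m),
        (1 + s.real (6, i, k)) * s.real (5, j, k) / (1 + s.real (7, k, 0)) ∧
      ∀ i' ≠ i, (incrementProg.exec J s).real (8, i', 0) = s.real (8, i', 0) := by
  refine Prog.exec_loop_induction J
    (fun t s' => s'.real (8, i, 0) = ∑ k ∈ Finset.range t,
        (1 + s.real (6, i, k)) * s.real (5, j, k) / (1 + s.real (7, k, 0)) ∧
      ∀ i' ≠ i, s'.real (8, i', 0) = s.real (8, i', 0)) (by simp [hE.norms]) (by simp [h0]) ?_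
  intro t s' _ hag hI
  have hj' : s'.nat (6, 0, 0) = j := by rw [hag.nat 6 (by decide), hj]
  have hi' : s'.nat (9, 0, 0) = i := by rw [hag.nat 9 (by decide), hi]
  have h5 : ∀ i k, s'.real (5, i, k) = s.real (5, i, k) := hag.real 5 (by decide)
  have h6 : ∀ i k, s'.real (6, i, k) = s.real (6, i, k) := hag.real 6 (by decide)
  have h7 : ∀ i k, s'.real (7, i, k) = s.real (7, i, k) := hag.real 7 (by decide)
  simp only [Prog.exec, entryExp, NExp.eval, RExp.eval, State.tick_real, State.writeReal_real,
    nCell_eval, State.tick_nat, State.writeNat_nat, State.writeNat_real, Prod.mk.injEq,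
    rLit_eval]
  norm_num [h5, h6, h7, hj', hi', Finset.sum_range_succ, hI.1]
  intro i' hne
  rw [if_neg hne, hI.2 i' hne]

/-- Compute the increases of the potential for the current job. -/
def increasesProg : Prog :=
  .loop 9 (nCell 0) <| .seq (.setReal 8 (nCell 9) (.lit 0) (rLit 0)) incrementProg

theorem increasesProg_spec (J : JobAccess) {m n j : ℕ} {s : State} (hE : Env m n s)
    (hj : s.nat (6, 0, 0) = j) :
    ∀ i < m, (increasesProg.exec J s).real (8, i, 0) = ∑ k ∈ Finset.range (numNorms m),
        (1 + s.real (6, i, k)) * s.real (5, j, k) / (1 + s.real (7, k, 0)) := by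
  refine Prog.exec_loop_induction J
    (fun t s' => ∀ i < t, s'.real (8, i, 0) = ∑ k ∈ Finset.range (numNorms m),
        (1 + s.real (6, i, k)) * s.real (5, j, k) / (1 + s.real (7, k, 0)))
    (by simp [hE.machines]) (by simp) ?_
  intro t s' _ hag hI
  have hE' := (hE.of_agree hag (by decide)).round (a := 9) (t := t) (by decide)
  have hj' : s'.nat (6, 0, 0) = j := by rw [hag.nat 6 (by decide), hj]
  have h5 : ∀ i k, s'.real (5, i, k) = s.real (5, i, k) := hag.real 5 (by decide)
  have h6 : ∀ i k, s'.real (6, i, k) = s.real (6, i, k) := hag.real 6 (by decide)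
  have h7 : ∀ i k, s'.real (7, i, k) = s.real (7, i, k) := hag.real 7 (by decide)
  rw [Prog.exec_seq]
  set s1 := (Prog.setReal 8 (nCell 9) (.lit 0) (rLit 0)).exec J (s'.writeNat (9, 0, 0) t).tick
    with hs1
  have hE1 : Env m n s1 := hE'.exec J _ (by decide)
  obtain ⟨k1, k2⟩ := incrementProg_spec J (i := t) hE1
    (by simp [hs1, Prog.exec, hj'] : s1.nat (6, 0, 0) = j)
    (by simp [hs1, Prog.exec]) (by simp [hs1, Prog.exec, NExp.eval])
  have e5 : ∀ i k, s1.real (5, i, k) = s.real (5, i, k) := by simp [hs1, Prog.exec, h5]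
  have e6 : ∀ i k, s1.real (6, i, k) = s.real (6, i, k) := by simp [hs1, Prog.exec, h6]
  have e7 : ∀ i k, s1.real (7, i, k) = s.real (7, i, k) := by simp [hs1, Prog.exec, h7]
  intro i hi
  rcases (by omega : i < t ∨ i = t) with h | rfl
  · rw [k2 i h.ne, ← hI i h]
    simp [hs1, Prog.exec, h.ne]
  · simpa only [e5, e6, e7] using k1

/-- Update `loadProd` after the current job has been assigned. -/
def updateLoadProg : Prog :=
  .loop 7 (nCell 2) <| .setReal 6 (nCell 10) (nCell 7)
    (.sub (.mul (.add (rLit 1) (.get 6 (nCell 10) (nCell 7))) (.add (rLit 1) entryExp)) (rLit 1))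

theorem updateLoadProg_spec (J : JobAccess) {m n b j : ℕ} {s : State} (hE : Env m n s)
    (hj : s.nat (6, 0, 0) = j) (hb : s.nat (10, 0, 0) = b) :
    ∀ i, ∀ k < numNorms m, (updateLoadProg.exec J s).real (6, i, k) =
      if b = i then (1 + s.real (6, i, k)) * (1 + s.real (5, j, k)) - 1 else s.real (6, i, k) := by
  have key : (∀ i, ∀ k < numNorms m, (updateLoadProg.exec J s).real (6, i, k) =
      if b = i then (1 + s.real (6, i, k)) * (1 + s.real (5, j, k)) - 1 else s.real (6, i, k)) ∧
      ∀ i, ∀ k ≥ numNorms m, (updateLoadProg.exec J s).real (6, i, k) = s.real (6, i, k) := by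
    refine Prog.exec_loop_induction J
      (fun t s' => (∀ i, ∀ k < t, s'.real (6, i, k) =
        if b = i then (1 + s.real (6, i, k)) * (1 + s.real (5, j, k)) - 1 else s.real (6, i, k)) ∧
        ∀ i, ∀ k ≥ t, s'.real (6, i, k) = s.real (6, i, k)) (by simp [hE.norms]) (by simp) ?_
    intro t s' _ hag hI
    have hj' : s'.nat (6, 0, 0) = j := by rw [hag.nat 6 (by decide), hj]
    have hb' : s'.nat (10, 0, 0) = b := by rw [hag.nat 10 (by decide), hb]
    have h5 : ∀ k, s'.real (5, j, k) = s.real (5, j, k) := hag.real 5 (by decide) _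
    simp only [Prog.exec, entryExp, RExp.eval, State.tick_real, State.writeReal_real,
      nCell_eval, State.tick_nat, State.writeNat_nat, State.writeNat_real, Prod.mk.injEq,
      rLit_eval]
    norm_num [h5, hj', hb', hI.2 b t le_rfl]
    refine ⟨fun i k hk => ?_, fun i k hk => ?_⟩
    · by_cases hkt : k = t
      · subst hkt
        by_cases hbi : i = b
        · simp [hbi]
        · rw [if_neg fun h => hbi h.1, if_neg (Ne.symm hbi), hI.2 i k le_rfl]
      · rw [if_neg fun h => hkt h.2]
        exact hI.1 i k (by omega)
    · rw [if_neg (by omega)]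
      exact hI.2 i k (by omega)
  exact key.1

/-- Assign all jobs, each of them so as to minimize the potential. -/
def greedyProg : Prog :=
  .loop 6 jobsExp <|
    .seq updateMeanProg <|
    .seq increasesProg <|
    .seq (argminProg 8) <|
    .seq (.setNat 1 (nCell 6) (.lit 0) (nCell 10)) updateLoadProg

/-- The assignment in a state. -/
def State.assignment (s : State) (j : ℕ) : ℕ := s.nat (1, j, 0)

/-- The vectors in a state. -/
def State.vectors (s : State) (j k : ℕ) : ℝ := s.real (5, j, k)

theorem greedyProg_spec (J : JobAccess) {m n : ℕ} (hm : 0 < m) {s : State} (hE : Env m n s)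
    (hv : ∀ j < n, ∀ k < numNorms m, 0 ≤ s.vectors j k)
    (h6 : ∀ i k, s.real (6, i, k) = 0) (h7 : ∀ k, s.real (7, k, 0) = 0) :
    (∀ j < n, (greedyProg.exec J s).assignment j < m) ∧
    (∀ i, ∀ k < numNorms m, (greedyProg.exec J s).real (6, i, k) =
      loadProd s.vectors (greedyProg.exec J s).assignment n i k - 1) ∧
    potential s.vectors (greedyProg.exec J s).assignment m (numNorms m) n ≤ m * numNorms m := by
  have key : (∀ j < n, (greedyProg.exec J s).assignment j < m) ∧
    (∀ i, ∀ k < numNorms m, (greedyProg.exec J s).real (6, i, k) =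
      loadProd s.vectors (greedyProg.exec J s).assignment n i k - 1) ∧
    (∀ k < numNorms m, (greedyProg.exec J s).real (7, k, 0) = meanProd s.vectors m n k - 1) ∧
    potential s.vectors (greedyProg.exec J s).assignment m (numNorms m) n ≤ m * numNorms m := by
    refine Prog.exec_loop_induction J
      (fun t s' => (∀ j < t, s'.assignment j < m) ∧
        (∀ i, ∀ k < numNorms m, s'.real (6, i, k) =
          loadProd s.vectors s'.assignment t i k - 1) ∧
        (∀ k < numNorms m, s'.real (7, k, 0) = meanProd s.vectors m t k - 1) ∧
        potential s.vectors s'.assignment m (numNorms m) t ≤ m * numNorms m)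
      (by simp [hE.jobs]) ?_ ?_
    · refine ⟨by simp, fun i k _ => ?_, fun k _ => ?_, potential_zero.le⟩
      · simp [h6, loadProd]
      · simp [h7, meanProd]
    rintro t s' ht hag ⟨I1, I2, I3, I4⟩
    have hE0 := (hE.of_agree hag (by decide)).round (a := 6) (t := t) (by decide)
    have h50 : ∀ i k, s'.real (5, i, k) = s.vectors i k := hag.real 5 (by decide)
    set s0 := (s'.writeNat (6, 0, 0) t).tick with hs0
    have hj0 : s0.nat (6, 0, 0) = t := by simp [hs0]
    rw [Prog.exec_seq, Prog.exec_seq, Prog.exec_seq, Prog.exec_seq]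
    have u1 := updateMeanProg_spec J hE0 hj0
    set s1 := updateMeanProg.exec J s0 with hs1
    have hE1 : Env m n s1 := hE0.exec J _ (by decide)
    have hj1 : s1.nat (6, 0, 0) = t := by rw [hs1, Prog.exec_nat J _ (by decide), hj0]
    have h51 : ∀ i k, s1.real (5, i, k) = s.vectors i k := fun i k => by
      rw [hs1, Prog.exec_real J _ (by decide)]; exact h50 i k
    have h61 : ∀ i, ∀ k < numNorms m, s1.real (6, i, k) =
        loadProd s.vectors s'.assignment t i k - 1 := fun i k hk => by
      rw [hs1, Prog.exec_real J _ (by decide)]; exact I2 i k hk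
    have h71 : ∀ k < numNorms m, s1.real (7, k, 0) = meanProd s.vectors m (t + 1) k - 1 := by
      intro k hk
      have e7 : s0.real (7, k, 0) = meanProd s.vectors m t k - 1 := I3 k hk
      have e5 : s0.real (5, t, k) = s.vectors t k := h50 t k
      rw [u1 k hk, meanProd_succ, e7, e5]
      ring
    have u2 := increasesProg_spec J hE1 hj1
    set s2 := increasesProg.exec J s1 with hs2
    have hE2 : Env m n s2 := hE1.exec J _ (by decide)
    have hj2 : s2.nat (6, 0, 0) = t := by rw [hs2, Prog.exec_nat J _ (by decide), hj1]
    have h82 : ∀ i < m, s2.real (8, i, 0) =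
        increase s.vectors s'.assignment m (numNorms m) t i := by
      intro i hi
      rw [u2 i hi, increase]
      refine Finset.sum_congr rfl fun k hk => ?_
      have hk' := Finset.mem_range.1 hk
      rw [h51, h61 i k hk', h71 k hk']
      ring_nf
    obtain ⟨hb, hmin⟩ := argminProg_spec J hm hE2 8
    set s3 := (argminProg 8).exec J s2 with hs3
    have hE3 : Env m n s3 := hE2.exec J _ (by decide)
    have hj3 : s3.nat (6, 0, 0) = t := by rw [hs3, Prog.exec_nat J _ (by decide), hj2]
    set b := s3.nat (10, 0, 0) with hbdef
    set s4 := (Prog.setNat 1 (nCell 6) (.lit 0) (nCell 10)).exec J s3 with hs4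
    have hE4 : Env m n s4 := hE3.exec J _ (by decide)
    have hj4 : s4.nat (6, 0, 0) = t := by rw [hs4, Prog.exec_nat J _ (by decide), hj3]
    have hb4 : s4.nat (10, 0, 0) = b := by rw [hs4, Prog.exec_nat J _ (by decide)]
    have ha4 : ∀ j, s4.nat (1, j, 0) = if j = t then b else s'.assignment j := by
      intro j
      have : s3.nat (1, j, 0) = s'.assignment j := by
        rw [hs3, Prog.exec_nat J _ (by decide), hs2, Prog.exec_nat J _ (by decide), hs1,
          Prog.exec_nat J _ (by decide)]
        simp [hs0, State.assignment]
      simp [hs4, Prog.exec, NExp.eval, hj3, this, ← hbdef]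
    have u5 := updateLoadProg_spec J hE4 hj4 hb4
    set s5 := updateLoadProg.exec J s4 with hs5
    have ha5 : ∀ j, s5.assignment j = if j = t then b else s'.assignment j := by
      intro j
      rw [State.assignment, hs5, Prog.exec_nat J _ (by decide), ha4 j]
    have hlt : ∀ j < t, s5.assignment j = s'.assignment j := fun j hj => by
      rw [ha5, if_neg hj.ne]
    have hat : s5.assignment t = b := by rw [ha5, if_pos rfl]
    -- The products over the jobs before `t` do not see the machine just chosen for job `t`.
    have hlp : ∀ i k, loadProd s.vectors s5.assignment t i k =
        loadProd s.vectors s'.assignment t i k := fun i k =>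
      loadProd_congr i k (fun _ _ => rfl) hlt
    have hinc : ∀ i, increase s.vectors s5.assignment m (numNorms m) t i =
        increase s.vectors s'.assignment m (numNorms m) t i := fun i => by
      simp only [increase, hlp]
    refine ⟨fun j hj => ?_, fun i k hk => ?_, fun k hk => ?_, ?_⟩
    · rcases (by omega : j < t ∨ j = t) with h | rfl
      · rw [hlt j h]; exact I1 j h
      · rw [hat]; exact hb
    · have h64 : s4.real (6, i, k) = loadProd s.vectors s'.assignment t i k - 1 := by
        rw [hs4, Prog.exec_real J _ (by decide), hs3, Prog.exec_real J _ (by decide), hs2,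
          Prog.exec_real J _ (by decide), h61 i k hk]
      have h54 : s4.real (5, t, k) = s.vectors t k := by
        rw [hs4, Prog.exec_real J _ (by decide), hs3, Prog.exec_real J _ (by decide), hs2,
          Prog.exec_real J _ (by decide), h51]
      rw [u5 i k hk, loadProd_succ, hlp, hat, h64, h54]
      split_ifs <;> ring
    · rw [hs5, Prog.exec_real J _ (by decide), hs4, Prog.exec_real J _ (by decide), hs3,
        Prog.exec_real J _ (by decide), hs2, Prog.exec_real J _ (by decide), h71 k hk]
    · have h1 : potential s.vectors s5.assignment m (numNorms m) t ≤ m * numNorms m := by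
        have : potential s.vectors s5.assignment m (numNorms m) t =
            potential s.vectors s'.assignment m (numNorms m) t := by simp only [potential, hlp]
        rw [this]; exact I4
      refine le_trans (potential_succ_le hm (fun j hj k hk => hv j (by omega) k hk)
        (by rw [hat]; exact hb) fun i hi => ?_) h1
      rw [hat, hinc, hinc, ← h82 i hi, ← h82 b hb]
      exact hmin i hi
  exact ⟨key.1, key.2.1, key.2.2.2⟩

/-! ### Reassigning the jobs on overfull machines -/

def scanLoop : Prog :=
  .loop 7 (nCell 2) <|
    .seq (.setReal 10 (.lit 0) (.lit 0) (.add (rCell 10)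
      (.add (rLit 1) (.get 6 (.get 1 (nCell 6) (.lit 0)) (nCell 7)))))
      (.ite (.realLE (rCell 11) entryExp) (.setReal 11 (.lit 0) (.lit 0) entryExp) .skip)

/-- Compute the sum that tells whether the machine of the current job is overfull, and the largest
coordinate of the current job. -/
def scanProg : Prog :=
  .seq (.setReal 10 (.lit 0) (.lit 0) (rLit 0)) <|
  .seq (.setReal 11 (.lit 0) (.lit 0) (rLit 0)) scanLoop

theorem scanProg_spec (J : JobAccess) {m n j : ℕ} {s : State} (hE : Env m n s)
    (hj : s.nat (6, 0, 0) = j) :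
    (scanProg.exec J s).real (10, 0, 0) =
        ∑ k ∈ Finset.range (numNorms m), (1 + s.real (6, s.assignment j, k)) ∧
      (scanProg.exec J s).real (11, 0, 0) = maxUpTo (s.vectors j) (numNorms m) := by
  rw [scanProg, Prog.exec_seq, Prog.exec_seq]
  set s0 := Prog.exec J (.setReal 11 (.lit 0) (.lit 0) (rLit 0))
    (Prog.exec J (.setReal 10 (.lit 0) (.lit 0) (rLit 0)) s) with hs0
  have hE0 : Env m n s0 := (hE.exec J _ (by decide)).exec J _ (by decide)
  have hj0 : s0.nat (6, 0, 0) = j := by simp [hs0, Prog.exec, hj]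
  have e5 : ∀ i k, s0.real (5, i, k) = s.real (5, i, k) := by simp [hs0, Prog.exec]
  have e6 : ∀ i k, s0.real (6, i, k) = s.real (6, i, k) := by simp [hs0, Prog.exec]
  have e1 : ∀ i k, s0.nat (1, i, k) = s.nat (1, i, k) := by simp [hs0, Prog.exec]
  refine Prog.exec_loop_induction J
    (fun t s' => s'.real (10, 0, 0) =
        ∑ k ∈ Finset.range t, (1 + s.real (6, s.assignment j, k)) ∧
      s'.real (11, 0, 0) = maxUpTo (s.vectors j) t)
    (by simp [hE0.norms]) (by simp [hs0, Prog.exec, NExp.eval, maxUpTo]) ?_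
  rintro t s' _ hag ⟨I1, I2⟩
  have hj' : s'.nat (6, 0, 0) = j := by rw [hag.nat 6 (by decide), hj0]
  have h1 : s'.nat (1, j, 0) = s.assignment j := by rw [hag.nat 1 (by decide), e1]; rfl
  have h5 : ∀ i k, s'.real (5, i, k) = s.real (5, i, k) := fun i k => by
    rw [hag.real 5 (by decide), e5]
  have h6 : ∀ i k, s'.real (6, i, k) = s.real (6, i, k) := fun i k => by
    rw [hag.real 6 (by decide), e6]
  rw [Prog.exec_seq]
  set s1 := (Prog.setReal 10 (.lit 0) (.lit 0) (.add (rCell 10)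
    (.add (rLit 1) (.get 6 (.get 1 (nCell 6) (.lit 0)) (nCell 7))))).exec J
      (s'.writeNat (7, 0, 0) t).tick with hs1
  have k10 : s1.real (10, 0, 0) =
      ∑ k ∈ Finset.range (t + 1), (1 + s.real (6, s.assignment j, k)) := by
    simp [hs1, Prog.exec, NExp.eval, RExp.eval, hj', h1, h6, I1, Finset.sum_range_succ]
  have k11 : s1.real (11, 0, 0) = maxUpTo (s.vectors j) t := by simp [hs1, Prog.exec, I2]
  have k5 : s1.real (5, j, t) = s.vectors j t := by simp [hs1, Prog.exec, h5, State.vectors]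
  have k6 : s1.nat (6, 0, 0) = j := by simp [hs1, Prog.exec, hj']
  have k7 : s1.nat (7, 0, 0) = t := by simp [hs1, Prog.exec]
  rw [Prog.exec]
  simp only [Test.Holds, RExp.eval, entryExp, nCell_eval, rCell_eval, k11, k5, k6, k7]
  split_ifs with h
  · refine ⟨by simp [Prog.exec, k10], ?_⟩
    simp [Prog.exec, NExp.eval, RExp.eval, maxUpTo, max_eq_right h, k5, k6, k7]
  · refine ⟨by simp [Prog.exec, k10], ?_⟩
    simp [Prog.exec, maxUpTo, max_eq_left (not_le.1 h).le, k11]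

/-- Move the current job to the machine with the least load by reassigned jobs. -/
def moveProg : Prog :=
  .seq (argminProg 9) <|
  .seq (.setNat 1 (nCell 6) (.lit 0) (nCell 10))
    (.setReal 9 (nCell 10) (.lit 0) (.add (.get 9 (nCell 10) (.lit 0)) (rCell 11)))

theorem moveProg_spec (J : JobAccess) {m n j : ℕ} (hm : 0 < m) {s : State} (hE : Env m n s)
    (hj : s.nat (6, 0, 0) = j) :
    ∃ b < m, (∀ i < m, s.real (9, b, 0) ≤ s.real (9, i, 0)) ∧
      (∀ i, (moveProg.exec J s).real (9, i, 0) =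
        if i = b then s.real (9, i, 0) + s.real (11, 0, 0) else s.real (9, i, 0)) ∧
      ∀ i, (moveProg.exec J s).assignment i = if i = j then b else s.assignment i := by
  obtain ⟨hb, hmin⟩ := argminProg_spec J hm hE 9
  refine ⟨_, hb, hmin, ?_⟩
  rw [moveProg, Prog.exec_seq, Prog.exec_seq]
  set s1 := (argminProg 9).exec J s with hs1
  have hj1 : s1.nat (6, 0, 0) = j := by rw [hs1, Prog.exec_nat J _ (by decide), hj]
  have e9 : ∀ i k, s1.real (9, i, k) = s.real (9, i, k) := fun i k => by
    rw [hs1, Prog.exec_real J _ (by decide)]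
  have e11 : ∀ i k, s1.real (11, i, k) = s.real (11, i, k) := fun i k => by
    rw [hs1, Prog.exec_real J _ (by decide)]
  have e1 : ∀ i k, s1.nat (1, i, k) = s.nat (1, i, k) := fun i k => by
    rw [hs1, Prog.exec_nat J _ (by decide)]
  constructor
  · intro i
    simp only [Prog.exec, NExp.eval, RExp.eval, State.tick_real, State.writeReal_real,
      nCell_eval, rCell_eval, State.tick_nat, State.writeNat_nat, State.writeNat_real,
      Prod.mk.injEq, hj1, e9, e11]
    norm_num
    by_cases h : i = s1.nat (10, 0, 0)
    · rw [if_pos h, if_pos h, ← h]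
    · rw [if_neg h, if_neg h]
  · intro i
    simp [Prog.exec, NExp.eval, State.assignment, hj1, e1]

def reassignProg : Prog :=
  .loop 6 jobsExp <|
    .seq scanProg <|
    .ite (.not (.realLE (rCell 10) (.mul (.mul (.ofNat (nCell 2)) (.ofNat (nCell 2)))
      (.mul (.ofNat (nCell 2)) (.ofNat (nCell 2)))))) moveProg .skip

-- List scheduling: the least loaded machine has at most the average load `R` of reassigned jobs,
-- and one more job adds at most `1 / 4`. Overfullness always refers to the greedy assignment: array
-- `6` is not updated, and job `t` has not moved before round `t`.
open Classical in
theorem reassignProg_spec (J : JobAccess) {m n : ℕ} (hm : 0 < m) {s : State} (hE : Env m n s)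
    (hv1 : ∀ j < n, ∀ k < numNorms m, s.vectors j k ≤ 1 / 4)
    (ha : ∀ j < n, s.assignment j < m)
    (h6 : ∀ i, ∀ k < numNorms m, s.real (6, i, k) = loadProd s.vectors s.assignment n i k - 1)
    (h9 : ∀ i, s.real (9, i, 0) = 0) {R : ℝ} (hR : 0 ≤ R)
    (hU : ∑ j ∈ Finset.range n with Overfull s.vectors s.assignment (numNorms m) n (s.assignment j),
      maxUpTo (s.vectors j) (numNorms m) ≤ R * m) :
    (∀ j < n, (reassignProg.exec J s).assignment j < m) ∧
    (∀ j < n, ¬ Overfull s.vectors s.assignment (numNorms m) n (s.assignment j) →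
      (reassignProg.exec J s).assignment j = s.assignment j) ∧
    ∀ i < m, ∑ j ∈ Finset.range n with
        Overfull s.vectors s.assignment (numNorms m) n (s.assignment j) ∧
          (reassignProg.exec J s).assignment j = i,
      maxUpTo (s.vectors j) (numNorms m) ≤ R + 1 / 4 := by
  have hm' : (0 : ℝ) < m := by exact_mod_cast hm
  set D := numNorms m with hD
  set bad : ℕ → Prop := fun j => Overfull s.vectors s.assignment D n (s.assignment j) with hbad
  set u : ℕ → ℝ := fun j => maxUpTo (s.vectors j) D with hu
  have hu1 : ∀ j < n, u j ≤ 1 / 4 := fun j hj => maxUpTo_le (by norm_num) (hv1 j hj)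
  have hu0 : ∀ j, 0 ≤ u j := fun j => maxUpTo_nonneg _ _
  have key : (∀ j < n, (reassignProg.exec J s).assignment j < m) ∧
      (∀ j ≥ n, (reassignProg.exec J s).assignment j = s.assignment j) ∧
      (∀ j, ¬ bad j → (reassignProg.exec J s).assignment j = s.assignment j) ∧
      (∀ i, (reassignProg.exec J s).real (9, i, 0) = ∑ j ∈ Finset.range n with
        bad j ∧ (reassignProg.exec J s).assignment j = i, u j) ∧
      ∀ i < m, (reassignProg.exec J s).real (9, i, 0) ≤ R + 1 / 4 := by
    refine Prog.exec_loop_induction J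
      (fun t s' => (∀ j < n, s'.assignment j < m) ∧
        (∀ j ≥ t, s'.assignment j = s.assignment j) ∧
        (∀ j, ¬ bad j → s'.assignment j = s.assignment j) ∧
        (∀ i, s'.real (9, i, 0) = ∑ j ∈ Finset.range t with
          bad j ∧ s'.assignment j = i, u j) ∧
        ∀ i < m, s'.real (9, i, 0) ≤ R + 1 / 4) (by simp [hE.jobs]) ?_ ?_
    · refine ⟨ha, fun _ _ => rfl, fun _ _ => rfl, by simp [h9], fun i _ => ?_⟩
      simp only [State.tick_real, h9]
      linarith
    rintro t s' ht hag ⟨I1, I2, I3, I4, I5⟩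
    have hE0 := (hE.of_agree hag (by decide)).round (a := 6) (t := t) (by decide)
    set s0 := (s'.writeNat (6, 0, 0) t).tick with hs0
    have hj0 : s0.nat (6, 0, 0) = t := by simp [hs0]
    have a0 : s0.assignment = s'.assignment := by funext j; simp [State.assignment, hs0]
    have v0 : s0.vectors = s.vectors := by
      funext j k
      exact hag.real 5 (by decide) j k
    obtain ⟨k10, k11⟩ := scanProg_spec J hE0 hj0
    have h60 : ∀ i k, s0.real (6, i, k) = s.real (6, i, k) := hag.real 6 (by decide)
    have ht0 : s'.assignment t = s.assignment t := I2 t le_rfl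
    rw [a0, ht0] at k10
    rw [v0] at k11
    have k10' : (scanProg.exec J s0).real (10, 0, 0) =
        ∑ k ∈ Finset.range D, loadProd s.vectors s.assignment n (s.assignment t) k := by
      rw [k10]
      refine Finset.sum_congr rfl fun k hk => ?_
      rw [h60, h6 _ k (Finset.mem_range.1 hk)]
      ring
    rw [Prog.exec_seq]
    set s1 := scanProg.exec J s0 with hs1
    have hE1 : Env m n s1 := hE0.exec J _ (by decide)
    have hj1 : s1.nat (6, 0, 0) = t := by rw [hs1, Prog.exec_nat J _ (by decide), hj0]
    have a1 : s1.assignment = s'.assignment := by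
      rw [← a0]
      funext j
      exact Prog.exec_nat J scanProg (by decide) s0 j 0
    have h91 : ∀ i, s1.real (9, i, 0) = s'.real (9, i, 0) := fun i => by
      rw [hs1, Prog.exec_real J _ (by decide)]; rfl
    rw [Prog.exec]
    have hcond : (Test.not (.realLE (rCell 10) (.mul (.mul (.ofNat (nCell 2)) (.ofNat (nCell 2)))
        (.mul (.ofNat (nCell 2)) (.ofNat (nCell 2)))))).Holds s1 ↔ bad t := by
      simp only [Test.Holds, RExp.eval, rCell_eval, nCell_eval, k10', hE1.norms, not_le, hbad,
        Overfull]
      rw [show (D : ℝ) * D * (D * D) = (D : ℝ) ^ 4 by ring]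
    have hsum_succ : ∀ (i : ℕ) (a : ℕ → ℕ), ∑ j ∈ Finset.range (t + 1) with bad j ∧ a j = i, u j =
        (∑ j ∈ Finset.range t with bad j ∧ a j = i, u j) + if bad t ∧ a t = i then u t else 0 := by
      intro i a
      rw [Finset.sum_filter, Finset.sum_range_succ, ← Finset.sum_filter]
    by_cases hb : bad t
    · rw [if_pos (hcond.2 hb)]
      obtain ⟨b, hbm, hmin, hL, hA⟩ := moveProg_spec J hm (s := s1.tick)
        (hE1.of_agree (ws := []) (wr := []) ⟨fun _ _ _ _ => rfl, fun _ _ _ _ => rfl⟩ (by simp)) hj1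
      set s2 := moveProg.exec J s1.tick with hs2
      simp only [State.tick_real, h91, k11] at hL hmin
      have hA' : ∀ j, s2.assignment j = if j = t then b else s'.assignment j := fun j => by
        rw [hA j, ← a1]; rfl
      have hlt : ∀ i, ∑ j ∈ Finset.range t with bad j ∧ s2.assignment j = i, u j =
          s'.real (9, i, 0) := by
        intro i
        rw [I4]
        refine Finset.sum_congr (Finset.filter_congr fun j hj => ?_) fun _ _ => rfl
        rw [hA' j, if_neg (Finset.mem_range.1 hj).ne]
      refine ⟨fun j hj => ?_, fun j hj => ?_, fun j hj => ?_, fun i => ?_, fun i hi => ?_⟩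
      · rw [hA']
        split_ifs
        · exact hbm
        · exact I1 j hj
      · rw [hA', if_neg (by omega)]
        exact I2 j (by omega)
      · have : j ≠ t := fun h => hj (h ▸ hb)
        rw [hA', if_neg this]
        exact I3 j hj
      · rw [hsum_succ, hlt, hL, hA', if_pos rfl]
        by_cases h : i = b
        · rw [if_pos h, if_pos ⟨hb, h.symm⟩]
        · rw [if_neg h, if_neg fun h' => h h'.2.symm, add_zero]
      · rw [hL]
        split_ifs with h
        · have h1 : (m : ℝ) * s'.real (9, b, 0) ≤ R * m := by
            calc (m : ℝ) * s'.real (9, b, 0) = ∑ _i ∈ Finset.range m, s'.real (9, b, 0) := by simp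
              _ ≤ ∑ i ∈ Finset.range m, s'.real (9, i, 0) :=
                  Finset.sum_le_sum fun i hi => hmin i (Finset.mem_range.1 hi)
              _ = ∑ j ∈ Finset.range t with bad j, u j := by
                  rw [← Finset.sum_fiberwise_of_maps_to (s := (Finset.range t).filter bad)
                    (t := Finset.range m) (g := s'.assignment) fun j hj => ?_]
                  · refine Finset.sum_congr rfl fun i _ => ?_
                    rw [I4, Finset.filter_filter]
                  · simp only [Finset.mem_filter, Finset.mem_range] at hj ⊢
                    exact I1 j (by omega)
              _ ≤ ∑ j ∈ Finset.range n with bad j, u j :=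
                  Finset.sum_le_sum_of_subset_of_nonneg
                    (Finset.filter_subset_filter _ fun j hj => by
                      simp only [Finset.mem_range] at hj ⊢; omega) fun j _ _ => hu0 j
              _ ≤ R * m := hU
          have h2 : s'.real (9, b, 0) ≤ R := by nlinarith
          rw [h]
          exact add_le_add h2 (hu1 t ht)
        · exact I5 i hi
    · rw [if_neg fun h => hb (hcond.1 h)]
      have a2 : ∀ j, (Prog.skip.exec J s1.tick).assignment j = s'.assignment j := fun j => by
        rw [← a1]; rfl
      have h92 : ∀ i, (Prog.skip.exec J s1.tick).real (9, i, 0) = s'.real (9, i, 0) := h91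
      simp only [a2, h92]
      refine ⟨I1, fun j hj => I2 j (by omega), I3, fun i => ?_, I5⟩
      rw [hsum_succ, if_neg fun h => hb h.1, add_zero, I4]
  refine ⟨key.1, fun j _ => key.2.2.1 j, fun i hi => ?_⟩
  rw [← key.2.2.2.1 i]
  exact key.2.2.2.2 i hi

/-! ### The whole program -/

def mainProg : Prog :=
  .seq totalProg <| .seq vectorsProg <| .seq greedyProg reassignProg

def stochLBProg : Prog := .seq powersProg mainProg

theorem stochLBProg_coinFree : stochLBProg.CoinFree := by
  simp [stochLBProg, mainProg, powersProg, doubleProg, totalProg, vectorsProg, searchProg,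
    sumsProg, fillProg, greedyProg, updateMeanProg, increasesProg, incrementProg, argminProg,
    updateLoadProg, reassignProg, scanProg, scanLoop, moveProg, Prog.CoinFree]

theorem stochLBProg_steps_le (J : JobAccess) {m n : ℕ} (hm : 0 < m) :
    (stochLBProg.exec J (State.init m n)).steps ≤
      stochLBProg.cost 1 * 2 ^ stochLBProg.depth * (m + n) ^ stochLBProg.depth := by
  set s1 := powersProg.exec J (State.init m n) with hs1
  have hE : Env m n s1 := powersProg_spec J n hm
  have h1 : s1.steps ≤ (State.init m n).steps + powersProg.cost (n + m + 1) := by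
    refine Prog.exec_steps_le J (A := [0]) (f := (State.init m n).nat) _ (by decide) ?_ _
      fun _ _ _ _ => rfl
    simp only [powersProg, doubleProg, Prog.LoopsLE, HasNat, nCell_eval]
    simp only [true_and, and_true]
    intro s hs
    rw [hs 0 (by simp)]
    simp only [State.init]
    norm_num
    omega
  -- From here on the number of norms in array `2` is also a loop bound. `powersProg` writes to it,
  -- which is why the two phases are bounded separately.
  have h2 : (mainProg.exec J s1).steps ≤ s1.steps + mainProg.cost (n + m + 1) := by
    refine Prog.exec_steps_le J (A := [0, 2]) (f := s1.nat) _ (by decide) ?_ _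
      fun _ _ _ _ => rfl
    have e1 : ∀ s, HasNat [0, 2] s1.nat s → s.nat (0, 0, 0) = m := fun s hs => by
      rw [hs 0 (by simp), hE.machines]
    have e2 : ∀ s, HasNat [0, 2] s1.nat s → s.nat (0, 1, 0) = n := fun s hs => by
      rw [hs 0 (by simp), hE.jobs]
    have e3 : ∀ s, HasNat [0, 2] s1.nat s → s.nat (2, 0, 0) ≤ m := fun s hs => by
      rw [hs 2 (by simp), hE.norms]
      exact numNorms_le hm
    have l1 : ∀ s, HasNat [0, 2] s1.nat s → (nCell 0).eval s ≤ n + m + 1 := fun s hs => by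
      rw [nCell_eval, e1 s hs]; omega
    have l2 : ∀ s, HasNat [0, 2] s1.nat s → jobsExp.eval s ≤ n + m + 1 := fun s hs => by
      rw [jobsExp_eval, e2 s hs]; omega
    have l3 : ∀ s, HasNat [0, 2] s1.nat s → (nCell 2).eval s ≤ n + m + 1 := fun s hs => by
      rw [nCell_eval]; have := e3 s hs; omega
    have l4 : ∀ s, HasNat [0, 2] s1.nat s → candidatesExp.eval s ≤ n + m + 1 := fun s hs => by
      simp [candidatesExp, NExp.eval, e1 s hs, e2 s hs]
    simp only [mainProg, totalProg, vectorsProg, searchProg,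
      sumsProg, fillProg, greedyProg, updateMeanProg, increasesProg, incrementProg, argminProg,
      updateLoadProg, reassignProg, scanProg, scanLoop, moveProg, Prog.LoopsLE, and_true, true_and]
    tauto
  have h3 : (stochLBProg.exec J (State.init m n)).steps ≤ stochLBProg.cost (n + m + 1) := by
    rw [stochLBProg, Prog.exec_seq, ← hs1]
    simp only [Prog.cost]
    have : (State.init m n).steps = 0 := rfl
    omega
  refine h3.trans ((Prog.cost_le (n + m + 1) (by omega) _).trans ?_)
  rw [mul_assoc, ← mul_pow]
  exact Nat.mul_le_mul_left _ (Nat.pow_le_pow_left (by omega) _)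

/-- The program outputs an assignment for which the vectors given by least good candidates for the
thresholds are balanced. -/
theorem stochLBProg_spec (J : JobAccess) {m n : ℕ} (hm : 0 < m)
    (hgood : ∀ k < numNorms m, J.Good m n k (n + m + 1))
    (h0 : ∀ k < numNorms m, ∀ j < n, ∀ t, 0 ≤ J.truncEff j (2 ^ (numNorms m - k)) (J.thr m n t))
    (h1 : ∀ k < numNorms m, ∀ j < n, ∀ t,
      J.truncEff j (2 ^ (numNorms m - k)) (J.thr m n t) ≤ 1 / 4) :
    (∀ j < n, (stochLBProg.exec J (State.init m n)).assignment j < m) ∧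
    ∀ k < numNorms m, ∃ T, 0 < T ∧ T ≤ n + m + 1 ∧ J.Good m n k T ∧
      (∀ t, 0 < t → t < T → ¬ J.Good m n k t) ∧
      ∀ i < m, ∑ j ∈ Finset.range n with
          (stochLBProg.exec J (State.init m n)).assignment j = i,
        J.truncEff j (2 ^ (numNorms m - k)) (J.thr m n T) ≤
          8 * Real.log (numNorms m) + (4 * Real.exp 11 + 1 / 4) := by
  classical
  rw [stochLBProg, mainProg, Prog.exec_seq, Prog.exec_seq, Prog.exec_seq, Prog.exec_seq]
  have hE1 := powersProg_spec J n hm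
  set s1 := powersProg.exec J (State.init m n) with hs1
  have r1 : ∀ b i j, s1.real (b, i, j) = 0 := fun b i j => by
    rw [hs1, Prog.exec_real J _ (by simp [powersProg, doubleProg, Prog.realWrites])]; rfl
  have ht := totalProg_spec J hE1 (r1 0 0 0)
  set s2 := totalProg.exec J s1 with hs2
  have hE2 : Env m n s2 := hE1.exec J _ (by decide)
  have hvec := vectorsProg_spec J hE2 ht hgood
  set s3 := vectorsProg.exec J s2 with hs3
  have hE3 : Env m n s3 := hE2.exec J _ (by decide)
  have r3 : ∀ b ∉ vectorsProg.realWrites, b ∉ totalProg.realWrites →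
      ∀ i j, s3.real (b, i, j) = 0 := fun b hb hb' i j => by
    rw [hs3, Prog.exec_real J _ hb, hs2, Prog.exec_real J _ hb', r1]
  choose! T hT0 hTN hTg hTm hTv using hvec
  have hv0 : ∀ j < n, ∀ k < numNorms m, 0 ≤ s3.vectors j k := fun j hj k hk => by
    rw [State.vectors, hTv k hk j hj]; exact h0 k hk j hj _
  have hv1 : ∀ j < n, ∀ k < numNorms m, s3.vectors j k ≤ 1 / 4 := fun j hj k hk => by
    rw [State.vectors, hTv k hk j hj]; exact h1 k hk j hj _
  have hv1' : ∀ j < n, ∀ k < numNorms m, s3.vectors j k ≤ 1 := fun j hj k hk =>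
    (hv1 j hj k hk).trans (by norm_num)
  have hsum : ∀ k < numNorms m, ∑ j ∈ Finset.range n, s3.vectors j k ≤ 11 * m := fun k hk => by
    refine le_trans (le_of_eq ?_) (hTg k hk).2
    exact Finset.sum_congr rfl fun j hj => hTv k hk j (Finset.mem_range.1 hj)
  obtain ⟨ha, hlp, hpot⟩ := greedyProg_spec J hm hE3 hv0 (r3 6 (by decide) (by decide))
    (fun k => r3 7 (by decide) (by decide) k 0)
  set s4 := greedyProg.exec J s3 with hs4
  have hE4 : Env m n s4 := hE3.exec J _ (by decide)
  have v4 : s4.vectors = s3.vectors := by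
    funext j k
    exact Prog.exec_real J greedyProg (by decide) s3 j k
  have h9 : ∀ i, s4.real (9, i, 0) = 0 := fun i => by
    rw [hs4, Prog.exec_real J _ (by decide), r3 9 (by decide) (by decide)]
  have hD : 0 < numNorms m := Nat.succ_pos _
  obtain ⟨ha5, hgood5, hR⟩ := reassignProg_spec J hm hE4 (by rw [v4]; exact hv1) ha
    (by rw [v4]; exact hlp) h9 (by positivity : 0 ≤ 4 * Real.exp 11)
    (by rw [v4]; exact sum_overfull_le hm hD hv0 hv1' hsum hpot ha)
  rw [v4] at hgood5 hR
  refine ⟨ha5, fun k hk => ⟨T k, hT0 k hk, hTN k hk, hTg k hk, hTm k hk, fun i hi => ?_⟩⟩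
  refine le_trans (le_of_eq ?_) (sum_reassigned_le hD hv0 hv1' hgood5 (hR i hi) hk)
  exact Finset.sum_congr rfl fun j hj =>
    (hTv k hk j (Finset.mem_range.1 (Finset.mem_filter.1 hj).1)).symm

/-! ### The approximation guarantee -/

section

variable {Ω : Type*} [MeasurableSpace Ω] {P : Measure Ω} {m n : ℕ} {X : Fin n → Ω → ℝ}

@[simp] theorem jobAccess_excMean (j : Fin n) (θ : ℝ) :
    (jobAccess P X).excMean j θ = ∫ ω, exceptional (X j) θ ω ∂P := by
  simp [jobAccess]

@[simp] theorem jobAccess_truncEff (j : Fin n) (lam : ℕ) (θ : ℝ) :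
    (jobAccess P X).truncEff j lam θ = effSize P lam (scaled (X j) θ) := by
  simp only [jobAccess, j.2, dif_pos]
  rfl

theorem jobAccess_total (h0 : ∀ j ω, 0 ≤ X j ω) :
    (jobAccess P X).total n = ∑ j, ∫ ω, X j ω ∂P := by
  rw [JobAccess.total, Finset.sum_range]
  refine Finset.sum_congr rfl fun j _ => ?_
  rw [jobAccess_excMean]
  refine integral_congr_ae (.of_forall fun ω => ?_)
  exact Set.indicator_of_mem (s := {ω | 0 ≤ X j ω}) (h0 j ω) (X j)

theorem jobAccess_total_nonneg (h0 : ∀ j ω, 0 ≤ X j ω) : 0 ≤ (jobAccess P X).total n := by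
  rw [jobAccess_total h0]
  exact Finset.sum_nonneg fun j _ => integral_nonneg (h0 j)

theorem jobAccess_thr_nonneg (h0 : ∀ j ω, 0 ≤ X j ω) (t : ℕ) :
    0 ≤ (jobAccess P X).thr m n t := by
  have := jobAccess_total_nonneg (P := P) h0
  unfold JobAccess.thr
  positivity

theorem jobAccess_good_iff {k t : ℕ} : (jobAccess P X).Good m n k t ↔
    ∑ j, ∫ ω, exceptional (X j) ((jobAccess P X).thr m n t) ω ∂P ≤
        2 ^ k * (jobAccess P X).thr m n t ∧
      ∑ j, effSize P ((2 ^ (numNorms m - k) : ℕ) : ℝ)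
        (scaled (X j) ((jobAccess P X).thr m n t)) ≤ 11 * m := by
  rw [JobAccess.Good, Finset.sum_range, Finset.sum_range]
  simp only [jobAccess_excMean, jobAccess_truncEff]

theorem two_le_base {k : ℕ} (hk : k < numNorms m) : (2 : ℝ) ≤ ((2 ^ (numNorms m - k) : ℕ) : ℝ) := by
  have : 2 ^ 1 ≤ 2 ^ (numNorms m - k) := Nat.pow_le_pow_right (by norm_num) (by omega)
  exact_mod_cast this

/-- With `m ≤ 2 ^ numNorms m ≤ 2 m`, this places the base between `m / ℓ` and `2 m / ℓ`: the upper
bound serves the lower bound on the optimum, and vice versa. -/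
theorem base_mul_eq {k : ℕ} (hk : k < numNorms m) :
    ((2 ^ (numNorms m - k) : ℕ) : ℝ) * (2 ^ k : ℕ) = (2 : ℝ) ^ numNorms m := by
  push_cast
  rw [← pow_add]
  congr 1
  omega

theorem two_pow_numNorms_le (hm : 0 < m) : (2 : ℝ) ^ numNorms m ≤ 2 * m := by
  have := (two_pow_le_iff_lt_numNorms hm (Nat.log 2 m)).2 (Nat.lt_succ_self _)
  rw [numNorms, pow_succ, mul_comm]
  exact mul_le_mul_of_nonneg_left (by exact_mod_cast this) (by norm_num)

theorem le_two_pow_numNorms (hm : 0 < m) : (m : ℝ) ≤ (2 : ℝ) ^ numNorms m := by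
  have := (two_pow_le_iff_lt_numNorms hm (numNorms m)).not.2 (lt_irrefl _)
  exact_mod_cast (not_le.1 this).le

variable [IsProbabilityMeasure P]

/-- The last candidate is the total mean `M`. The scaled parts have total mean at most `1 / 4`, so
their effective sizes sum to at most `(lam - 1) / 2`, where `lam ≤ 2 m`. The case `M = 0` is covered
by division by zero being `0`. -/
theorem jobAccess_good_last (hX : ∀ j, Measurable (X j)) (h0 : ∀ j ω, 0 ≤ X j ω)
    (hi : ∀ j, Integrable (X j) P) (hm : 0 < m) {k : ℕ} (hk : k < numNorms m) :
    (jobAccess P X).Good m n k (n + m + 1) := by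
  have hM := jobAccess_total (P := P) h0
  have hM0 := jobAccess_total_nonneg (P := P) h0
  have hthr : (jobAccess P X).thr m n (n + m + 1) = (jobAccess P X).total n :=
    mul_div_cancel₀ _ (by positivity)
  rw [jobAccess_good_iff, hthr]
  set M := (jobAccess P X).total n with hMdef
  set lam : ℝ := ((2 ^ (numNorms m - k) : ℕ) : ℝ) with hlam
  have hlam2 : 2 ≤ lam := two_le_base hk
  constructor
  · have h1 : ∑ j, ∫ ω, exceptional (X j) M ω ∂P ≤ M := by
      conv_rhs => rw [hM]
      exact Finset.sum_le_sum fun j _ => integral_mono (integrable_exceptional (hX j) (hi j) _)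
        (hi j) fun ω => Set.indicator_le_self' (fun ω _ => h0 j ω) ω
    have h2 : (1 : ℝ) ≤ 2 ^ k := one_le_pow₀ (by norm_num)
    nlinarith
  · have h1 : ∀ j, effSize P lam (scaled (X j) M) ≤
        2 * (lam - 1) * ((∫ ω, X j ω ∂P) / (4 * M)) := by
      intro j
      refine (effSize_le_mul_integral hlam2 (measurable_scaled (hX j) M)
        (scaled_nonneg (h0 j) hM0)
        fun ω => (scaled_le hM0 ω).trans (by norm_num)).trans ?_
      refine mul_le_mul_of_nonneg_left ?_ (by linarith)
      simp only [scaled]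
      rw [integral_div]
      exact div_le_div_of_nonneg_right (integral_mono (integrable_trunc (hX j) (hi j) _) (hi j)
        fun ω => trunc_le (h0 j) M ω) (by positivity)
    have h2 : M / (4 * M) ≤ 1 / 4 := by
      rcases hM0.eq_or_lt with h | h
      · rw [← h]; norm_num
      · exact le_of_eq (by field_simp)
    have h3 : lam ≤ 2 * m := by
      refine le_trans ?_ (two_pow_numNorms_le hm)
      rw [← base_mul_eq hk]
      refine le_mul_of_one_le_right (by linarith) ?_
      exact_mod_cast Nat.one_le_two_pow
    calc ∑ j, effSize P lam (scaled (X j) M)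
        ≤ ∑ j, 2 * (lam - 1) * ((∫ ω, X j ω ∂P) / (4 * M)) := Finset.sum_le_sum fun j _ => h1 j
      _ = 2 * (lam - 1) * (M / (4 * M)) := by
          rw [← Finset.mul_sum, ← Finset.sum_div, ← hM]
      _ ≤ 2 * (lam - 1) * (1 / 4) := mul_le_mul_of_nonneg_left h2 (by linarith)
      _ ≤ 11 * m := by
          have : (0 : ℝ) ≤ m := Nat.cast_nonneg m
          linarith

/-- Thresholds that are not good are of the order of the optimum at most. -/
theorem half_le_expTop_of_not_good (hX : ∀ j, Measurable (X j)) (h0 : ∀ j ω, 0 ≤ X j ω)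
    (hi : ∀ j, Integrable (X j) P) (hind : iIndepFun X P) (hm : 0 < m) {k t : ℕ}
    (hk : k < numNorms m) (hpos : 0 < (jobAccess P X).thr m n t)
    (hbad : ¬ (jobAccess P X).Good m n k t) (τ : Fin n → Fin m) :
    ((2 ^ k : ℕ) : ℝ) * (jobAccess P X).thr m n t / 2 ≤ expTop P X (2 ^ k) τ := by
  rw [jobAccess_good_iff, not_and_or, not_le, not_le] at hbad
  rcases hbad with h | h
  · exact half_le_expTop_of_exceptional hX h0 hi hind _ (by push_cast; exact h.le) τ
  · refine half_le_expTop_of_effSize hX h0 hi hind hpos (two_le_base hk) ?_ h.le τ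
    rw [base_mul_eq hk]
    exact two_pow_numNorms_le hm

/-- The truncated parts account for at most `n θ` of the total `(n + m + 1) θ`, so the exceptional
parts have mean at least `(m + 1) θ > 2 ^ k θ`. This choice of grid guarantees that the least good
candidate has a positive predecessor. -/
theorem not_good_one (hX : ∀ j, Measurable (X j)) (h0 : ∀ j ω, 0 ≤ X j ω)
    (hi : ∀ j, Integrable (X j) P) (hm : 0 < m) {k : ℕ} (hk : k < numNorms m)
    (hM : 0 < (jobAccess P X).total n) : ¬ (jobAccess P X).Good m n k 1 := by
  rw [jobAccess_good_iff, not_and_or]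
  left
  set θ := (jobAccess P X).thr m n 1 with hθ
  have hθM : θ * ((n : ℝ) + m + 1) = (jobAccess P X).total n := by
    rw [hθ, JobAccess.thr]
    push_cast
    field_simp
  have hθ0 : 0 < θ := by
    rw [hθ, JobAccess.thr]
    positivity
  have h1 : ∀ j, ∫ ω, X j ω ∂P ≤ θ + ∫ ω, exceptional (X j) θ ω ∂P := by
    intro j
    have he := integrable_exceptional (hX j) (hi j) θ
    calc ∫ ω, X j ω ∂P ≤ ∫ ω, (θ + exceptional (X j) θ ω) ∂P := by
          refine integral_mono (hi j) ((integrable_const _).add he) fun ω => ?_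
          have := trunc_add_exceptional (X j) θ ω
          have := trunc_le_threshold (Z := X j) hθ0.le ω
          linarith
      _ = _ := by rw [integral_add (integrable_const _) he]; simp
  have h2 : (jobAccess P X).total n ≤ n * θ + ∑ j, ∫ ω, exceptional (X j) θ ω ∂P := by
    rw [jobAccess_total h0]
    refine (Finset.sum_le_sum fun j _ => h1 j).trans (le_of_eq ?_)
    rw [Finset.sum_add_distrib]
    simp
  have h3 : (2 : ℝ) ^ k ≤ m := by exact_mod_cast (two_pow_le_iff_lt_numNorms hm k).2 hk
  have h4 : (2 : ℝ) ^ k * θ ≤ m * θ := mul_le_mul_of_nonneg_right h3 hθ0.le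
  rw [not_le]
  nlinarith

/-- Balancing the effective sizes for the least good threshold gives an approximation. -/
theorem isApprox_of_effSize_le (hX : ∀ j, Measurable (X j)) (h0 : ∀ j ω, 0 ≤ X j ω)
    (hi : ∀ j, Integrable (X j) P) (hind : iIndepFun X P) (hm : 0 < m) {k T : ℕ}
    (hk : k < numNorms m) (hT0 : 0 < T) (hT : (jobAccess P X).Good m n k T)
    (hmin : ∀ t, 0 < t → t < T → ¬ (jobAccess P X).Good m n k t) {B : ℝ} (hB : 0 ≤ B)
    (σ : Fin n → Fin m)
    (hσ : ∀ i, ∑ j with σ j = i, effSize P ((2 ^ (numNorms m - k) : ℕ) : ℝ)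
      (scaled (X j) ((jobAccess P X).thr m n T)) ≤ B) :
    IsApprox P X (2 ^ k) (16 * B + 36) σ := by
  intro τ
  rcases (jobAccess_total_nonneg (P := P) h0).eq_or_lt with hM | hM
  · have h1 := expTop_le_sum_integral hX h0 hi (2 ^ k) σ
    rw [← jobAccess_total (P := P) h0, ← hM] at h1
    exact h1.trans (mul_nonneg (by linarith) (expTop_nonneg h0 _ τ))
  have hT1 : T ≠ 1 := by
    rintro rfl
    exact not_good_one hX h0 hi hm hk hM hT
  have hq : 0 < (jobAccess P X).total n / ((n + m + 1 : ℕ) : ℝ) := by positivity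
  have hpos : ∀ t, 0 < t → 0 < (jobAccess P X).thr m n t := fun t ht => by
    have : (0 : ℝ) < t := by exact_mod_cast ht
    unfold JobAccess.thr
    positivity
  set θ := (jobAccess P X).thr m n T with hθ
  -- As `T ≥ 2`, `T - 1 ≥ T / 2`.
  have hhalf : θ / 2 ≤ (jobAccess P X).thr m n (T - 1) := by
    have h2 : (2 : ℝ) ≤ T := by exact_mod_cast (by omega : 2 ≤ T)
    rw [hθ, JobAccess.thr, JobAccess.thr, Nat.cast_sub (by omega)]
    push_cast at hq ⊢
    nlinarith
  have hlow := half_le_expTop_of_not_good hX h0 hi hind hm hk (hpos (T - 1) (by omega))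
    (hmin (T - 1) (by omega) (by omega)) τ
  have hup := expTop_le_of_effSize hX h0 hi hind (ℓ := 2 ^ k) (hpos T hT0) (two_le_base hk) hB σ hσ
  have hexc := (jobAccess_good_iff.1 hT).1
  have hdiv : (m : ℝ) / ((2 ^ (numNorms m - k) : ℕ) : ℝ) ≤ ((2 ^ k : ℕ) : ℝ) := by
    rw [div_le_iff₀ (by have := two_le_base hk; linarith), mul_comm, base_mul_eq hk]
    exact le_two_pow_numNorms hm
  have hθ0 := hpos T hT0
  rw [← hθ] at hup hexc hθ0
  have hl0 : (0 : ℝ) ≤ ((2 ^ k : ℕ) : ℝ) := Nat.cast_nonneg _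
  have hcast : ((2 ^ k : ℕ) : ℝ) = 2 ^ k := by push_cast; rfl
  rw [← hcast] at hexc
  set l : ℝ := ((2 ^ k : ℕ) : ℝ) with hl
  have h4 : l * θ / 4 ≤ expTop P X (2 ^ k) τ := by
    have := mul_le_mul_of_nonneg_left hhalf hl0
    linarith
  have h5 : 4 * θ * ((m : ℝ) / ((2 ^ (numNorms m - k) : ℕ) : ℝ)) ≤ 4 * θ * l :=
    mul_le_mul_of_nonneg_left hdiv (by positivity)
  -- In units of `l θ` the upper bound is `4 (B + 1) + 4 + 1`, from the loads, the exponential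
  -- moments and the exceptional parts; the lower bound is `1 / 4`.
  calc expTop P X (2 ^ k) σ ≤ (16 * B + 36) * (l * θ / 4) := by linarith
    _ ≤ _ := mul_le_mul_of_nonneg_left h4 (by linarith)

end

/-- If `log m ≥ 1` then `numNorms m ≤ 3 log m`, and `log 3 ≤ 2`. Otherwise `m ≤ 2`, because `exp 1 <
3`, and the left side is at most `1`. -/
theorem log_numNorms_le {m : ℕ} (hm : 0 < m) :
    Real.log (numNorms m) ≤ 3 * max 1 (Real.log (Real.log m)) := by
  have h1 : (1 : ℝ) ≤ max 1 (Real.log (Real.log m)) := le_max_left _ _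
  have hD0 : (0 : ℝ) < numNorms m := by exact_mod_cast Nat.succ_pos _
  by_cases h : (1 : ℝ) ≤ Real.log m
  · have h2 : (numNorms m : ℝ) ≤ 3 * Real.log m := by
      have h3 : (Nat.log 2 m : ℝ) * Real.log 2 ≤ Real.log m := by
        rw [← Real.log_pow]
        refine Real.log_le_log (by positivity) ?_
        exact_mod_cast Nat.pow_log_le_self 2 hm.ne'
      have h4 := Real.log_two_gt_d9
      have h5 : (0 : ℝ) ≤ Nat.log 2 m := Nat.cast_nonneg _
      rw [numNorms]
      push_cast
      nlinarith
    have h3 : Real.log (numNorms m) ≤ Real.log 3 + Real.log (Real.log m) := by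
      rw [← Real.log_mul (by norm_num) (by linarith)]
      exact Real.log_le_log hD0 h2
    have h4 : Real.log 3 ≤ 2 := by
      have := Real.log_le_sub_one_of_pos (by norm_num : (0 : ℝ) < 3)
      linarith
    have h5 := le_max_right 1 (Real.log (Real.log m))
    linarith
  · have hm2 : m ≤ 2 := by
      by_contra! h3
      refine h ?_
      rw [Real.le_log_iff_exp_le (by exact_mod_cast hm)]
      have h4 : (3 : ℝ) ≤ m := by exact_mod_cast h3
      linarith [Real.exp_one_lt_d9]
    have h3 : (numNorms m : ℝ) ≤ 2 := by exact_mod_cast (numNorms_le hm).trans hm2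
    have h4 := Real.log_le_sub_one_of_pos hD0
    linarith

end StochLB

end

/-! ### The main theorem -/

open StochLB in
theorem theorem6 :
    ∃ (A : StochLB.Prog) (C : ℝ) (c k : ℕ),
      ∀ (m n : ℕ), 1 ≤ m →
      ∀ (Ω : Type*) [MeasurableSpace Ω] (P : Measure Ω) [IsProbabilityMeasure P]
        (X : Fin n → Ω → ℝ),
        (∀ j, Measurable (X j)) → (∀ j ω, 0 ≤ X j ω) → (∀ j, Integrable (X j) P) →
        iIndepFun X P →
        (∀ s ∈ (A.run (StochLB.jobAccess P X) (StochLB.State.init m n)).support,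
          s.steps ≤ c * (m + n) ^ k) ∧
        2 / 3 ≤ (A.run (StochLB.jobAccess P X) (StochLB.State.init m n)).toOuterMeasure
          {s | ∃ σ : Fin n → Fin m, s.Outputs σ ∧
            ∀ ℓ ∈ StochLB.POS m,
              StochLB.IsApprox P X ℓ (C * max 1 (Real.log (Real.log m))) σ} := by
  -- With `B = 8 log D + 4 exp 11 + 1 / 4` the factor `16 B + 36` is `128 log D + 64 exp 11 + 40`,
  -- and `log D` is at most `3` times the maximum, so `424 = 128 * 3 + 40`.
  refine ⟨stochLBProg, 424 + 64 * Real.exp 11, stochLBProg.cost 1 * 2 ^ stochLBProg.depth,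
    stochLBProg.depth, fun m n hm Ω _ P _ X hX h0 hi hind => ?_⟩
  rw [Prog.run_eq_pure_exec _ _ stochLBProg_coinFree]
  refine ⟨fun s hs => ?_, ?_⟩
  · rw [PMF.mem_support_pure_iff] at hs
    rw [hs]
    exact stochLBProg_steps_le _ hm
  have hbase : ∀ k < numNorms m, (1 : ℝ) < ((2 ^ (numNorms m - k) : ℕ) : ℝ) := fun k hk => by
    linarith [two_le_base hk]
  obtain ⟨ha, hspec⟩ := stochLBProg_spec (jobAccess P X) (m := m) (n := n) hm
    (fun k hk => jobAccess_good_last hX h0 hi hm hk)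
    (fun k hk j hj t => by
      rw [jobAccess_truncEff ⟨j, hj⟩]
      exact effSize_nonneg (hbase k hk) (measurable_scaled (hX _) _)
        (scaled_nonneg (h0 _) (jobAccess_thr_nonneg h0 t)) (scaled_le (jobAccess_thr_nonneg h0 t)))
    (fun k hk j hj t => by
      rw [jobAccess_truncEff ⟨j, hj⟩]
      exact effSize_le (hbase k hk) (measurable_scaled (hX _) _)
        (scaled_nonneg (h0 _) (jobAccess_thr_nonneg h0 t)) (scaled_le (jobAccess_thr_nonneg h0 t)))
  set s := stochLBProg.exec (jobAccess P X) (State.init m n) with hs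
  have hmem : s ∈ {s : State | ∃ σ : Fin n → Fin m, s.Outputs σ ∧ ∀ ℓ ∈ POS m,
      IsApprox P X ℓ ((424 + 64 * Real.exp 11) * max 1 (Real.log (Real.log m))) σ} := by
    refine ⟨fun j => ⟨s.assignment j, ha j j.2⟩, fun j => rfl, fun ℓ hℓ => ?_⟩
    simp only [POS, Finset.mem_image, Finset.mem_range] at hℓ
    obtain ⟨k, hk, rfl⟩ := hℓ
    obtain ⟨T, hT0, -, hTg, hTm, hTB⟩ := hspec k hk
    have hD : (1 : ℝ) ≤ numNorms m := by exact_mod_cast Nat.succ_pos _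
    have hlog := Real.log_nonneg hD
    have hexp := Real.exp_pos 11
    have happ := isApprox_of_effSize_le hX h0 hi hind hm hk hT0 hTg hTm
      (B := 8 * Real.log (numNorms m) + (4 * Real.exp 11 + 1 / 4)) (by positivity)
      (fun j => ⟨s.assignment j, ha j j.2⟩) fun i => by
        refine le_trans (le_of_eq ?_) (hTB i i.2)
        rw [Finset.sum_filter, Finset.sum_filter, Finset.sum_range]
        refine Finset.sum_congr rfl fun j _ => ?_
        rw [jobAccess_truncEff]
        simp only [Fin.ext_iff]
    intro τ
    refine (happ τ).trans (mul_le_mul_of_nonneg_right ?_ (expTop_nonneg h0 _ τ))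
    have h1 := log_numNorms_le hm
    have h2 : (1 : ℝ) ≤ max 1 (Real.log (Real.log m)) := le_max_left _ _
    nlinarith
  -- The run is deterministic, so success has probability `1`.
  have hone : (PMF.pure s).toOuterMeasure {s : State | ∃ σ : Fin n → Fin m, s.Outputs σ ∧
      ∀ ℓ ∈ POS m, IsApprox P X ℓ ((424 + 64 * Real.exp 11) * max 1 (Real.log (Real.log m))) σ} =
        1 := by
    rw [PMF.toOuterMeasure_pure_apply, if_pos hmem]
  rw [hone]
  exact ENNReal.div_le_of_le_mul (by norm_num)
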